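/- All Hilbert spaces are finite-dimensional and nonzero; juxtaposition of labels denotes tensor products. $\mathcal C(X,Y)$ is the set of quantum channels (completely positive trace preserving maps) $\mathcal B(X)\to\mathcal B(Y)$, $\mathfrak S(X)$ the set of states on $X$, $\mathcal M_k(X)$ the set of $k$-outcome measurements (POVMs) on $X$, and $C_\Phi$ the Choi matrix of $\Phi$. For $A=A_0A_1$, $A'=A_0'A_1'$, a superchannel $\Theta\in\mathcal C_2(A,A')$ consists of a preprocessing $\Theta_{\mathrm{pre}}\in\mathcal C(A_0',UA_0)$ and a postprocessing $\Theta_{\mathrm{post}}\in\mathcal C(UA_1,A_1')$ with some ancilla $U$; it maps $\Phi\in\mathcal C(A_0B_0,A_1B_1)$ to $(\Theta\otimes id_B)(\Phi)=(\Theta_{\mathrm{post}}\otimes id_{B_1})\circ(id_U\otimes\Phi)\circ(\Theta_{\mathrm{pre}}\otimes id_{B_0})$, and it is also regarded as a channel in $\mathcal C(A_0'A_1,A_1'A_0)$. For $X\in\mathcal B(YZ)$ hermitian and $\phi:\mathcal B(Y)\to\mathcal B(Z)$ hermitian-preserving put $\langle X,\phi\rangle=\langle\langle I_Z|(\phi\otimes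 id_Z)(X)|I_Z\rangle\rangle$, $|I_Z\rangle\rangle=\sum_i|ii\rangle$. Let $\|\cdot\|^{\diamond}_{Z|Y}$ and $\|\cdot\|^{2\diamond}_{A'|A}$ be the corresponding dual norms, i.e. the maximum of $\langle X,\phi\rangle$ over all $\phi$ with $-\Theta\le\phi\le\Theta$ in the completely positive order for some $\Theta\in\mathcal C(Y,Z)$, respectively for some $\Theta\in\mathcal C_2(A,A')\subseteq\mathcal C(A'_0A_1,A'_1A_0)$. (For positive $X$ these are $\max_{\Theta}\langle X,\Theta\rangle$, and $-\log$ of them is the conditional min-entropy, respectively the conditional 2-min-entropy.) For an ensemble $\mathcal E=\{\lambda_i,\rho_i\}$, $P_{\mathrm{succ}}(\mathcal E)=\max_M\sum_i\lambda_i\mathrm{Tr}[\rho_iM_i]$ over all measurements $M$. For an ensemble $\mathcal E=\{\lambda_{ij},\rho_{ij}\}$, $i\le k$, $j\le l$, on $R_0B_0R_1B_1$, $\Phi\in\mathcal C(A_0B_0,A_1B_1)$ and $M\in\mathcal M_l(B_1B_1)$, let $$P_{\mathrm{succ}}^{\mathcal C(R_0,A_0\cdot),\Phi,\mathcal M_k\otimes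 M}(\mathcal E)=\sup_{U,\alpha,N}\sum_{i,j}\lambda_{ij}\mathrm{Tr}\big[(N_i\otimes M_j)\,\big((id_U\otimes\Phi)\circ(\alpha\otimes id_{B_0})\otimes id_{R_1B_1}\big)(\rho_{ij})\big],$$ the supremum being over all ancillas $U$, all $\alpha\in\mathcal C(R_0,UA_0)$ and all $N\in\mathcal M_k(UA_1R_1)$; here $M$ acts on the output $B_1$ of $\Phi$ and on the system $B_1$ of the ensemble. **Theorem.** Let $\Phi_1\in\mathcal C(A_0B_0,A_1B_1)$, $\Phi_2\in\mathcal C(A'_0B_0,A'_1B_1)$ and let $\epsilon\ge0$. The following are equivalent. (i) $\delta_{A|A'}(\Phi_1\|\Phi_2):=\inf_{\Theta\in\mathcal C_2(A,A')}\|(\Theta\otimes id_B)(\Phi_1)-\Phi_2\|_\diamond\le\epsilon$, where $\|\Psi\|_\diamond=\max_{\rho\in\mathfrak S(XX)}\|(\Psi\otimes id_X)(\rho)\|_1$ for a map $\Psi$ with input space $X$. (ii) For all spaces $R_0,R_1$ and all $\rho\in\mathfrak S(R_0B_0R_1B_1)$, $$\|\rho*C_{\Phi_2}\|^{2\diamond}_{R|A'}\le\|\rho*C_{\Phi_1}\|^{2\diamond}_{R|A}+\frac{\epsilon}{2}\|\rho\|^{\diamond}_{R_1B_1|R_0B_0},$$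 where $R=R_0R_1$ and $*$ is the link product connecting the systems $B_0$ and $B_1$, $X*Y=\mathrm{Tr}_B[(X\otimes I)(I\otimes Y^{\mathsf T_B})]$ with $B=B_0B_1$. (iii) For all spaces $R_0,R_1$, all $k,l\in\mathbb N$, every ensemble $\mathcal E$ with $kl$ elements on $R_0B_0R_1B_1$ and every fixed measurement $M\in\mathcal M_l(B_1B_1)$, $$P_{\mathrm{succ}}^{\mathcal C(R_0,A'_0\cdot),\Phi_2,\mathcal M_k\otimes M}(\mathcal E)\le P_{\mathrm{succ}}^{\mathcal C(R_0,A_0\cdot),\Phi_1,\mathcal M_k\otimes M}(\mathcal E)+\frac{\epsilon}{2}P_{\mathrm{succ}}(\mathcal E).$$ Moreover, in (ii) and in (iii) it is enough to take $R_0\simeq A'_0$, $R_1\simeq A'_1$: each of the conditions restricted to these spaces is equivalent to (i). -/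

import Mathlib

open scoped Kronecker ComplexOrder

universe u

noncomputable section

namespace QChan

/-! Finite-dimensional Hilbert spaces are represented by finite index types `a` (the labels of the
standard basis), `𝓑(A)` by `Matrix a a ℂ`, and tensor products of spaces by products of types. -/

section Basic

variable {a b r : Type*}

/-- Linear maps `𝓑(A) → 𝓑(B)`. -/
abbrev LMap (a b : Type*) : Type _ := Matrix a a ℂ →ₗ[ℂ] Matrix b b ℂ

/-- The map `φ ⊗ id_R : 𝓑(A ⊗ R) → 𝓑(B ⊗ R)`. -/
def tensorId (φ : LMap a b) (r : Type*) : LMap (a × r) (b × r) where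
  toFun X := Matrix.of fun p q => φ (Matrix.of fun i j => X (i, p.2) (j, q.2)) p.1 q.1
  map_add' X Y := by
    ext p q
    exact congrFun (congrFun (map_add φ (Matrix.of fun i j => X (i, p.2) (j, q.2))
      (Matrix.of fun i j => Y (i, p.2) (j, q.2))) p.1) q.1
  map_smul' c X := by
    ext p q
    exact congrFun (congrFun (map_smul φ c (Matrix.of fun i j => X (i, p.2) (j, q.2))) p.1) q.1

/-- Relabelling of the tensor factors (or of the basis) along a bijection of the labels. -/
def relabel (e : a ≃ b) : LMap a b := (Matrix.reindexLinearEquiv ℂ ℂ e e).toLinearMap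

/-- The map `id_R ⊗ φ : 𝓑(R ⊗ A) → 𝓑(R ⊗ B)`. -/
def idTensor (r : Type*) (φ : LMap a b) : LMap (r × a) (r × b) :=
  relabel (Equiv.prodComm b r) ∘ₗ tensorId φ r ∘ₗ relabel (Equiv.prodComm r a)

/-- Complete positivity: `φ ⊗ id` preserves positivity for every finite-dimensional ancilla. -/
def IsCP (φ : LMap a b) : Prop :=
  ∀ (n : ℕ) (X : Matrix (a × Fin n) (a × Fin n) ℂ),
    X.PosSemidef → (tensorId φ (Fin n) X).PosSemidef

/-- Quantum channels: completely positive trace preserving maps, the set `𝓒(A, B)`. -/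
def IsChannel [Fintype a] [Fintype b] (φ : LMap a b) : Prop :=
  IsCP φ ∧ ∀ X, (φ X).trace = X.trace

/-- States (density operators), the set `𝔖(A)`. -/
def IsState [Fintype a] (ρ : Matrix a a ℂ) : Prop :=
  ρ.PosSemidef ∧ ρ.trace = 1

/-- The trace norm `‖X‖₁ = Tr (X* X)^{1/2}`, the sum of the singular values. -/
def traceNorm [Fintype a] [DecidableEq a] (X : Matrix a a ℂ) : ℝ :=
  ∑ i, Real.sqrt ((Matrix.isHermitian_conjTranspose_mul_self X).eigenvalues i)

/-- The diamond norm `‖φ‖_⋄`, the maximum of `‖(φ ⊗ id_A)(ρ)‖₁` over states `ρ` on `A ⊗ A`. -/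
def diamondNorm [Fintype a] [Fintype b] [DecidableEq a] [DecidableEq b] (φ : LMap a b) : ℝ :=
  sSup {t : ℝ | ∃ ρ : Matrix (a × a) (a × a) ℂ, IsState ρ ∧ t = traceNorm (tensorId φ a ρ)}

/-- The Choi matrix `C_φ = (φ ⊗ id_A)(∑ₖₗ |kk⟩⟨ll|)` on `B ⊗ A`. -/
def choi [DecidableEq a] (φ : LMap a b) : Matrix (b × a) (b × a) ℂ :=
  tensorId φ a (Matrix.of fun p q => if p.1 = p.2 ∧ q.1 = q.2 then 1 else 0)

/-- The link product `X * Y = Tr_B [(X ⊗ I_C)(I_A ⊗ Y^{T_B})]` of `X` on `A ⊗ B` and `Y` on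
`B ⊗ C`, written out in matrix entries. -/
def linkProd {c : Type*} [Fintype b] (X : Matrix (a × b) (a × b) ℂ)
    (Y : Matrix (b × c) (b × c) ℂ) : Matrix (a × c) (a × c) ℂ :=
  Matrix.of fun p q => ∑ i, ∑ j, X (p.1, i) (q.1, j) * Y (i, p.2) (j, q.2)

/-- The duality `⟨X, φ⟩ = ⟪I_B| (φ ⊗ id_B)(X) |I_B⟫`, with `|I_B⟫ = ∑ᵢ |ii⟩`, between `X` on
`A ⊗ B` and maps `φ : 𝓑(A) → 𝓑(B)`. It is real if `X` is hermitian and `φ` is hermitian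
preserving, so the real part is taken. -/
def pairing [Fintype b] (X : Matrix (a × b) (a × b) ℂ) (φ : LMap a b) : ℝ :=
  (∑ i, ∑ j, tensorId φ b X (i, i) (j, j)).re

/-- For a base section `S` in the hermitian maps `𝓑(A) → 𝓑(B)`, ordered by complete positivity,
the dual norm of `X` on `A ⊗ B`: the maximum of `⟨X, φ⟩` over the unit ball
`[-S, S] = {φ | -Θ ≤ φ ≤ Θ for some Θ ∈ S}` of the base section norm. -/
def dualNorm [Fintype b] (S : Set (LMap a b)) (X : Matrix (a × b) (a × b) ℂ) : ℝ :=
  sSup {t : ℝ | ∃ φ : LMap a b, (∃ Θ ∈ S, IsCP (Θ - φ) ∧ IsCP (Θ + φ)) ∧ t = pairing X φ}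

/-- The norm `‖X‖^⋄_{B|A}`, dual to the diamond norm, with `-log ‖X‖^⋄_{B|A}` the conditional
min-entropy. -/
def condNorm [Fintype a] [Fintype b] (X : Matrix (a × b) (a × b) ℂ) : ℝ :=
  dualNorm {α : LMap a b | IsChannel α} X

end Basic

section Superchannels

/-- The relabelling `U ⊗ A₀ ⊗ A₁ → U ⊗ A₁ ⊗ A₀`. -/
def swapRight (x y z : Type*) : (x × y) × z ≃ (x × z) × y where
  toFun p := ((p.1.1, p.2), p.1.2)
  invFun p := ((p.1.1, p.2), p.1.2)
  left_inv _ := rfl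
  right_inv _ := rfl

/-- A superchannel from maps `A₀ → A₁` to maps `A₀' → A₁'`: a preprocessing channel
`A₀' → U ⊗ A₀` and a postprocessing channel `U ⊗ A₁ → A₁'`, connected by an ancilla `U`. -/
structure Superchannel (a₀ a₁ a₀' a₁' : Type u)
    [Fintype a₀] [Fintype a₁] [Fintype a₀'] [Fintype a₁'] where
  U : Type u
  [fintypeU : Fintype U]
  pre : LMap a₀' (U × a₀)
  post : LMap (U × a₁) a₁'
  isChannel_pre : IsChannel pre
  isChannel_post : IsChannel post

attribute [instance] Superchannel.fintypeU

variable {a₀ a₁ a₀' a₁' b₀ b₁ : Type u}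
  [Fintype a₀] [Fintype a₁] [Fintype a₀'] [Fintype a₁'] [Fintype b₀] [Fintype b₁]

/-- The superchannel as a channel `A₀' ⊗ A₁ → A₁' ⊗ A₀` (a quantum network). -/
def Superchannel.toMap (Θ : Superchannel a₀ a₁ a₀' a₁') : LMap (a₀' × a₁) (a₁' × a₀) :=
  tensorId Θ.post a₀ ∘ₗ relabel (swapRight Θ.U a₀ a₁) ∘ₗ tensorId Θ.pre a₁

/-- The action `(Θ ⊗ id_B)(Φ)` of a superchannel on the `A` part of a map
`A₀ ⊗ B₀ → A₁ ⊗ B₁`. -/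
def Superchannel.apply (Θ : Superchannel a₀ a₁ a₀' a₁') (Φ : LMap (a₀ × b₀) (a₁ × b₁)) :
    LMap (a₀' × b₀) (a₁' × b₁) :=
  tensorId Θ.post b₁ ∘ₗ relabel (Equiv.prodAssoc Θ.U a₁ b₁).symm ∘ₗ idTensor Θ.U Φ ∘ₗ
    relabel (Equiv.prodAssoc Θ.U a₀ b₀) ∘ₗ tensorId Θ.pre b₀

/-- The set `𝓒₂(A, A')` of superchannels, as a set of maps `A₀' ⊗ A₁ → A₁' ⊗ A₀`. -/
def superchannels (a₀ a₁ a₀' a₁' : Type u)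
    [Fintype a₀] [Fintype a₁] [Fintype a₀'] [Fintype a₁'] :
    Set (LMap (a₀' × a₁) (a₁' × a₀)) :=
  Set.range (Superchannel.toMap (a₀ := a₀) (a₁ := a₁) (a₀' := a₀') (a₁' := a₁'))

/-- The norm `‖X‖^{2⋄}_{A'|A}` of `X` on `(A₀' ⊗ A₁) ⊗ (A₁' ⊗ A₀)`, dual to the diamond
2-norm, with `-log ‖X‖^{2⋄}_{A'|A}` the conditional 2-min-entropy. -/
def condTwoNorm (X : Matrix ((a₀' × a₁) × (a₁' × a₀)) ((a₀' × a₁) × (a₁' × a₀)) ℂ) : ℝ :=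
  dualNorm (superchannels a₀ a₁ a₀' a₁') X

/-- The conversion distance `δ_{A|A'}(Φ₁‖Φ₂)`, the infimum over superchannels `Θ ∈ 𝓒₂(A, A')`
of `‖(Θ ⊗ id_B)(Φ₁) - Φ₂‖_⋄`. -/
def conversionDist [DecidableEq a₀'] [DecidableEq a₁'] [DecidableEq b₀] [DecidableEq b₁]
    (Φ₁ : LMap (a₀ × b₀) (a₁ × b₁)) (Φ₂ : LMap (a₀' × b₀) (a₁' × b₁)) : ℝ :=
  sInf {t : ℝ | ∃ Θ : Superchannel a₀ a₁ a₀' a₁', t = diamondNorm (Θ.apply Φ₁ - Φ₂)}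

/-- For `ρ` on `R₀B₀R₁B₁` and `Φ : A₀B₀ → A₁B₁`, the link product `ρ * C_Φ` connecting `B₀` and
`B₁`, as an operator on `(R₀ ⊗ A₁) ⊗ (R₁ ⊗ A₀)`. -/
def linkChoi {r₀ r₁ : Type*} [DecidableEq a₀] [DecidableEq b₀]
    (ρ : Matrix ((r₀ × b₀) × (r₁ × b₁)) ((r₀ × b₀) × (r₁ × b₁)) ℂ)
    (Φ : LMap (a₀ × b₀) (a₁ × b₁)) :
    Matrix ((r₀ × a₁) × (r₁ × a₀)) ((r₀ × a₁) × (r₁ × a₀)) ℂ :=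
  relabel (Equiv.prodProdProdComm r₀ r₁ a₁ a₀)
    (linkProd (relabel (Equiv.prodProdProdComm r₀ b₀ r₁ b₁) ρ)
      (relabel ((Equiv.prodProdProdComm a₁ b₁ a₀ b₀).trans
        ((Equiv.prodComm (a₁ × a₀) (b₁ × b₀)).trans
          (Equiv.prodCongr (Equiv.prodComm b₁ b₀) (Equiv.refl (a₁ × a₀))))) (choi Φ)))

end Superchannels

section Games

/-- Ensembles `{λᵢ, ρᵢ}` of states on `A` with prior probabilities `λᵢ`. -/
structure Ensemble (ι a : Type*) [Fintype ι] [Fintype a] where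
  prob : ι → ℝ
  state : ι → Matrix a a ℂ
  prob_nonneg : ∀ i, 0 ≤ prob i
  sum_prob : ∑ i, prob i = 1
  isState : ∀ i, IsState (state i)

/-- Measurements with outcomes in `ι`: positive operators summing to the identity. -/
def IsMeasurement {ι a : Type*} [Fintype ι] [DecidableEq a] (M : ι → Matrix a a ℂ) : Prop :=
  (∀ i, (M i).PosSemidef) ∧ ∑ i, M i = 1

/-- The optimal success probability `P_succ(𝓔) = max_M ∑ᵢ λᵢ Tr[ρᵢ Mᵢ]`. -/
def succProb {ι a : Type*} [Fintype ι] [Fintype a] [DecidableEq a] (E : Ensemble ι a) : ℝ :=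
  sSup {p : ℝ | ∃ M : ι → Matrix a a ℂ, IsMeasurement M ∧
    p = ∑ i, E.prob i * ((E.state i * M i).trace).re}

variable {a₀ a₁ b₀ b₁ : Type u}

/-- Grouping `(U ⊗ (A₁ ⊗ B₁)) ⊗ (R₁ ⊗ B₁)` as `(U ⊗ A₁ ⊗ R₁) ⊗ (B₁ ⊗ B₁)`: the first `B₁` is the
output of the channel, the second one is part of the ensemble. -/
def gameEquiv (x a r b c : Type*) :
    (x × (a × b)) × (r × c) ≃ ((x × a) × r) × (b × c) where
  toFun p := (((p.1.1, p.1.2.1), p.2.1), (p.1.2.2, p.2.2))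
  invFun p := ((p.1.1.1, (p.1.1.2, p.2.1)), (p.1.2, p.2.2))
  left_inv _ := rfl
  right_inv _ := rfl

/-- The map `(id_U ⊗ Φ) ∘ (α ⊗ id_{B₀})`, tensored with the identity on `R₁ ⊗ B₁`, from operators
on `(R₀ ⊗ B₀) ⊗ (R₁ ⊗ B₁)` to operators on `(U ⊗ A₁ ⊗ R₁) ⊗ (B₁ ⊗ B₁)`. -/
def gameMap {r₀ : Type*} (r₁ : Type*) {U : Type*} (α : LMap r₀ (U × a₀))
    (Φ : LMap (a₀ × b₀) (a₁ × b₁)) :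
    LMap ((r₀ × b₀) × (r₁ × b₁)) (((U × a₁) × r₁) × (b₁ × b₁)) :=
  relabel (gameEquiv U a₁ r₁ b₁ b₁) ∘ₗ
    tensorId (idTensor U Φ ∘ₗ relabel (Equiv.prodAssoc U a₀ b₀) ∘ₗ tensorId α b₀) (r₁ × b₁)

/-- The optimal success probability `P_succ^{𝓒(R₀, A₀ ·), Φ, 𝓜ₖ ⊗ M}(𝓔)` in the guessing game with
the fixed measurement `M` on `B₁ ⊗ B₁`: the supremum over all ancillas `U`, all preprocessings
`α ∈ 𝓒(R₀, U ⊗ A₀)` and all `k`-outcome measurements `N` on `U ⊗ A₁ ⊗ R₁`, the guess being the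
pair of outcomes of `N ⊗ M`. -/
def gameSuccProb [Fintype a₀] [Fintype a₁] [DecidableEq a₁] [Fintype b₀] [Fintype b₁]
    {r₀ r₁ : Type u} [Fintype r₀] [Fintype r₁] [DecidableEq r₁] {k l : ℕ}
    (Φ : LMap (a₀ × b₀) (a₁ × b₁)) (M : Fin l → Matrix (b₁ × b₁) (b₁ × b₁) ℂ)
    (E : Ensemble (Fin k × Fin l) ((r₀ × b₀) × (r₁ × b₁))) : ℝ :=
  sSup {p : ℝ | ∃ (U : Type u) (_ : Fintype U) (_ : DecidableEq U) (α : LMap r₀ (U × a₀))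
    (N : Fin k → Matrix ((U × a₁) × r₁) ((U × a₁) × r₁) ℂ),
    IsChannel α ∧ IsMeasurement N ∧
    p = ∑ x : Fin k × Fin l,
      E.prob x * ((gameMap r₁ α Φ (E.state x) * (N x.1 ⊗ₖ M x.2)).trace).re}

end Games

section Conditions

variable {a₀ a₁ a₀' a₁' b₀ b₁ : Type u}
  [Fintype a₀] [Fintype a₁] [Fintype a₀'] [Fintype a₁'] [Fintype b₀] [Fintype b₁]
  [DecidableEq a₀] [DecidableEq a₁] [DecidableEq a₀'] [DecidableEq a₁']
  [DecidableEq b₀] [DecidableEq b₁]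

/-- The comparison of conditional 2-min-entropies for given spaces `R₀`, `R₁`. -/
def EntropyCondition (Φ₁ : LMap (a₀ × b₀) (a₁ × b₁)) (Φ₂ : LMap (a₀' × b₀) (a₁' × b₁)) (ε : ℝ)
    (r₀ r₁ : Type u) [Fintype r₀] [Fintype r₁] : Prop :=
  ∀ ρ : Matrix ((r₀ × b₀) × (r₁ × b₁)) ((r₀ × b₀) × (r₁ × b₁)) ℂ, IsState ρ →
    condTwoNorm (linkChoi ρ Φ₂) ≤ condTwoNorm (linkChoi ρ Φ₁) + ε / 2 * condNorm ρ

/-- The comparison of guessing games for given spaces `R₀`, `R₁`. -/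
def GuessingCondition (Φ₁ : LMap (a₀ × b₀) (a₁ × b₁)) (Φ₂ : LMap (a₀' × b₀) (a₁' × b₁)) (ε : ℝ)
    (r₀ r₁ : Type u) [Fintype r₀] [Fintype r₁] [DecidableEq r₀] [DecidableEq r₁] : Prop :=
  ∀ (k l : ℕ) (E : Ensemble (Fin k × Fin l) ((r₀ × b₀) × (r₁ × b₁)))
    (M : Fin l → Matrix (b₁ × b₁) (b₁ × b₁) ℂ), IsMeasurement M →
    gameSuccProb Φ₂ M E ≤ gameSuccProb Φ₁ M E + ε / 2 * succProb E

end Conditions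

end QChan

end

/-! All quantities are pairings ⟨ρ, Ψ⟩ with ρ ≥ 0. Linking is adjoint to the action of
superchannels, ⟨ρ * C_Φ, Θ⟩ = ⟨ρ, (Θ ⊗ id)(Φ)⟩ (`cpairing_linkChoi`), so the dual 2-norm of ρ * C_Φ
is the supremum of ⟨ρ, ·⟩ over the maps into which Φ can be converted.

From the distance to entropies and games: a functional F that is nonnegative on completely positive
maps and at most μ on channels satisfies F(Ψ₁ - Ψ₂) ≤ (μ/2) ‖Ψ₁ - Ψ₂‖_⋄ (`functional_sub_le`).
Indeed, strong duality dominates the operator representing F by some σ ⊗ 1 with Tr σ close to μ.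
Writing σ = TT* and removing T, F becomes Tr σ times the probability of an effect on the output of
the map for a pure input state, and an effect distinguishes two states by at most half their trace
distance. For entropies F is Ψ ↦ ⟨ρ, Λ(Ψ)⟩ with a superchannel Λ; for games it is the value of a
strategy. A nearly optimal Θ is then absorbed into Λ or into the strategy.

From entropies to the distance: the diamond distance of two channels is controlled by twice the
supremum of ⟨ρ, Ψ₁ - Ψ₂⟩ over the compact convex set of ρ ≥ 0 that are at most 1 on channels
(`diamondNorm_sub_le`). The maps Θ(Φ₁) form a convex set, so a minimax theorem allows Θ to depend on
ρ (`conversionDist_le_of_forall_pairing`). With R = A' the identity superchannel bounds ⟨ρ, Φ₂⟩ by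
the norm of ρ * C_{Φ₂}, and the entropy comparison supplies Θ.

From games to the distance: let d = dim A₁', e = dim B₁. Rotate ρ uniformly by Heisenberg-Weyl
unitaries on R₁ and B₁ and let M be the Bell measurement on B₁B₁. Undoing the rotations turns every
measurement N into d times the pairing with a channel UA₁ → R₁ (`exists_isChannel_of_twirl`), so a
strategy becomes a superchannel. Up to the common factor 1/(de), the game with Φ₂ is worth at least
⟨ρ, Φ₂⟩, the game with Φ₁ at most sup_Θ ⟨ρ, Θ(Φ₁)⟩, and the unrestricted success probability is at
most the conditional norm of ρ. -/

noncomputable section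

namespace QChan

/-! ### Complete positivity and its stability properties. -/

section CompletePositivity

variable {a b c r : Type*}

theorem tensorId_apply (φ : LMap a b) (X : Matrix (a × r) (a × r) ℂ) (p q : b × r) :
    tensorId φ r X p q = φ (Matrix.of fun i j => X (i, p.2) (j, q.2)) p.1 q.1 := rfl

theorem tensorId_submatrix {s : Type*} (φ : LMap a b) (f : s → r) (X : Matrix (a × r) (a × r) ℂ) :
    tensorId φ s (X.submatrix (Prod.map id f) (Prod.map id f)) =
      (tensorId φ r X).submatrix (Prod.map id f) (Prod.map id f) := rfl

/-- The definition tests ancillas `Fin n` only; relabelling the basis extends it to every finite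
ancilla. -/
theorem IsCP.tensorId_posSemidef {φ : LMap a b} (h : IsCP φ) [Finite r]
    {X : Matrix (a × r) (a × r) ℂ} (hX : X.PosSemidef) : (tensorId φ r X).PosSemidef := by
  obtain ⟨n, ⟨e⟩⟩ := Finite.exists_equiv_fin r
  have h1 := (h n _ (hX.submatrix (Prod.map id e.symm))).submatrix (Prod.map id e)
  have h2 : Prod.map (id : a → a) e.symm ∘ Prod.map id e = id := by
    ext p <;> simp
  rwa [← tensorId_submatrix, Matrix.submatrix_submatrix, h2, Matrix.submatrix_id_id] at h1

theorem IsCP.posSemidef {φ : LMap a b} (h : IsCP φ) {X : Matrix a a ℂ} (hX : X.PosSemidef) :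
    (φ X).PosSemidef :=
  (h.tensorId_posSemidef (r := Unit) (hX.submatrix Prod.fst)).submatrix fun i => (i, ())

theorem IsCP.comp {ψ : LMap b c} {φ : LMap a b} (hψ : IsCP ψ) (hφ : IsCP φ) : IsCP (ψ ∘ₗ φ) :=
  fun n X hX => hψ n _ (hφ n X hX)

theorem IsCP.tensorId {φ : LMap a b} (h : IsCP φ) (r : Type*) [Finite r] : IsCP (tensorId φ r) := by
  intro n X hX
  exact (h.tensorId_posSemidef (r := r × Fin n)
    (hX.submatrix fun p : a × r × Fin n => ((p.1, p.2.1), p.2.2))).submatrix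
      fun p : (b × r) × Fin n => (p.1.1, (p.1.2, p.2))

theorem isCP_relabel (e : a ≃ b) : IsCP (relabel e) :=
  fun _ _ hX => hX.submatrix (Prod.map e.symm id)

theorem IsCP.idTensor {φ : LMap a b} (h : IsCP φ) (r : Type*) [Finite r] : IsCP (idTensor r φ) :=
  (isCP_relabel _).comp ((h.tensorId r).comp (isCP_relabel _))

theorem IsCP.add {φ ψ : LMap a b} (hφ : IsCP φ) (hψ : IsCP ψ) : IsCP (φ + ψ) :=
  fun n X hX => (hφ n X hX).add (hψ n X hX)

theorem IsCP.smul {φ : LMap a b} (hφ : IsCP φ) {t : ℝ} (ht : 0 ≤ t) : IsCP ((t : ℂ) • φ) :=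
  fun n X hX => (hφ n X hX).smul (by exact_mod_cast ht : (0 : ℂ) ≤ t)

/-- The map `X ↦ K X K*`. -/
def conjBy [Fintype a] (K : Matrix b a ℂ) : LMap a b where
  toFun X := K * X * K.conjTranspose
  map_add' X Y := by rw [Matrix.mul_add, Matrix.add_mul]
  map_smul' c X := by simp

theorem tensorId_conjBy [Fintype a] [Fintype r] [DecidableEq r] (K : Matrix b a ℂ) :
    tensorId (conjBy K) r = conjBy (K ⊗ₖ (1 : Matrix r r ℂ)) := by
  refine LinearMap.ext fun X => ?_
  ext ⟨i, p⟩ ⟨j, q⟩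
  simp only [tensorId_apply, conjBy, LinearMap.coe_mk, AddHom.coe_mk, Matrix.mul_apply,
    Matrix.of_apply, Matrix.conjTranspose_apply, Fintype.sum_prod_type, Matrix.kroneckerMap_apply,
    Matrix.one_apply, mul_ite, mul_one, mul_zero, ite_mul, zero_mul, Finset.sum_ite_eq,
    Finset.mem_univ, if_true, apply_ite star, star_zero]

theorem isCP_conjBy [Fintype a] [Finite b] (K : Matrix b a ℂ) : IsCP (conjBy K) := by
  intro n X hX
  rw [tensorId_conjBy]
  exact hX.mul_mul_conjTranspose_same _

theorem IsCP.sum {ι : Type*} {s : Finset ι} {φ : ι → LMap a b} (h : ∀ i ∈ s, IsCP (φ i)) :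
    IsCP (∑ i ∈ s, φ i) := by
  classical
  induction s using Finset.induction_on with
  | empty =>
    intro n X _
    rw [Finset.sum_empty]
    exact Matrix.PosSemidef.zero
  | insert i s hi ih =>
    rw [Finset.sum_insert hi]
    exact (h i (by simp)).add (ih fun j hj => h j (by simp [hj]))

end CompletePositivity

/-! ### Closure properties of channels. -/

section Channels

variable {a b c r : Type*} [Fintype a] [Fintype b] [Fintype c] [Fintype r]

theorem trace_tensorId {φ : LMap a b} (h : ∀ X, (φ X).trace = X.trace)
    (X : Matrix (a × r) (a × r) ℂ) : (tensorId φ r X).trace = X.trace := by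
  have key : ∀ k : r, ∑ i, tensorId φ r X (i, k) (i, k) = ∑ i, X (i, k) (i, k) :=
    fun k => h (Matrix.of fun i j => X (i, k) (j, k))
  simp only [Matrix.trace, Matrix.diag_apply, Fintype.sum_prod_type_right, key]

theorem trace_relabel (e : a ≃ b) (X : Matrix a a ℂ) : (relabel e X).trace = X.trace :=
  Equiv.sum_comp e.symm fun i => X i i

theorem IsChannel.comp {ψ : LMap b c} {φ : LMap a b} (hψ : IsChannel ψ) (hφ : IsChannel φ) :
    IsChannel (ψ ∘ₗ φ) :=
  ⟨hψ.1.comp hφ.1, fun X => (hψ.2 _).trans (hφ.2 X)⟩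

theorem IsChannel.tensorId {φ : LMap a b} (h : IsChannel φ) (r : Type*) [Fintype r] :
    IsChannel (tensorId φ r) :=
  ⟨h.1.tensorId r, trace_tensorId h.2⟩

theorem isChannel_relabel (e : a ≃ b) : IsChannel (relabel e) :=
  ⟨isCP_relabel e, trace_relabel e⟩

theorem IsChannel.idTensor {φ : LMap a b} (h : IsChannel φ) (r : Type*) [Fintype r] :
    IsChannel (idTensor r φ) :=
  (isChannel_relabel _).comp ((h.tensorId r).comp (isChannel_relabel _))

end Channels

/-! ### The Choi correspondence. -/

section Choi

variable {a b : Type*}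

theorem choi_apply [DecidableEq a] (φ : LMap a b) (p q : b × a) :
    choi φ p q = φ (Matrix.single p.2 q.2 1) p.1 q.1 := by
  have h : Matrix.single p.2 q.2 1 = Matrix.of fun i j =>
      (Matrix.of fun p q : a × a => if p.1 = p.2 ∧ q.1 = q.2 then (1 : ℂ) else 0)
        (i, p.2) (j, q.2) := by
    ext i j
    simp [Matrix.single_apply, eq_comm]
  rw [h, choi, tensorId_apply]

variable [Fintype a]

/-- The map `𝓑(A) → 𝓑(B)` with Choi matrix `W`. -/
def ofChoi (W : Matrix (b × a) (b × a) ℂ) : LMap a b where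
  toFun X := Matrix.of fun i j => ∑ p, ∑ q, X p q * W (i, p) (j, q)
  map_add' X Y := by
    ext i j
    simp [add_mul, Finset.sum_add_distrib]
  map_smul' c X := by
    ext i j
    simp [Finset.mul_sum, mul_assoc]

theorem ofChoi_apply (W : Matrix (b × a) (b × a) ℂ) (X : Matrix a a ℂ) (i j : b) :
    ofChoi W X i j = ∑ p, ∑ q, X p q * W (i, p) (j, q) := rfl

theorem LMap.apply_eq_sum [DecidableEq a] (φ : LMap a b) (X : Matrix a a ℂ) (i j : b) :
    φ X i j = ∑ p, ∑ q, X p q * choi φ (i, p) (j, q) := by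
  conv_lhs => rw [Matrix.matrix_eq_sum_single X]
  simp only [map_sum, Matrix.sum_apply, choi_apply]
  refine Finset.sum_congr rfl fun p _ => Finset.sum_congr rfl fun q _ => ?_
  rw [← mul_one (X p q), ← smul_eq_mul (X p q), ← Matrix.smul_single, map_smul]
  simp

@[simp]
theorem ofChoi_choi [DecidableEq a] (φ : LMap a b) : ofChoi (choi φ) = φ := by
  refine LinearMap.ext fun X => ?_
  ext i j
  rw [ofChoi_apply, φ.apply_eq_sum]

@[simp]
theorem ofChoi_vecMulVec (v : b × a → ℂ) :
    ofChoi (Matrix.vecMulVec v (star v)) = conjBy (Matrix.of fun i p => v (i, p)) := by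
  refine LinearMap.ext fun X => ?_
  ext i j
  simp only [ofChoi_apply, conjBy, LinearMap.coe_mk, AddHom.coe_mk, Matrix.mul_apply,
    Matrix.vecMulVec_apply, Matrix.of_apply, Matrix.conjTranspose_apply, Finset.sum_mul,
    Pi.star_apply]
  rw [Finset.sum_comm]
  exact Finset.sum_congr rfl fun q _ => Finset.sum_congr rfl fun p _ => by ring

/-- `ofChoi` as a linear map. -/
def ofChoiₗ : Matrix (b × a) (b × a) ℂ →ₗ[ℂ] LMap a b where
  toFun := ofChoi
  map_add' V W := by
    refine LinearMap.ext fun X => ?_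
    ext i j
    simp [ofChoi_apply, mul_add, Finset.sum_add_distrib]
  map_smul' c W := by
    refine LinearMap.ext fun X => ?_
    ext i j
    simp only [ofChoi_apply, Matrix.smul_apply, smul_eq_mul, RingHom.id_apply,
      LinearMap.smul_apply, Finset.mul_sum]
    exact Finset.sum_congr rfl fun q _ => Finset.sum_congr rfl fun p _ => by ring

theorem ofChoiₗ_apply (W : Matrix (b × a) (b × a) ℂ) : ofChoiₗ W = ofChoi W := rfl

/-- Choi's theorem: a decomposition of `W` into rank-one terms is a Kraus decomposition of the map.
-/
theorem isCP_ofChoi [Finite b] {W : Matrix (b × a) (b × a) ℂ} (hW : W.PosSemidef) :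
    IsCP (ofChoi W) := by
  obtain ⟨m, v, rfl⟩ := Matrix.posSemidef_iff_eq_sum_vecMulVec.mp hW
  rw [← ofChoiₗ_apply, map_sum]
  refine IsCP.sum fun i _ => ?_
  rw [ofChoiₗ_apply, ofChoi_vecMulVec]
  exact isCP_conjBy _

theorem IsCP.choi_posSemidef [DecidableEq a] {φ : LMap a b} (h : IsCP φ) :
    (choi φ).PosSemidef := by
  refine h.tensorId_posSemidef ?_
  convert Matrix.posSemidef_vecMulVec_self_star
    (fun p : a × a => if p.1 = p.2 then (1 : ℂ) else 0) using 1
  ext p q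
  simp [Matrix.vecMulVec_apply, apply_ite, ← ite_and, and_comm]

end Choi

/-! ### The duality between operators and maps, and its positive cones. -/

section Pairing

variable {a b : Type*} [Fintype b]

/-- The duality `⟪I_B| (φ ⊗ id_B)(X) |I_B⟫` with complex values. -/
def cpairing (X : Matrix (a × b) (a × b) ℂ) (φ : LMap a b) : ℂ :=
  ∑ i, ∑ j, tensorId φ b X (i, i) (j, j)

theorem pairing_eq_re (X : Matrix (a × b) (a × b) ℂ) (φ : LMap a b) :
    pairing X φ = (cpairing X φ).re := rfl

theorem cpairing_eq_dotProduct (X : Matrix (a × b) (a × b) ℂ) (φ : LMap a b) [DecidableEq b] :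
    cpairing X φ = star (fun p : b × b => if p.1 = p.2 then (1 : ℂ) else 0) ⬝ᵥ
      (tensorId φ b X).mulVec (fun p : b × b => if p.1 = p.2 then (1 : ℂ) else 0) := by
  simp [cpairing, dotProduct, Matrix.mulVec, Fintype.sum_prod_type]

theorem cpairing_nonneg {X : Matrix (a × b) (a × b) ℂ} (hX : X.PosSemidef) {φ : LMap a b}
    (hφ : IsCP φ) : 0 ≤ cpairing X φ := by
  classical
  rw [cpairing_eq_dotProduct]
  exact (hφ.tensorId_posSemidef hX).dotProduct_mulVec_nonneg _

theorem pairing_nonneg {X : Matrix (a × b) (a × b) ℂ} (hX : X.PosSemidef) {φ : LMap a b}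
    (hφ : IsCP φ) : 0 ≤ pairing X φ :=
  (Complex.nonneg_iff.mp (cpairing_nonneg hX hφ)).1

/-- The duality as a bilinear map. -/
def cpairingₗ : Matrix (a × b) (a × b) ℂ →ₗ[ℂ] LMap a b →ₗ[ℂ] ℂ :=
  LinearMap.mk₂ ℂ cpairing
    (fun X Y φ => by simp [cpairing, Finset.sum_add_distrib])
    (fun c X φ => by simp [cpairing, Finset.mul_sum])
    (fun X φ ψ => by simp [cpairing, Finset.sum_add_distrib, tensorId_apply])
    (fun c X φ => by simp [cpairing, Finset.mul_sum, tensorId_apply])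

theorem cpairingₗ_apply (X : Matrix (a × b) (a × b) ℂ) (φ : LMap a b) :
    cpairingₗ X φ = cpairing X φ := rfl

theorem cpairing_eq_sum [Fintype a] [DecidableEq a] (X : Matrix (a × b) (a × b) ℂ) (φ : LMap a b) :
    cpairing X φ = ∑ i, ∑ j, ∑ p, ∑ q, X (p, i) (q, j) * choi φ (i, p) (j, q) := by
  simp only [cpairing, tensorId_apply, LMap.apply_eq_sum φ, Matrix.of_apply]

theorem cpairing_ofChoi [Fintype a] (X : Matrix (a × b) (a × b) ℂ)
    (W : Matrix (b × a) (b × a) ℂ) :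
    cpairing X (ofChoi W) = ∑ i, ∑ j, ∑ p, ∑ q, X (p, i) (q, j) * W (i, p) (j, q) := rfl

/-- Over ℂ hermiticity comes for free: `0 ≤` includes that the values are real, and a real-valued
form is hermitian. -/
theorem posSemidef_of_forall_dotProduct {n : Type*} [Fintype n] {M : Matrix n n ℂ}
    (h : ∀ v : n → ℂ, 0 ≤ star v ⬝ᵥ M.mulVec v) : M.PosSemidef := by
  classical
  rw [← Matrix.isPositive_toEuclideanLin_iff, LinearMap.isPositive_iff_complex]
  intro x
  have h1 := h x.ofLp
  have h2 : inner ℂ (M.toEuclideanLin x) x = star (star x.ofLp ⬝ᵥ M.mulVec x.ofLp) := by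
    rw [PiLp.inner_apply]
    simp [dotProduct, mul_comm]
  rw [h2]
  obtain ⟨h3, h4⟩ := Complex.nonneg_iff.mp h1
  refine ⟨?_, by simpa using! h3⟩
  apply Complex.ext <;> simp [← h4]

/-- The map on the right has a single Kraus operator, the conjugate of `v` read as a matrix from A
to B. Hence testing against completely positive maps detects positivity. -/
theorem dotProduct_mulVec_eq_cpairing [Fintype a] (X : Matrix (a × b) (a × b) ℂ) (v : a × b → ℂ) :
    star v ⬝ᵥ X.mulVec v = cpairing X (ofChoi (Matrix.vecMulVec
      (fun p : b × a => star (v (p.2, p.1))) (star fun p : b × a => star (v (p.2, p.1))))) := by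
  rw [cpairing_ofChoi]
  simp only [dotProduct, Matrix.mulVec, Fintype.sum_prod_type, Pi.star_apply,
    Matrix.vecMulVec_apply, star_star, Finset.mul_sum]
  rw [Finset.sum_comm]
  refine Finset.sum_congr rfl fun i _ => ?_
  simp_rw [Finset.sum_comm (γ := b)]
  exact Finset.sum_congr rfl fun j _ => Finset.sum_congr rfl fun p _ =>
    Finset.sum_congr rfl fun q _ => by ring

theorem posSemidef_of_cpairing_nonneg [Fintype a] {X : Matrix (a × b) (a × b) ℂ}
    (h : ∀ φ, IsCP φ → 0 ≤ cpairing X φ) : X.PosSemidef := by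
  refine posSemidef_of_forall_dotProduct fun v => ?_
  rw [dotProduct_mulVec_eq_cpairing]
  exact h _ (isCP_ofChoi (Matrix.posSemidef_vecMulVec_self_star _))

/-- The operator representing a linear functional on maps with respect to the pairing. -/
def functionalOp [DecidableEq a] [DecidableEq b] [Fintype a] (F : LMap a b →ₗ[ℂ] ℂ) :
    Matrix (a × b) (a × b) ℂ :=
  Matrix.of fun p q => F (ofChoi (Matrix.single (p.2, p.1) (q.2, q.1) 1))

theorem cpairing_functionalOp [DecidableEq a] [DecidableEq b] [Fintype a]
    (F : LMap a b →ₗ[ℂ] ℂ) (φ : LMap a b) : cpairing (functionalOp F) φ = F φ := by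
  conv_rhs => rw [← ofChoi_choi φ, Matrix.matrix_eq_sum_single (choi φ), ← ofChoiₗ_apply]
  simp only [map_sum, Fintype.sum_prod_type, cpairing_eq_sum]
  refine Finset.sum_congr rfl fun i _ => ?_
  rw [Finset.sum_comm]
  refine Finset.sum_congr rfl fun p _ => Finset.sum_congr rfl fun j _ =>
    Finset.sum_congr rfl fun q _ => ?_
  rw [← mul_one (choi φ (i, p) (j, q)), ← smul_eq_mul (choi φ (i, p) (j, q)),
    ← Matrix.smul_single, map_smul, map_smul, ofChoiₗ_apply, smul_eq_mul, smul_eq_mul, mul_one,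
    mul_comm]
  rfl

theorem functionalOp_posSemidef [DecidableEq a] [DecidableEq b] [Fintype a]
    {F : LMap a b →ₗ[ℂ] ℂ} (hF : ∀ φ, IsCP φ → 0 ≤ F φ) : (functionalOp F).PosSemidef :=
  posSemidef_of_cpairing_nonneg fun φ hφ => by
    rw [cpairing_functionalOp]
    exact hF φ hφ

end Pairing

/-! ### The trace norm of traceless hermitian matrices via effects. -/

section TraceNorm

variable {a : Type*} [Fintype a] [DecidableEq a]

theorem exists_eigen_decomposition {H : Matrix a a ℂ} (hH : H.IsHermitian) :
    ∃ U : Matrix a a ℂ, U.conjTranspose * U = 1 ∧ U * U.conjTranspose = 1 ∧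
      H = U * Matrix.diagonal (fun i => (hH.eigenvalues i : ℂ)) * U.conjTranspose := by
  refine ⟨hH.eigenvectorUnitary, ?_, ?_, ?_⟩
  · exact Unitary.coe_star_mul_self hH.eigenvectorUnitary
  · exact Unitary.coe_mul_star_self hH.eigenvectorUnitary
  · conv_lhs => rw [hH.spectral_theorem, Unitary.conjStarAlgAut_apply]
    rfl

/-- The eigenvalues of H*H are identified, as a multiset, with the squares of those of H by
comparing roots of the characteristic polynomial. -/
theorem traceNorm_eq_sum_abs {H : Matrix a a ℂ} (hH : H.IsHermitian) :
    traceNorm H = ∑ i, |hH.eigenvalues i| := by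
  obtain ⟨U, hU, -, hHU⟩ := exists_eigen_decomposition hH
  have hK := Matrix.isHermitian_conjTranspose_mul_self H
  have h1 : H.conjTranspose * H =
      U * Matrix.diagonal (fun i => ((hH.eigenvalues i ^ 2 : ℝ) : ℂ)) * U.conjTranspose := by
    rw [hH.eq]
    conv_lhs => rw [hHU]
    rw [show ∀ D : Matrix a a ℂ, U * D * U.conjTranspose * (U * D * U.conjTranspose) =
      U * (D * (U.conjTranspose * U) * D) * U.conjTranspose from fun D => by
        simp only [Matrix.mul_assoc], hU, Matrix.mul_one, Matrix.diagonal_mul_diagonal]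
    simp [pow_two]
  have h2 : (H.conjTranspose * H).charpoly.roots =
      Multiset.map (fun i => ((hH.eigenvalues i ^ 2 : ℝ) : ℂ)) Finset.univ.val := by
    rw [h1, Matrix.charpoly_mul_comm, ← Matrix.mul_assoc, hU, Matrix.one_mul,
      Matrix.charpoly_diagonal]
    rw [Polynomial.roots_prod _ _ (Finset.prod_ne_zero_iff.mpr fun i _ =>
      Polynomial.X_sub_C_ne_zero _)]
    simp only [Polynomial.roots_X_sub_C, Multiset.bind_singleton]
  rw [hK.roots_charpoly_eq_eigenvalues] at h2
  have h3 : Multiset.map hK.eigenvalues Finset.univ.val =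
      Multiset.map (fun i => hH.eigenvalues i ^ 2) Finset.univ.val := by
    apply Multiset.map_injective Complex.ofReal_injective
    rw [Multiset.map_map, Multiset.map_map]
    exact h2
  have h4 := congrArg (fun s => (Multiset.map Real.sqrt s).sum) h3
  simp only [Multiset.map_map, Function.comp_def, Real.sqrt_sq_eq_abs] at h4
  exact h4

theorem traceNorm_nonneg (X : Matrix a a ℂ) : 0 ≤ traceNorm X :=
  Finset.sum_nonneg fun _ _ => Real.sqrt_nonneg _

/-- The positive and negative parts of a traceless H have the same trace ‖H‖₁/2, and Tr MH is at
most the trace of the positive part. This is the source of the factor 1/2 in ε/2. -/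
theorem two_mul_trace_le_traceNorm {H M : Matrix a a ℂ} (hH : H.IsHermitian) (ht : H.trace = 0)
    (hM : M.PosSemidef) (hM' : (1 - M).PosSemidef) : 2 * (M * H).trace.re ≤ traceNorm H := by
  obtain ⟨U, hU, hU', hHU⟩ := exists_eigen_decomposition hH
  have h0 : ∑ i, hH.eigenvalues i = 0 := by
    have := hH.trace_eq_sum_eigenvalues
    rw [ht] at this
    exact Complex.ofReal_injective (by simpa using this.symm)
  have h1 := hM.conjTranspose_mul_mul_same U
  have h2 := hM'.conjTranspose_mul_mul_same U
  rw [Matrix.mul_sub, Matrix.mul_one, Matrix.sub_mul, hU] at h2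
  set N := U.conjTranspose * M * U with hN
  have h3 : (M * H).trace.re = ∑ i, (N i i).re * hH.eigenvalues i := by
    conv_lhs => rw [hHU, ← Matrix.mul_assoc, Matrix.trace_mul_comm, ← Matrix.mul_assoc,
      ← Matrix.mul_assoc, ← hN]
    simp [Matrix.trace, Matrix.mul_diagonal]
  rw [traceNorm_eq_sum_abs hH, h3, Finset.mul_sum]
  calc ∑ i, 2 * ((N i i).re * hH.eigenvalues i)
      ≤ ∑ i, (|hH.eigenvalues i| + hH.eigenvalues i) := ?_
    _ = _ := by rw [Finset.sum_add_distrib, h0, add_zero]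
  refine Finset.sum_le_sum fun i _ => ?_
  have h4 : 0 ≤ (N i i).re := (Complex.nonneg_iff.mp h1.diag_nonneg).1
  have h5 : 0 ≤ 1 - (N i i).re := by
    simpa using (Complex.nonneg_iff.mp (h2.diag_nonneg (i := i))).1
  rcases le_total 0 (hH.eigenvalues i) with h | h
  · rw [abs_of_nonneg h]; nlinarith
  · rw [abs_of_nonpos h]; nlinarith

/-- The optimal effect is the projection onto the span of the eigenvectors with positive eigenvalue.
-/
theorem exists_two_mul_trace_eq_traceNorm {H : Matrix a a ℂ} (hH : H.IsHermitian)
    (ht : H.trace = 0) : ∃ M : Matrix a a ℂ, M.PosSemidef ∧ (1 - M).PosSemidef ∧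
      traceNorm H = 2 * (M * H).trace.re := by
  obtain ⟨U, hU, hU', hHU⟩ := exists_eigen_decomposition hH
  have h0 : ∑ i, hH.eigenvalues i = 0 := by
    have := hH.trace_eq_sum_eigenvalues
    rw [ht] at this
    exact Complex.ofReal_injective (by simpa using this.symm)
  let d : a → ℂ := fun i => if 0 < hH.eigenvalues i then 1 else 0
  refine ⟨U * Matrix.diagonal d * U.conjTranspose, ?_, ?_, ?_⟩
  · refine Matrix.PosSemidef.mul_mul_conjTranspose_same (Matrix.PosSemidef.diagonal fun i => ?_) _
    by_cases h : 0 < hH.eigenvalues i <;> simp [d, h]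
  · have : 1 - U * Matrix.diagonal d * U.conjTranspose =
        U * Matrix.diagonal (1 - d) * U.conjTranspose := by
      rw [show Matrix.diagonal (1 - d) = 1 - Matrix.diagonal d by
        rw [← Matrix.diagonal_one, Matrix.diagonal_sub]; rfl, Matrix.mul_sub, Matrix.sub_mul,
        Matrix.mul_one, hU']
    rw [this]
    refine Matrix.PosSemidef.mul_mul_conjTranspose_same (Matrix.PosSemidef.diagonal fun i => ?_) _
    by_cases h : 0 < hH.eigenvalues i <;> simp [d, h]
  · have h3 : (U * Matrix.diagonal d * U.conjTranspose * H).trace.re =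
        ∑ i, (d i).re * hH.eigenvalues i := by
      conv_lhs => rw [hHU]
      rw [show ∀ D E : Matrix a a ℂ, U * D * U.conjTranspose * (U * E * U.conjTranspose) =
        U * (D * (U.conjTranspose * U) * E) * U.conjTranspose from fun D E => by
          simp only [Matrix.mul_assoc], hU, Matrix.mul_one, Matrix.trace_mul_comm,
        ← Matrix.mul_assoc, hU, Matrix.one_mul, Matrix.diagonal_mul_diagonal]
      simp [Matrix.trace]
    rw [traceNorm_eq_sum_abs hH, h3, Finset.mul_sum]
    calc ∑ i, |hH.eigenvalues i| = ∑ i, (|hH.eigenvalues i| + hH.eigenvalues i) := by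
          rw [Finset.sum_add_distrib, h0, add_zero]
      _ = _ := Finset.sum_congr rfl fun i _ => ?_
    by_cases h : 0 < hH.eigenvalues i
    · simp only [d, h, if_true, abs_of_pos h, Complex.one_re]; ring
    · simp only [d, h, if_false, abs_of_nonpos (not_lt.mp h), Complex.zero_re]; ring

end TraceNorm

/-! ### The minimax principle. -/

section Minimax

/-- If every point of a compact convex set `K` is dealt with by some point of a convex set `Y`, then
some point of `Y` deals with all of `K`. -/
theorem exists_forall_lt_of_forall_exists_lt {E F : Type*}
    [TopologicalSpace E] [AddCommGroup E] [Module ℝ E] [IsTopologicalAddGroup E]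
    [ContinuousSMul ℝ E] [TopologicalSpace F] [AddCommGroup F] [Module ℝ F]
    [IsTopologicalAddGroup F] [ContinuousSMul ℝ F] {K : Set E} {Y : Set F} (hK : IsCompact K)
    (hKc : Convex ℝ K) (hKn : K.Nonempty) (hY : Convex ℝ Y) (f : E →ₗ[ℝ] F →ₗ[ℝ] ℝ) (g : E →ₗ[ℝ] ℝ)
    (hg : Continuous g) (hf₁ : ∀ y, Continuous fun x => f x y) (hf₂ : ∀ x, Continuous (f x))
    {t : ℝ} (h : ∀ x ∈ K, ∃ y ∈ Y, t < f x y - g x) :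
    ∃ y ∈ Y, ∀ x ∈ K, t < f x y - g x := by
  choose! y hyY hy using h
  -- `Y` need not be compact: finitely many of its points already deal with all of `K`, and the
  -- strict inequality makes the cover open.
  obtain ⟨s, hs⟩ := hK.elim_finite_subcover (fun x : K => {z | t < f z (y x) - g z})
    (fun x => isOpen_lt continuous_const ((hf₁ _).sub hg))
    (fun x hx => Set.mem_iUnion.mpr ⟨⟨x, hx⟩, hy x hx⟩)
  classical
  refine Sion.exists_lt_iInf_of_lt_iInf_of_finite (f := fun x y => f x y - g x) hKn hK
    (fun y _ => ((hf₁ y).sub hg).lowerSemicontinuous.lowerSemicontinuousOn _) (fun y _ => ?_) hY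
    (fun x _ => ((hf₂ x).sub continuous_const).upperSemicontinuous.upperSemicontinuousOn _)
    (fun x _ => ?_) hKc ((s.image fun x : K => y x.1).finite_toSet) ?_ (t := t) fun x hx => ?_
  · exact (((f.flip y - g).convexOn hKc)).quasiconvexOn
  · exact (((f x).concaveOn hY).sub (convexOn_const (g x) hY)).quasiconcaveOn
  · intro z hz
    obtain ⟨x, -, rfl⟩ := Finset.mem_image.mp (Finset.mem_coe.mp hz)
    exact hyY x x.2
  · obtain ⟨z, hz⟩ := Set.mem_iUnion.mp (hs hx)
    obtain ⟨hzs, hz'⟩ := Set.mem_iUnion.mp hz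
    exact ⟨y z, Finset.mem_coe.mpr (Finset.mem_image_of_mem (fun x : K => y x.1) hzs), hz'⟩

end Minimax

/-! ### Compactness of bounded sets of positive matrices. -/

section Compactness

variable {a : Type*} [Fintype a]

theorem isClosed_posSemidef : IsClosed {X : Matrix a a ℂ | X.PosSemidef} := by
  have : {X : Matrix a a ℂ | X.PosSemidef} =
      {X : Matrix a a ℂ | X.conjTranspose = X} ∩
        ⋂ v : a → ℂ, {X : Matrix a a ℂ | 0 ≤ star v ⬝ᵥ X.mulVec v} := by
    ext X
    simp only [Set.mem_ofPred_eq, Set.mem_inter_iff, Set.mem_iInter,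
      Matrix.posSemidef_iff_dotProduct_mulVec]
    rfl
  rw [this]
  refine (isClosed_eq (by fun_prop) continuous_id).inter (isClosed_iInter fun v => ?_)
  exact isClosed_le continuous_const (by fun_prop)

omit [Fintype a] in
theorem convex_posSemidef : Convex ℝ {X : Matrix a a ℂ | X.PosSemidef} := by
  intro X hX Y hY s t hs ht _
  exact (Matrix.PosSemidef.smul hX hs).add (Matrix.PosSemidef.smul hY ht)

theorem norm_apply_le_trace {X : Matrix a a ℂ} (hX : X.PosSemidef) (i j : a) :
    ‖X i j‖ ≤ X.trace.re := by
  obtain ⟨m, v, rfl⟩ := Matrix.posSemidef_iff_eq_sum_vecMulVec.mp hX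
  simp only [Matrix.sum_apply, Matrix.vecMulVec_apply, Pi.star_apply, Matrix.trace_sum,
    Complex.re_sum]
  refine (norm_sum_le _ _).trans (Finset.sum_le_sum fun k _ => ?_)
  have h1 : (Matrix.vecMulVec (v k) (star (v k))).trace.re = ∑ i, ‖v k i‖ ^ 2 := by
    simp [Matrix.trace, Matrix.vecMulVec_apply, Complex.mul_conj, Complex.normSq_eq_norm_sq,
      -Complex.ofReal_pow]
  have h2 : ∀ i, ‖v k i‖ ^ 2 ≤ ∑ i, ‖v k i‖ ^ 2 := fun i =>
    Finset.single_le_sum (f := fun i => ‖v k i‖ ^ 2) (fun _ _ => sq_nonneg _) (Finset.mem_univ i)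
  rw [h1, norm_mul, norm_star]
  nlinarith [h2 i, h2 j, sq_nonneg (‖v k i‖ - ‖v k j‖)]

theorem isCompact_posSemidef_trace_le (t : ℝ) :
    IsCompact {X : Matrix a a ℂ | X.PosSemidef ∧ X.trace.re ≤ t} := by
  have h : IsCompact (Set.univ.pi fun _ : a => Set.univ.pi fun _ : a => Metric.closedBall (0 : ℂ) t) :=
    isCompact_univ_pi fun _ => isCompact_univ_pi fun _ => isCompact_closedBall _ _
  have hc : IsClosed {X : Matrix a a ℂ | X.trace.re ≤ t} :=
    isClosed_le (Complex.continuous_re.comp continuous_id.matrix_trace) continuous_const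
  refine h.of_isClosed_subset (isClosed_posSemidef.inter hc) fun X hX i _ j _ => ?_
  simpa using (norm_apply_le_trace hX.1 i j).trans hX.2

end Compactness

/-! ### Channels built from Choi matrices. -/

section Constructions

variable {a b : Type*} [Fintype a] [Fintype b]

theorem isChannel_ofChoi [DecidableEq a] {W : Matrix (b × a) (b × a) ℂ} (hW : W.PosSemidef)
    (h : ∀ p q, ∑ i, W (i, p) (i, q) = if p = q then 1 else 0) : IsChannel (ofChoi W) := by
  refine ⟨isCP_ofChoi hW, fun X => ?_⟩
  simp only [Matrix.trace, Matrix.diag_apply, ofChoi_apply]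
  rw [Finset.sum_comm]
  refine Finset.sum_congr rfl fun p _ => ?_
  rw [Finset.sum_comm]
  simp only [← Finset.mul_sum, h, mul_ite, mul_one, mul_zero, Finset.sum_ite_eq, Finset.mem_univ,
    if_true]

/-- The partial trace over the first factor. -/
def traceFst (W : Matrix (b × a) (b × a) ℂ) : Matrix a a ℂ :=
  Matrix.of fun p q => ∑ i, W (i, p) (i, q)

omit [Fintype a] in
theorem traceFst_apply (W : Matrix (b × a) (b × a) ℂ) (p q : a) :
    traceFst W p q = ∑ i, W (i, p) (i, q) := rfl

omit [Fintype a] in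
theorem traceFst_posSemidef [Finite a] {W : Matrix (b × a) (b × a) ℂ} (hW : W.PosSemidef) :
    (traceFst W).PosSemidef := by
  have : traceFst W = ∑ i, W.submatrix (fun p => (i, p)) (fun p => (i, p)) := by
    ext p q
    simp [traceFst_apply, Matrix.sum_apply]
  rw [this]
  exact Matrix.posSemidef_sum _ fun i _ => hW.submatrix _

theorem trace_traceFst (W : Matrix (b × a) (b × a) ℂ) : (traceFst W).trace = W.trace := by
  simp only [Matrix.trace, Matrix.diag_apply, traceFst_apply, Fintype.sum_prod_type]
  exact Finset.sum_comm

/-- The deficit t·1 - Tr_B W is placed on a fixed basis state of the output; this completes the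
partial trace to t·1 by adding a positive operator to `W`. -/
theorem exists_isChannel_le [DecidableEq a] [Nonempty b] {W : Matrix (b × a) (b × a) ℂ}
    (hW : W.PosSemidef) {t : ℝ} (ht : 0 < t)
    (h : ((t : ℂ) • (1 : Matrix a a ℂ) - traceFst W).PosSemidef) :
    ∃ α : LMap a b, IsChannel α ∧ IsCP ((t : ℂ) • α - ofChoi W) := by
  classical
  obtain ⟨i₀⟩ := ‹Nonempty b›
  have hs : (Matrix.single i₀ i₀ (1 : ℂ)).PosSemidef := by
    rw [← Matrix.diagonal_single]
    exact Matrix.PosSemidef.diagonal fun i => by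
      by_cases hi : i = i₀
      · subst hi; simp
      · simp [hi]
  set V := Matrix.single i₀ i₀ (1 : ℂ) ⊗ₖ ((t : ℂ) • (1 : Matrix a a ℂ) - traceFst W) with hV
  have hVp : V.PosSemidef := hs.kronecker h
  have ht' : (t : ℂ) ≠ 0 := by exact_mod_cast ht.ne'
  refine ⟨ofChoi ((t : ℂ)⁻¹ • (W + V)), isChannel_ofChoi ((hW.add hVp).smul ?_) fun p q => ?_, ?_⟩
  · rw [← Complex.ofReal_inv]
    exact_mod_cast (inv_pos.mpr ht).le
  · have : ∑ i, V (i, p) (i, q) = (if p = q then (t : ℂ) else 0) - ∑ i, W (i, p) (i, q) := by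
      simp [hV, Matrix.single_apply, Matrix.one_apply, traceFst_apply]
    simp only [Matrix.smul_apply, Matrix.add_apply, smul_eq_mul, ← Finset.mul_sum,
      Finset.sum_add_distrib, this]
    split_ifs <;> simp [ht']
  · have : (t : ℂ) • ofChoi ((t : ℂ)⁻¹ • (W + V)) - ofChoi W = ofChoi V := by
      simp only [← ofChoiₗ_apply, map_smul, map_add, smul_smul, mul_inv_cancel₀ ht', one_smul]
      simp
    rw [this]
    exact isCP_ofChoi hVp

theorem exists_isChannel [Nonempty b] : ∃ α : LMap a b, IsChannel α := by
  classical
  obtain ⟨α, hα, -⟩ := exists_isChannel_le (a := a) (b := b) (W := 0) Matrix.PosSemidef.zero one_pos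
    (by
      have : traceFst (0 : Matrix (b × a) (b × a) ℂ) = 0 := by ext; simp [traceFst_apply]
      rw [this]
      simpa using Matrix.PosSemidef.one)
  exact ⟨α, hα⟩

end Constructions

/-! ### Real-valued pairing calculus. -/

section PairingReal

variable {a b : Type*} [Fintype b]

theorem pairing_add_right (X : Matrix (a × b) (a × b) ℂ) (φ ψ : LMap a b) :
    pairing X (φ + ψ) = pairing X φ + pairing X ψ := by
  simp only [pairing_eq_re, ← cpairingₗ_apply, map_add, Complex.add_re]

theorem pairing_sub_right (X : Matrix (a × b) (a × b) ℂ) (φ ψ : LMap a b) :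
    pairing X (φ - ψ) = pairing X φ - pairing X ψ := by
  simp only [pairing_eq_re, ← cpairingₗ_apply, map_sub, Complex.sub_re]

theorem pairing_smul_right (X : Matrix (a × b) (a × b) ℂ) (t : ℝ) (φ : LMap a b) :
    pairing X ((t : ℂ) • φ) = t * pairing X φ := by
  simp only [pairing_eq_re, ← cpairingₗ_apply, map_smul, smul_eq_mul, Complex.re_ofReal_mul]

theorem pairing_smul_left (X : Matrix (a × b) (a × b) ℂ) (t : ℝ) (φ : LMap a b) :
    pairing ((t : ℂ) • X) φ = t * pairing X φ := by
  simp only [pairing_eq_re, ← cpairingₗ_apply, map_smul, LinearMap.smul_apply, smul_eq_mul,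
    Complex.re_ofReal_mul]

theorem pairing_sub_left (X Y : Matrix (a × b) (a × b) ℂ) (φ : LMap a b) :
    pairing (X - Y) φ = pairing X φ - pairing Y φ := by
  simp only [pairing_eq_re, ← cpairingₗ_apply, map_sub, LinearMap.sub_apply, Complex.sub_re]

theorem pairing_le_of_isCP_sub {X : Matrix (a × b) (a × b) ℂ} (hX : X.PosSemidef) {φ ψ : LMap a b}
    (h : IsCP (ψ - φ)) : pairing X φ ≤ pairing X ψ := by
  have := pairing_nonneg hX h
  rw [pairing_sub_right] at this
  linarith

theorem cpairing_kronecker_one [DecidableEq b] (σ : Matrix a a ℂ) (φ : LMap a b) :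
    cpairing (σ ⊗ₖ (1 : Matrix b b ℂ)) φ = (φ σ).trace := by
  have h : ∀ i j, tensorId φ b (σ ⊗ₖ (1 : Matrix b b ℂ)) (i, i) (j, j) =
      if i = j then φ σ i j else 0 := by
    intro i j
    have h1 : (Matrix.of fun x y => (σ ⊗ₖ (1 : Matrix b b ℂ)) (x, i) (y, j)) =
        if i = j then σ else 0 := by
      ext x y
      split_ifs with hij <;> simp [hij]
    rw [tensorId_apply, h1]
    split_ifs <;> simp
  simp [cpairing, h, Matrix.trace]

variable [Fintype a]

theorem posSemidef_of_pairing_nonneg {X : Matrix (a × b) (a × b) ℂ} (hX : X.IsHermitian)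
    (h : ∀ W : Matrix (b × a) (b × a) ℂ, W.PosSemidef → 0 ≤ pairing X (ofChoi W)) :
    X.PosSemidef := by
  refine Matrix.PosSemidef.of_dotProduct_mulVec_nonneg hX fun v => ?_
  rw [Complex.nonneg_iff]
  refine ⟨?_, (hX.im_star_dotProduct_mulVec_self v).symm⟩
  rw [dotProduct_mulVec_eq_cpairing]
  exact h _ (Matrix.posSemidef_vecMulVec_self_star _)

theorem cpairing_ofChoi_kronecker_one [DecidableEq b] (σ : Matrix a a ℂ)
    (W : Matrix (b × a) (b × a) ℂ) :
    cpairing (σ ⊗ₖ (1 : Matrix b b ℂ)) (ofChoi W) = ∑ p, ∑ q, σ p q * traceFst W p q := by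
  rw [cpairing_kronecker_one]
  simp only [Matrix.trace, Matrix.diag_apply, ofChoi_apply, traceFst_apply, Finset.mul_sum]
  rw [Finset.sum_comm]
  exact Finset.sum_congr rfl fun p _ => Finset.sum_comm

end PairingReal

/-! ### Strong duality for the conditional min-entropy. -/

section Duality

variable {a b : Type*} [Fintype a] [Fintype b]

/-- A maximiser of the linear form over the compact set of states works: comparison with pure states
bounds every Rayleigh quotient of `A`. The form is Tr[σ Aᵀ], so the pure states are built from the
conjugate of `v`. -/
theorem exists_isMax_traceFst [DecidableEq a] [Nonempty a] {A : Matrix a a ℂ}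
    (hA : A.IsHermitian) : ∃ σ : Matrix a a ℂ, IsState σ ∧
      (((∑ p, ∑ q, σ p q * A p q).re : ℂ) • (1 : Matrix a a ℂ) - A).PosSemidef := by
  let F : Matrix a a ℂ →ₗ[ℝ] ℝ := Complex.reLm ∘ₗ
    { toFun := fun σ => ∑ p, ∑ q, σ p q * A p q
      map_add' := fun X Y => by simp [add_mul, Finset.sum_add_distrib]
      map_smul' := fun c X => by simp [Finset.mul_sum, mul_assoc] }
  have hF : ∀ σ, F σ = (∑ p, ∑ q, σ p q * A p q).re := fun _ => rfl
  have hc : IsCompact {X : Matrix a a ℂ | IsState X} := by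
    refine (isCompact_posSemidef_trace_le 1).of_isClosed_subset
      (isClosed_posSemidef.inter (isClosed_eq continuous_id.matrix_trace continuous_const))
      fun X hX => ⟨hX.1, by rw [hX.2]; simp⟩
  have hstate : ∀ v : a → ℂ, v ≠ 0 → ∃ t : ℝ, 0 < t ∧ star v ⬝ᵥ v = t ∧
      IsState (((t⁻¹ : ℝ) : ℂ) • Matrix.vecMulVec (star v) v) := by
    intro v hv
    have h1 : 0 < star v ⬝ᵥ v := by
      simpa using Matrix.dotProduct_star_self_pos_iff (v := star v) |>.mpr (by simpa using hv)
    obtain ⟨h2, h3⟩ := Complex.pos_iff.mp h1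
    refine ⟨(star v ⬝ᵥ v).re, h2, Complex.ext rfl (by simpa using h3.symm),
      (Matrix.posSemidef_vecMulVec_star_self v).smul (by exact_mod_cast (inv_pos.mpr h2).le), ?_⟩
    rw [Matrix.trace_smul, Matrix.trace_vecMulVec, smul_eq_mul,
      show star v ⬝ᵥ v = ((star v ⬝ᵥ v).re : ℂ) from Complex.ext rfl (by simpa using h3.symm),
      Complex.ofReal_re, ← Complex.ofReal_mul, inv_mul_cancel₀ h2.ne', Complex.ofReal_one]
  have hne : {X : Matrix a a ℂ | IsState X}.Nonempty := by
    obtain ⟨t, -, -, h⟩ := hstate 1 one_ne_zero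
    exact ⟨_, h⟩
  obtain ⟨σ, hσ, hmax⟩ := hc.exists_isMaxOn hne F.continuous_of_finiteDimensional.continuousOn
  refine ⟨σ, hσ, ?_⟩
  rw [← hF]
  have hH : (((F σ : ℝ) : ℂ) • (1 : Matrix a a ℂ) - A).IsHermitian := by
    refine Matrix.IsHermitian.sub ?_ hA
    simp [Matrix.IsHermitian, Matrix.conjTranspose_smul]
  refine Matrix.PosSemidef.of_dotProduct_mulVec_nonneg hH fun v => ?_
  rw [Complex.nonneg_iff]
  refine ⟨?_, (hH.im_star_dotProduct_mulVec_self v).symm⟩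
  by_cases hv : v = 0
  · simp [hv]
  obtain ⟨t, ht, htv, hs⟩ := hstate v hv
  have h1 := hmax hs
  have h2 : F (((t⁻¹ : ℝ) : ℂ) • Matrix.vecMulVec (star v) v) =
      t⁻¹ * (star v ⬝ᵥ A.mulVec v).re := by
    rw [hF, ← Complex.re_ofReal_mul]
    congr 1
    simp only [Matrix.smul_apply, Matrix.vecMulVec_apply, smul_eq_mul, dotProduct, Matrix.mulVec,
      Finset.mul_sum]
    exact Finset.sum_congr rfl fun p _ => Finset.sum_congr rfl fun q _ => by ring
  simp only [Set.mem_ofPred_eq] at h1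
  rw [h2, inv_mul_le_iff₀ ht] at h1
  rw [Matrix.sub_mulVec, dotProduct_sub, Matrix.smul_mulVec, Matrix.one_mulVec, dotProduct_smul,
    htv]
  simp only [Complex.sub_re, smul_eq_mul, Complex.re_ofReal_mul, Complex.ofReal_re]
  linarith

/-- Strong duality for the conditional min-entropy, up to an arbitrarily small error. -/
theorem exists_posDef_kronecker_one_sub_posSemidef [DecidableEq a] [DecidableEq b] [Nonempty a]
    [Nonempty b] {ρ : Matrix (a × b) (a × b) ℂ} (hρ : ρ.PosSemidef) {μ : ℝ}
    (h : ∀ α : LMap a b, IsChannel α → pairing ρ α ≤ μ) {η : ℝ} (hη : 0 < η) :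
    ∃ σ : Matrix a a ℂ, σ.PosDef ∧ σ.trace = ((μ + η * Fintype.card a : ℝ) : ℂ) ∧
      (σ ⊗ₖ (1 : Matrix b b ℂ) - ρ).PosSemidef := by
  have hμ : 0 ≤ μ := by
    obtain ⟨α, hα⟩ := exists_isChannel (a := a) (b := b)
    exact (pairing_nonneg hρ hα.1).trans (h α hα)
  -- Minimax between normalised Choi operators W and positive operators σ of trace μ, with payoff ⟨σ
  -- ⊗ 1 - ρ, W⟩.
  let K : Set (Matrix (b × a) (b × a) ℂ) := {W | W.PosSemidef ∧ W.trace.re = 1}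
  let Y : Set (Matrix a a ℂ) := {σ | σ.PosSemidef ∧ σ.trace = μ}
  let f : Matrix (b × a) (b × a) ℂ →ₗ[ℝ] Matrix a a ℂ →ₗ[ℝ] ℝ := LinearMap.mk₂ ℝ
    (fun W σ => (∑ p, ∑ q, σ p q * traceFst W p q).re)
    (fun V W σ => by simp [traceFst_apply, mul_add, Finset.sum_add_distrib])
    (fun c W σ => by
      simp only [traceFst_apply, Matrix.smul_apply, Complex.real_smul, smul_eq_mul,
        ← Complex.re_ofReal_mul, Finset.mul_sum]
      congr 1
      exact Finset.sum_congr rfl fun p _ => Finset.sum_congr rfl fun q _ =>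
        Finset.sum_congr rfl fun i _ => by ring)
    (fun W σ τ => by simp [add_mul, Finset.sum_add_distrib])
    (fun c W σ => by
      simp only [Matrix.smul_apply, Complex.real_smul, smul_eq_mul,
        ← Complex.re_ofReal_mul, Finset.mul_sum, mul_assoc])
  have hf : ∀ W σ, f W σ = pairing (σ ⊗ₖ (1 : Matrix b b ℂ)) (ofChoi W) := fun W σ => by
    rw [pairing_eq_re, cpairing_ofChoi_kronecker_one]; rfl
  let g : Matrix (b × a) (b × a) ℂ →ₗ[ℝ] ℝ :=
    Complex.reLm ∘ₗ ((cpairingₗ ρ ∘ₗ ofChoiₗ).restrictScalars ℝ)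
  have hg : ∀ W, g W = pairing ρ (ofChoi W) := fun _ => rfl
  have hKc : IsCompact K :=
    (isCompact_posSemidef_trace_le 1).of_isClosed_subset
      (isClosed_posSemidef.inter (isClosed_eq
        (Complex.continuous_re.comp continuous_id.matrix_trace) continuous_const))
      fun X hX => ⟨hX.1, hX.2.le⟩
  have hKconv : Convex ℝ K := by
    intro X hX Z hZ s t hs ht hst
    refine ⟨convex_posSemidef hX.1 hZ.1 hs ht hst, ?_⟩
    simp [Matrix.trace_add, Matrix.trace_smul, hX.2, hZ.2, hst]
  have hYconv : Convex ℝ Y := by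
    intro X hX Z hZ s t hs ht hst
    refine ⟨convex_posSemidef hX.1 hZ.1 hs ht hst, ?_⟩
    rw [Matrix.trace_add, Matrix.trace_smul, Matrix.trace_smul, hX.2, hZ.2, ← add_smul, hst,
      one_smul]
  have hKn : K.Nonempty := by
    obtain ⟨i⟩ := (inferInstance : Nonempty (b × a))
    refine ⟨Matrix.diagonal (Pi.single i 1), Matrix.PosSemidef.diagonal fun j => ?_, ?_⟩
    · by_cases hj : j = i
      · subst hj; simp
      · simp [hj]
    · simp [Matrix.trace]
  obtain ⟨σ, hσ, hσ'⟩ := exists_forall_lt_of_forall_exists_lt hKc hKconv hKn hYconv f g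
    g.continuous_of_finiteDimensional (fun y => (f.flip y).continuous_of_finiteDimensional)
    (fun x => (f x).continuous_of_finiteDimensional) (t := -η) fun W hW => by
      -- For a single W take μ times a state attaining the top eigenvalue t of Tr_B W. Since W ≤ tα
      -- for a channel α, the value of ρ on W is at most tμ, which is the value of σ ⊗ 1.
      obtain ⟨σ, hσ, hσ'⟩ := exists_isMax_traceFst (traceFst_posSemidef hW.1).1
      set t := (∑ p, ∑ q, σ p q * traceFst W p q).re with ht
      have htpos : 0 < t := by
        have h1 := (Complex.nonneg_iff.mp hσ'.trace_nonneg).1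
        rw [Matrix.trace_sub, trace_traceFst, Matrix.trace_smul, Matrix.trace_one] at h1
        simp only [smul_eq_mul, Complex.sub_re, Complex.re_ofReal_mul, Complex.natCast_re,
          hW.2] at h1
        by_contra hcon
        have : t * Fintype.card a ≤ 0 :=
          mul_nonpos_of_nonpos_of_nonneg (not_lt.mp hcon) (Nat.cast_nonneg _)
        linarith
      obtain ⟨α, hα, hα'⟩ := exists_isChannel_le hW.1 htpos hσ'
      refine ⟨(μ : ℂ) • σ, ⟨hσ.1.smul (by exact_mod_cast hμ), by simp [Matrix.trace_smul, hσ.2]⟩, ?_⟩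
      have h1 := pairing_le_of_isCP_sub hρ hα'
      rw [pairing_smul_right] at h1
      have h2 : f W ((μ : ℂ) • σ) = μ * t := by
        rw [ht, ← Complex.re_ofReal_mul]
        simp only [f, LinearMap.mk₂_apply, Matrix.smul_apply, smul_eq_mul, Finset.mul_sum,
          mul_assoc]
      have h3 := mul_le_mul_of_nonneg_left (h α hα) htpos.le
      rw [h2, hg]
      linarith
  -- Adding η·1 absorbs the error of the minimax and makes σ positive definite; the price is η·dim A
  -- in the trace.
  have hσ1 : ((η : ℂ) • (1 : Matrix a a ℂ)).PosDef :=
    Matrix.PosDef.one.smul (by exact_mod_cast hη)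
  refine ⟨σ + (η : ℂ) • 1, hσ1.posSemidef_add hσ.1, ?_, ?_⟩
  · rw [Matrix.trace_add, Matrix.trace_smul, hσ.2, Matrix.trace_one]
    simp
  · have hherm : ((σ + (η : ℂ) • 1) ⊗ₖ (1 : Matrix b b ℂ) - ρ).IsHermitian :=
      ((hσ1.posSemidef_add hσ.1).posSemidef.kronecker Matrix.PosSemidef.one).1.sub hρ.1
    refine posSemidef_of_pairing_nonneg hherm fun W hW => ?_
    have h1 : pairing ((σ + (η : ℂ) • 1) ⊗ₖ (1 : Matrix b b ℂ) - ρ) (ofChoi W) =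
        f W σ - g W + η * W.trace.re := by
      rw [pairing_sub_left, hg, pairing_eq_re, cpairing_ofChoi_kronecker_one]
      simp only [f, LinearMap.mk₂_apply, ← trace_traceFst W]
      simp [add_mul, Finset.sum_add_distrib, Matrix.one_apply, Matrix.trace, Finset.mul_sum]
      ring
    rw [h1]
    rcases (Complex.nonneg_iff.mp hW.trace_nonneg).1.eq_or_lt with h0 | h0
    · have : W = 0 := hW.trace_eq_zero_iff.mp
        (Complex.ext h0.symm (Complex.nonneg_iff.mp hW.trace_nonneg).2.symm)
      simp [this]
    · have h2 := hσ' (((W.trace.re⁻¹ : ℝ) : ℂ) • W)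
        ⟨hW.smul (by exact_mod_cast (inv_pos.mpr h0).le), by
          rw [Matrix.trace_smul, smul_eq_mul, Complex.re_ofReal_mul, inv_mul_cancel₀ h0.ne']⟩
      have h3 : ((W.trace.re⁻¹ : ℝ) : ℂ) • W = (W.trace.re⁻¹ : ℝ) • W := rfl
      rw [h3, map_smul, map_smul, LinearMap.smul_apply, smul_eq_mul, smul_eq_mul, ← mul_sub,
        lt_inv_mul_iff₀ h0] at h2
      linarith

end Duality

/-! ### The diamond distance as a supremum of positive functionals. -/

section DiamondNorm

variable {a b : Type*}

theorem isHermitian_tensorId_sub {r : Type*} [Finite r] {Ψ₁ Ψ₂ : LMap a b} (h₁ : IsCP Ψ₁)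
    (h₂ : IsCP Ψ₂) {τ : Matrix (a × r) (a × r) ℂ} (hτ : τ.PosSemidef) :
    (tensorId (Ψ₁ - Ψ₂) r τ).IsHermitian :=
  (h₁.tensorId_posSemidef hτ).1.sub (h₂.tensorId_posSemidef hτ).1

variable [Fintype a] [Fintype b]

theorem trace_tensorId_sub {r : Type*} [Fintype r] {Ψ₁ Ψ₂ : LMap a b} (h₁ : IsChannel Ψ₁)
    (h₂ : IsChannel Ψ₂) (τ : Matrix (a × r) (a × r) ℂ) :
    (tensorId (Ψ₁ - Ψ₂) r τ).trace = 0 := by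
  change (tensorId Ψ₁ r τ - tensorId Ψ₂ r τ).trace = 0
  rw [Matrix.trace_sub, trace_tensorId h₁.2, trace_tensorId h₂.2, sub_self]

theorem trace_mul_nonneg {n : Type*} [Fintype n] {A B : Matrix n n ℂ} (hA : A.PosSemidef)
    (hB : B.PosSemidef) : 0 ≤ (A * B).trace := by
  obtain ⟨m, v, rfl⟩ := Matrix.posSemidef_iff_eq_sum_vecMulVec.mp hA
  rw [Finset.sum_mul, Matrix.trace_sum]
  refine Finset.sum_nonneg fun i _ => ?_
  rw [Matrix.vecMulVec_mul, Matrix.trace_vecMulVec, dotProduct_comm, ← Matrix.dotProduct_mulVec]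
  exact hB.dotProduct_mulVec_nonneg _

theorem trace_mul_le_of_le_one {n : Type*} [Fintype n] [DecidableEq n] {M B : Matrix n n ℂ}
    (hM : (1 - M).PosSemidef) (hB : B.PosSemidef) : (M * B).trace.re ≤ B.trace.re := by
  have := (Complex.nonneg_iff.mp (trace_mul_nonneg hM hB)).1
  rw [Matrix.sub_mul, Matrix.one_mul, Matrix.trace_sub, Complex.sub_re] at this
  linarith

variable [DecidableEq a] [DecidableEq b]

theorem traceNorm_tensorId_sub_le_two {Ψ₁ Ψ₂ : LMap a b} (h₁ : IsChannel Ψ₁) (h₂ : IsChannel Ψ₂)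
    {τ : Matrix (a × a) (a × a) ℂ} (hτ : IsState τ) : traceNorm (tensorId (Ψ₁ - Ψ₂) a τ) ≤ 2 := by
  obtain ⟨M, hM, hM', h⟩ := exists_two_mul_trace_eq_traceNorm
    (isHermitian_tensorId_sub h₁.1 h₂.1 hτ.1) (trace_tensorId_sub h₁ h₂ τ)
  have h3 : tensorId (Ψ₁ - Ψ₂) a τ = tensorId Ψ₁ a τ - tensorId Ψ₂ a τ := rfl
  rw [h, h3, Matrix.mul_sub, Matrix.trace_sub, Complex.sub_re]
  have h4 := trace_mul_le_of_le_one hM' (h₁.1.tensorId_posSemidef hτ.1)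
  have h5 := (Complex.nonneg_iff.mp (trace_mul_nonneg hM (h₂.1.tensorId_posSemidef hτ.1))).1
  rw [trace_tensorId h₁.2, hτ.2, Complex.one_re] at h4
  linarith

theorem traceNorm_tensorId_le_diamondNorm {Ψ₁ Ψ₂ : LMap a b} (h₁ : IsChannel Ψ₁)
    (h₂ : IsChannel Ψ₂) {τ : Matrix (a × a) (a × a) ℂ} (hτ : IsState τ) :
    traceNorm (tensorId (Ψ₁ - Ψ₂) a τ) ≤ diamondNorm (Ψ₁ - Ψ₂) := by
  refine le_csSup ⟨2, ?_⟩ ⟨τ, hτ, rfl⟩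
  rintro _ ⟨τ, hτ, rfl⟩
  exact traceNorm_tensorId_sub_le_two h₁ h₂ hτ

theorem diamondNorm_nonneg (Ψ : LMap a b) : 0 ≤ diamondNorm Ψ :=
  Real.sSup_nonneg fun _ ⟨_, _, h⟩ => h ▸ traceNorm_nonneg _

theorem exists_posDef_factor {σ : Matrix a a ℂ} (hσ : σ.PosDef) :
    ∃ T S : Matrix a a ℂ, σ = T * T.conjTranspose ∧ S * T = 1 := by
  obtain ⟨U, hU, hU', h⟩ := exists_eigen_decomposition hσ.1
  set d := hσ.1.eigenvalues
  have hd : ∀ i, 0 < Real.sqrt (d i) := fun i => Real.sqrt_pos.mpr (hσ.eigenvalues_pos i)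
  refine ⟨U * Matrix.diagonal fun i => (Real.sqrt (d i) : ℂ),
    (Matrix.diagonal fun i => ((Real.sqrt (d i))⁻¹ : ℂ)) * U.conjTranspose, ?_, ?_⟩
  · rw [Matrix.conjTranspose_mul, Matrix.diagonal_conjTranspose, ← Matrix.mul_assoc,
      Matrix.mul_assoc U, Matrix.diagonal_mul_diagonal]
    conv_lhs => rw [h]
    congr 3
    ext i
    simp [← Complex.ofReal_mul, Real.mul_self_sqrt (hσ.eigenvalues_pos i).le, d]
  · rw [Matrix.mul_assoc, ← Matrix.mul_assoc U.conjTranspose, hU, Matrix.one_mul,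
      Matrix.diagonal_mul_diagonal, ← Matrix.diagonal_one]
    congr 1
    ext i
    exact inv_mul_cancel₀ (by exact_mod_cast (hd i).ne')

omit [DecidableEq a] in
-- Transpose trick: conjugation by T ⊗ 1 is traded for the vectorised T as input on A ⊗ A, and `R`,
-- swapped and transposed, becomes an observable on the output.
theorem cpairing_conj_kronecker_one (T : Matrix a a ℂ) (R : Matrix (a × b) (a × b) ℂ)
    (ψ : LMap a b) :
    cpairing ((T ⊗ₖ (1 : Matrix b b ℂ)) * R * (T ⊗ₖ (1 : Matrix b b ℂ)).conjTranspose) ψ =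
      ((R.submatrix Prod.swap Prod.swap).transpose * tensorId ψ a (Matrix.vecMulVec
        (fun x : a × a => T x.1 x.2) (star fun x : a × a => T x.1 x.2))).trace := by
  have h : ∀ i j, (Matrix.of fun x y => ((T ⊗ₖ (1 : Matrix b b ℂ)) * R *
      (T ⊗ₖ (1 : Matrix b b ℂ)).conjTranspose) (x, i) (y, j)) =
      ∑ q, ∑ p, R (p, i) (q, j) • Matrix.of fun x y => T x p * star (T y q) := by
    intro i j
    ext x y
    simp only [Matrix.of_apply, Matrix.mul_apply, Fintype.sum_prod_type, Matrix.sum_apply,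
      Matrix.smul_apply, Matrix.conjTranspose_apply, Matrix.kroneckerMap_apply, Matrix.one_apply,
      mul_ite, mul_one, mul_zero, ite_mul, zero_mul, Finset.sum_ite_eq,
      Finset.mem_univ, if_true, apply_ite star, star_zero, Finset.sum_mul, smul_eq_mul]
    exact Finset.sum_congr rfl fun p _ => Finset.sum_congr rfl fun q _ => by ring
  have h2 : ∀ i j, tensorId ψ b ((T ⊗ₖ (1 : Matrix b b ℂ)) * R *
      (T ⊗ₖ (1 : Matrix b b ℂ)).conjTranspose) (i, i) (j, j) =
      ∑ q, ∑ p, R (p, i) (q, j) * tensorId ψ a (Matrix.vecMulVec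
        (fun x : a × a => T x.1 x.2) (star fun x : a × a => T x.1 x.2)) (i, p) (j, q) := by
    intro i j
    rw [tensorId_apply, h]
    simp only [map_sum, map_smul, Matrix.sum_apply, Matrix.smul_apply, smul_eq_mul]
    rfl
  simp only [cpairing, h2, Matrix.trace, Matrix.diag_apply, Matrix.mul_apply,
    Fintype.sum_prod_type, Matrix.transpose_apply, Matrix.submatrix_apply, Prod.swap]
  rw [Finset.sum_comm]
  refine Finset.sum_congr rfl fun j _ => ?_
  rw [Finset.sum_comm]

/-- With σ = TT* the domination says that R = (T⁻¹ ⊗ 1)ρ(T⁻¹ ⊗ 1)* satisfies 0 ≤ R ≤ 1. So ρ is an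
effect on the output for the input vector T, whose squared norm is Tr σ, and the trace norm bound
for effects applies. -/
theorem pairing_sub_le_of_kronecker_one {ρ : Matrix (a × b) (a × b) ℂ} (hρ : ρ.PosSemidef)
    {σ : Matrix a a ℂ} (hσ : σ.PosDef) (hρσ : (σ ⊗ₖ (1 : Matrix b b ℂ) - ρ).PosSemidef)
    {Ψ₁ Ψ₂ : LMap a b} (h₁ : IsChannel Ψ₁) (h₂ : IsChannel Ψ₂) [Nonempty a] :
    pairing ρ (Ψ₁ - Ψ₂) ≤ σ.trace.re / 2 * diamondNorm (Ψ₁ - Ψ₂) := by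
  obtain ⟨T, S, hT, hST⟩ := exists_posDef_factor hσ
  have hTS : T * S = 1 := mul_eq_one_comm.mp hST
  set S' := S ⊗ₖ (1 : Matrix b b ℂ) with hS'
  set T' := T ⊗ₖ (1 : Matrix b b ℂ) with hT'
  have hTS' : T' * S' = 1 := by
    rw [hT', hS', ← Matrix.mul_kronecker_mul, hTS, Matrix.one_mul, Matrix.one_kronecker_one]
  have hST' : S' * T' = 1 := mul_eq_one_comm.mp hTS'
  set R := S' * ρ * S'.conjTranspose with hR
  have hρR : ρ = T' * R * T'.conjTranspose := by
    rw [hR, show T' * (S' * ρ * S'.conjTranspose) * T'.conjTranspose =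
      (T' * S') * ρ * (S'.conjTranspose * T'.conjTranspose) by simp only [Matrix.mul_assoc],
      ← Matrix.conjTranspose_mul, hTS']
    simp
  have hRp : R.PosSemidef := hρ.mul_mul_conjTranspose_same _
  have hR1 : (1 - R).PosSemidef := by
    have h := hρσ.mul_mul_conjTranspose_same S'
    have h3 : S' * (σ ⊗ₖ (1 : Matrix b b ℂ)) * S'.conjTranspose = 1 := by
      have : σ ⊗ₖ (1 : Matrix b b ℂ) = T' * T'.conjTranspose := by
        rw [hT', Matrix.conjTranspose_kronecker, ← Matrix.mul_kronecker_mul, ← hT]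
        simp
      rw [this, ← Matrix.mul_assoc, hST', Matrix.one_mul, ← Matrix.conjTranspose_mul, hST']
      simp
    rwa [Matrix.mul_sub, Matrix.sub_mul, h3] at h
  set M := (R.submatrix Prod.swap Prod.swap).transpose with hM
  have hMp : M.PosSemidef := (hRp.submatrix _).transpose
  have hM1 : (1 - M).PosSemidef := by
    have : 1 - M = ((1 - R).submatrix (Prod.swap : b × a → a × b) Prod.swap).transpose := by
      rw [Matrix.submatrix_sub, Pi.sub_apply, Pi.sub_apply,
        Matrix.submatrix_one _ Prod.swap_injective, Matrix.transpose_sub, Matrix.transpose_one]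
    rw [this]
    exact (hR1.submatrix _).transpose
  set v := Matrix.vecMulVec (fun x : a × a => T x.1 x.2) (star fun x : a × a => T x.1 x.2) with hv
  have hvp : v.PosSemidef := Matrix.posSemidef_vecMulVec_self_star _
  have hvt : v.trace = σ.trace := by
    rw [hT]
    simp [hv, Matrix.trace, Matrix.vecMulVec_apply, Matrix.mul_apply, Fintype.sum_prod_type]
  obtain ⟨h3, h4⟩ := Complex.pos_iff.mp hσ.trace_pos
  set s := σ.trace.re with hs
  have hτ : IsState (((s⁻¹ : ℝ) : ℂ) • v) := by
    refine ⟨hvp.smul (by exact_mod_cast (inv_pos.mpr h3).le), ?_⟩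
    rw [Matrix.trace_smul, hvt, show σ.trace = (s : ℂ) from Complex.ext rfl (by simpa using h4.symm),
      smul_eq_mul, ← Complex.ofReal_mul, inv_mul_cancel₀ h3.ne', Complex.ofReal_one]
  have h5 := two_mul_trace_le_traceNorm (isHermitian_tensorId_sub h₁.1 h₂.1 hτ.1)
    (trace_tensorId_sub h₁ h₂ _) hMp hM1
  have h6 := traceNorm_tensorId_le_diamondNorm h₁ h₂ hτ
  have h7 : (M * tensorId (Ψ₁ - Ψ₂) a (((s⁻¹ : ℝ) : ℂ) • v)).trace.re =
      s⁻¹ * pairing ρ (Ψ₁ - Ψ₂) := by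
    rw [map_smul, Matrix.mul_smul, Matrix.trace_smul, smul_eq_mul, Complex.re_ofReal_mul,
      pairing_eq_re, hρR, cpairing_conj_kronecker_one]
  rw [h7] at h5
  have h8 : s⁻¹ * pairing ρ (Ψ₁ - Ψ₂) ≤ diamondNorm (Ψ₁ - Ψ₂) / 2 := by linarith
  rw [inv_mul_le_iff₀ h3] at h8
  linarith

/-- A positive functional bounded by `μ` on channels separates two channels by at most `μ / 2` times
their diamond distance. -/
theorem pairing_sub_le {ρ : Matrix (a × b) (a × b) ℂ} (hρ : ρ.PosSemidef) [Nonempty a] [Nonempty b]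
    {μ : ℝ} (h : ∀ α : LMap a b, IsChannel α → pairing ρ α ≤ μ)
    {Ψ₁ Ψ₂ : LMap a b} (h₁ : IsChannel Ψ₁) (h₂ : IsChannel Ψ₂) :
    pairing ρ (Ψ₁ - Ψ₂) ≤ μ / 2 * diamondNorm (Ψ₁ - Ψ₂) := by
  have key : ∀ η : ℝ, 0 < η → pairing ρ (Ψ₁ - Ψ₂) ≤
      (μ + η * Fintype.card a) / 2 * diamondNorm (Ψ₁ - Ψ₂) := by
    intro η hη
    obtain ⟨σ, hσ, ht, hρσ⟩ := exists_posDef_kronecker_one_sub_posSemidef hρ h hη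
    have := pairing_sub_le_of_kronecker_one hρ hσ hρσ h₁ h₂
    rwa [ht, Complex.ofReal_re] at this
  have hlim : Filter.Tendsto (fun η : ℝ => (μ + η * Fintype.card a) / 2 * diamondNorm (Ψ₁ - Ψ₂))
      (nhdsWithin 0 (Set.Ioi 0)) (nhds ((μ + 0 * Fintype.card a) / 2 * diamondNorm (Ψ₁ - Ψ₂))) :=
    (Continuous.tendsto (by fun_prop) 0).mono_left nhdsWithin_le_nhds
  have := ge_of_tendsto hlim (Filter.eventually_of_mem self_mem_nhdsWithin key)
  simpa using this

theorem functional_sub_le {F : LMap a b →ₗ[ℂ] ℂ} (hF : ∀ φ, IsCP φ → 0 ≤ F φ) [Nonempty a]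
    [Nonempty b] {μ : ℝ} (h : ∀ α : LMap a b, IsChannel α → (F α).re ≤ μ) {Ψ₁ Ψ₂ : LMap a b}
    (h₁ : IsChannel Ψ₁) (h₂ : IsChannel Ψ₂) :
    (F (Ψ₁ - Ψ₂)).re ≤ μ / 2 * diamondNorm (Ψ₁ - Ψ₂) := by
  rw [← cpairing_functionalOp F, ← pairing_eq_re]
  refine pairing_sub_le (functionalOp_posSemidef hF) (fun α hα => ?_) h₁ h₂
  rw [pairing_eq_re, cpairing_functionalOp]
  exact h α hα

/-- If no state discriminates better than `t` under any positive operator of conditional norm at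
most one, then the diamond distance is at most `2 t`. -/
theorem diamondNorm_sub_le {Ψ₁ Ψ₂ : LMap a b} (h₁ : IsChannel Ψ₁) (h₂ : IsChannel Ψ₂) {t : ℝ}
    (ht : 0 ≤ t) (h : ∀ ρ : Matrix (a × b) (a × b) ℂ, ρ.PosSemidef →
      (∀ α : LMap a b, IsChannel α → pairing ρ α ≤ 1) → pairing ρ (Ψ₁ - Ψ₂) ≤ t) :
    diamondNorm (Ψ₁ - Ψ₂) ≤ 2 * t := by
  refine Real.sSup_le ?_ (by linarith)
  rintro _ ⟨τ, hτ, rfl⟩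
  obtain ⟨M, hM, hM', hMt⟩ := exists_two_mul_trace_eq_traceNorm
    (isHermitian_tensorId_sub h₁.1 h₂.1 hτ.1) (trace_tensorId_sub h₁ h₂ τ)
  -- The optimal effect for the input τ gives a positive functional that is at most 1 on channels;
  -- the operator representing it is a legitimate ρ for `h`.
  let F : LMap a b →ₗ[ℂ] ℂ :=
    { toFun := fun φ => (M * tensorId φ a τ).trace
      map_add' := fun φ ψ => by
        rw [show tensorId (φ + ψ) a τ = tensorId φ a τ + tensorId ψ a τ from rfl, Matrix.mul_add,
          Matrix.trace_add]
      map_smul' := fun c φ => by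
        rw [show tensorId (c • φ) a τ = c • tensorId φ a τ from rfl, Matrix.mul_smul,
          Matrix.trace_smul]
        rfl }
  have hF : ∀ φ, cpairing (functionalOp F) φ = (M * tensorId φ a τ).trace :=
    cpairing_functionalOp F
  have h3 := h (functionalOp F)
    (functionalOp_posSemidef fun φ hφ => trace_mul_nonneg hM (hφ.tensorId_posSemidef hτ.1))
    fun α hα => by
      rw [pairing_eq_re, hF]
      have := trace_mul_le_of_le_one hM' (hα.1.tensorId_posSemidef hτ.1)
      rwa [trace_tensorId hα.2, hτ.2, Complex.one_re] at this
  rw [pairing_eq_re, hF] at h3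
  rw [hMt]
  linarith

end DiamondNorm

/-! ### Dual norms of positive operators as suprema over the base section. -/

section DualNorm

variable {a b : Type*} [Fintype b]

/-- For positive `X` the interval [-Θ, Θ] gives nothing above ⟨X, Θ⟩. The bound `C` is needed
because `sSup` of an unbounded set of reals is 0. -/
theorem pairing_le_dualNorm {S : Set (LMap a b)} {X : Matrix (a × b) (a × b) ℂ}
    (hX : X.PosSemidef) (hS : ∀ Θ ∈ S, IsCP Θ) {C : ℝ} (hC : ∀ Θ ∈ S, pairing X Θ ≤ C)
    {Θ : LMap a b} (hΘ : Θ ∈ S) : pairing X Θ ≤ dualNorm S X := by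
  refine le_csSup ⟨C, ?_⟩ ⟨Θ, ⟨Θ, hΘ, ?_, (hS Θ hΘ).add (hS Θ hΘ)⟩, rfl⟩
  · rintro _ ⟨φ, ⟨Λ, hΛ, h, -⟩, rfl⟩
    exact (pairing_le_of_isCP_sub hX h).trans (hC Λ hΛ)
  · rw [sub_self]
    exact fun _ _ _ => Matrix.PosSemidef.zero

theorem dualNorm_le {S : Set (LMap a b)} {X : Matrix (a × b) (a × b) ℂ}
    (hX : X.PosSemidef) (hS : ∀ Θ ∈ S, IsCP Θ) (hne : S.Nonempty) {C : ℝ}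
    (hC : ∀ Θ ∈ S, pairing X Θ ≤ C) : dualNorm S X ≤ C := by
  obtain ⟨Θ, hΘ⟩ := hne
  refine csSup_le ⟨_, Θ, ⟨Θ, hΘ, ?_, (hS Θ hΘ).add (hS Θ hΘ)⟩, rfl⟩ ?_
  · rw [sub_self]
    exact fun _ _ _ => Matrix.PosSemidef.zero
  · rintro _ ⟨φ, ⟨Λ, hΛ, h, -⟩, rfl⟩
    exact (pairing_le_of_isCP_sub hX h).trans (hC Λ hΛ)

variable [Fintype a]

/-- Choi matrices of channels have trace dim A, so they lie in a compact set. -/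
theorem exists_pairing_bound (X : Matrix (a × b) (a × b) ℂ) :
    ∃ C : ℝ, ∀ α : LMap a b, IsChannel α → pairing X α ≤ C := by
  classical
  let F : Matrix (b × a) (b × a) ℂ →ₗ[ℝ] ℝ :=
    Complex.reLm ∘ₗ ((cpairingₗ X ∘ₗ ofChoiₗ).restrictScalars ℝ)
  obtain ⟨C, hC⟩ := (isCompact_posSemidef_trace_le (a := b × a) (Fintype.card a)).bddAbove_image
    F.continuous_of_finiteDimensional.continuousOn
  refine ⟨C, fun α hα => ?_⟩
  have h : F (choi α) = pairing X α := by
    change (cpairing X (ofChoi (choi α))).re = _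
    rw [ofChoi_choi, pairing_eq_re]
  rw [← h]
  refine hC ⟨_, ⟨hα.1.choi_posSemidef, ?_⟩, rfl⟩
  have h1 : ∀ p, ∑ i, choi α (i, p) (i, p) = 1 := fun p => by
    simp only [choi_apply]
    exact (hα.2 _).trans (by simp)
  simp [Matrix.trace, Fintype.sum_prod_type_right, h1]

theorem pairing_le_condNorm {X : Matrix (a × b) (a × b) ℂ} (hX : X.PosSemidef) {α : LMap a b}
    (hα : IsChannel α) : pairing X α ≤ condNorm X :=
  let ⟨_, hC⟩ := exists_pairing_bound X
  pairing_le_dualNorm hX (fun _ h => h.1) hC hα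

theorem condNorm_le [Nonempty b] {X : Matrix (a × b) (a × b) ℂ} (hX : X.PosSemidef) {C : ℝ}
    (hC : ∀ α : LMap a b, IsChannel α → pairing X α ≤ C) : condNorm X ≤ C :=
  dualNorm_le hX (fun _ h => h.1) exists_isChannel hC

end DualNorm

/-! ### Superchannels: composition, convexity, adjointness to the link product. -/

section Superchannels

variable {a₀ a₁ a₀' a₁' b₀ b₁ r₀ r₁ : Type u}
  [Fintype a₀] [Fintype a₁] [Fintype a₀'] [Fintype a₁'] [Fintype r₀] [Fintype r₁]

theorem Superchannel.isChannel_toMap (Θ : Superchannel a₀ a₁ a₀' a₁') : IsChannel Θ.toMap :=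
  (Θ.isChannel_post.tensorId _).comp ((isChannel_relabel _).comp (Θ.isChannel_pre.tensorId _))

/-- Composition of superchannels. -/
def Superchannel.comp (Λ : Superchannel a₀' a₁' r₀ r₁) (Θ : Superchannel a₀ a₁ a₀' a₁') :
    Superchannel a₀ a₁ r₀ r₁ where
  U := Λ.U × Θ.U
  pre := relabel (Equiv.prodAssoc Λ.U Θ.U a₀).symm ∘ₗ QChan.idTensor Λ.U Θ.pre ∘ₗ Λ.pre
  post := Λ.post ∘ₗ QChan.idTensor Λ.U Θ.post ∘ₗ relabel (Equiv.prodAssoc Λ.U Θ.U a₁)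
  isChannel_pre := (isChannel_relabel _).comp ((Θ.isChannel_pre.idTensor _).comp Λ.isChannel_pre)
  isChannel_post := Λ.isChannel_post.comp ((Θ.isChannel_post.idTensor _).comp (isChannel_relabel _))

theorem Superchannel.apply_comp (Λ : Superchannel a₀' a₁' r₀ r₁)
    (Θ : Superchannel a₀ a₁ a₀' a₁') (Φ : LMap (a₀ × b₀) (a₁ × b₁)) :
    (Λ.comp Θ).apply Φ = Λ.apply (Θ.apply Φ) := rfl

/-- The identity superchannel. -/
def Superchannel.refl (a₀ a₁ : Type u) [Fintype a₀] [Fintype a₁] : Superchannel a₀ a₁ a₀ a₁ where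
  U := PUnit
  pre := relabel (Equiv.punitProd a₀).symm
  post := relabel (Equiv.punitProd a₁)
  isChannel_pre := isChannel_relabel _
  isChannel_post := isChannel_relabel _

theorem Superchannel.refl_apply (Φ : LMap (a₀ × b₀) (a₁ × b₁)) :
    (Superchannel.refl a₀ a₁).apply Φ = Φ := rfl

theorem Superchannel.nonempty [Nonempty a₀] [Nonempty a₁'] :
    Nonempty (Superchannel a₀ a₁ a₀' a₁') := by
  obtain ⟨α, hα⟩ := exists_isChannel (a := a₀') (b := PUnit.{u+1} × a₀)
  obtain ⟨β, hβ⟩ := exists_isChannel (a := PUnit.{u+1} × a₁) (b := a₁')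
  exact ⟨⟨PUnit, α, β, hα, hβ⟩⟩

theorem Superchannel.apply_add (Θ : Superchannel a₀ a₁ a₀' a₁')
    (Φ Ψ : LMap (a₀ × b₀) (a₁ × b₁)) : Θ.apply (Φ + Ψ) = Θ.apply Φ + Θ.apply Ψ := by
  have h : QChan.idTensor Θ.U (Φ + Ψ) = QChan.idTensor Θ.U Φ + QChan.idTensor Θ.U Ψ := rfl
  simp only [Superchannel.apply, h, LinearMap.add_comp, LinearMap.comp_add]

theorem Superchannel.apply_smul (Θ : Superchannel a₀ a₁ a₀' a₁') (c : ℂ)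
    (Φ : LMap (a₀ × b₀) (a₁ × b₁)) : Θ.apply (c • Φ) = c • Θ.apply Φ := by
  have h : QChan.idTensor Θ.U (c • Φ) = c • QChan.idTensor Θ.U Φ := rfl
  simp only [Superchannel.apply, h, LinearMap.smul_comp, LinearMap.comp_smul]

/-- The isometry of coordinate spaces induced by an injection of the labels. -/
def embedding {a b : Type*} [DecidableEq b] (f : a → b) : Matrix b a ℂ :=
  Matrix.of fun i j => if i = f j then 1 else 0

theorem embedding_conj_apply {a b : Type*} [Fintype a] [DecidableEq b] {f : a → b}
    (hf : Function.Injective f) (X : Matrix a a ℂ) (i j : a) :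
    conjBy (embedding f) X (f i) (f j) = X i j := by
  classical
  simp [conjBy, embedding, Matrix.mul_apply, hf.eq_iff, apply_ite]

theorem embedding_conj_apply_eq_zero {a b : Type*} [Fintype a] [DecidableEq b] {f : a → b}
    (X : Matrix a a ℂ) {i j : b} (hi : ∀ k, i ≠ f k) :
    conjBy (embedding f) X i j = 0 := by
  simp [conjBy, embedding, Matrix.mul_apply, hi]

theorem trace_embedding_conj {a b : Type*} [Fintype a] [Fintype b] [DecidableEq b] {f : a → b}
    (hf : Function.Injective f) (X : Matrix a a ℂ) :
    (conjBy (embedding f) X).trace = X.trace := by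
  classical
  have h : (embedding f).conjTranspose * embedding f = 1 := by
    ext i j
    simp [embedding, Matrix.mul_apply, hf.eq_iff, Matrix.one_apply, apply_ite, eq_comm]
  change (embedding f * X * (embedding f).conjTranspose).trace = _
  rw [Matrix.trace_mul_comm, ← Matrix.mul_assoc, h, Matrix.one_mul]

/-- Restriction to the span of a family of basis vectors. -/
def compress {a b : Type*} (f : a → b) : LMap b a where
  toFun X := X.submatrix f f
  map_add' _ _ := rfl
  map_smul' _ _ := rfl

theorem compress_apply {a b : Type*} (f : a → b) (X : Matrix b b ℂ) :
    compress f X = X.submatrix f f := rfl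

theorem isCP_compress {a b : Type*} (f : a → b) : IsCP (compress f) :=
  fun _ _ hX => hX.submatrix (Prod.map f id)

/-- The ancilla is the direct sum of the two ancillas: the preprocessing prepares the blocks with
weights s and t, the postprocessing applies the map belonging to the block. Coherences between
blocks are neither created nor read. -/
theorem exists_superchannel_convexCombination (Θ Λ : Superchannel a₀ a₁ a₀' a₁') {s t : ℝ}
    (hs : 0 ≤ s) (ht : 0 ≤ t) (hst : s + t = 1) : ∃ Ξ : Superchannel a₀ a₁ a₀' a₁',
      ∀ Φ : LMap (a₀ × b₀) (a₁ × b₁),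
        Ξ.apply Φ = (s : ℂ) • Θ.apply Φ + (t : ℂ) • Λ.apply Φ := by
  classical
  let f₀ : Θ.U × a₀ → (Θ.U ⊕ Λ.U) × a₀ := Prod.map Sum.inl id
  let g₀ : Λ.U × a₀ → (Θ.U ⊕ Λ.U) × a₀ := Prod.map Sum.inr id
  let f₁ : Θ.U × a₁ → (Θ.U ⊕ Λ.U) × a₁ := Prod.map Sum.inl id
  let g₁ : Λ.U × a₁ → (Θ.U ⊕ Λ.U) × a₁ := Prod.map Sum.inr id
  have hf₀ : Function.Injective f₀ := Sum.inl_injective.prodMap Function.injective_id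
  have hg₀ : Function.Injective g₀ := Sum.inr_injective.prodMap Function.injective_id
  let Ξ : Superchannel a₀ a₁ a₀' a₁' :=
    { U := Θ.U ⊕ Λ.U
      pre := (s : ℂ) • (conjBy (embedding f₀) ∘ₗ Θ.pre) + (t : ℂ) • (conjBy (embedding g₀) ∘ₗ Λ.pre)
      post := Θ.post ∘ₗ compress f₁ + Λ.post ∘ₗ compress g₁
      isChannel_pre := by
        refine ⟨(((isCP_conjBy _).comp Θ.isChannel_pre.1).smul hs).add
          (((isCP_conjBy _).comp Λ.isChannel_pre.1).smul ht), fun X => ?_⟩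
        simp only [LinearMap.add_apply, LinearMap.smul_apply, LinearMap.comp_apply,
          Matrix.trace_add, Matrix.trace_smul, trace_embedding_conj hf₀, trace_embedding_conj hg₀,
          Θ.isChannel_pre.2, Λ.isChannel_pre.2]
        rw [← add_smul, ← Complex.ofReal_add, hst, Complex.ofReal_one, one_smul]
      isChannel_post := by
        refine ⟨(Θ.isChannel_post.1.comp (isCP_compress _)).add
          (Λ.isChannel_post.1.comp (isCP_compress _)), fun X => ?_⟩
        simp only [LinearMap.add_apply, LinearMap.comp_apply, Matrix.trace_add,
          Θ.isChannel_post.2, Λ.isChannel_post.2]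
        simp [Matrix.trace, compress_apply, Fintype.sum_prod_type, Fintype.sum_sum_type, f₁, g₁] }
  have hinl : ∀ X u x v y, Ξ.pre X (Sum.inl u, x) (Sum.inl v, y) =
      (s : ℂ) * Θ.pre X (u, x) (v, y) := by
    intro X u x v y
    change (s : ℂ) * conjBy (embedding f₀) (Θ.pre X) (f₀ (u, x)) (f₀ (v, y)) +
      (t : ℂ) * conjBy (embedding g₀) (Λ.pre X) (Sum.inl u, x) (Sum.inl v, y) = _
    rw [embedding_conj_apply hf₀, embedding_conj_apply_eq_zero _ fun k => by simp [g₀, Prod.ext_iff]]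
    simp
  have hinr : ∀ X u x v y, Ξ.pre X (Sum.inr u, x) (Sum.inr v, y) =
      (t : ℂ) * Λ.pre X (u, x) (v, y) := by
    intro X u x v y
    change (s : ℂ) * conjBy (embedding f₀) (Θ.pre X) (Sum.inr u, x) (Sum.inr v, y) +
      (t : ℂ) * conjBy (embedding g₀) (Λ.pre X) (g₀ (u, x)) (g₀ (v, y)) = _
    rw [embedding_conj_apply hg₀, embedding_conj_apply_eq_zero _ fun k => by simp [f₀, Prod.ext_iff]]
    simp
  refine ⟨Ξ, fun Φ => LinearMap.ext fun X => ?_⟩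
  ext ⟨i, p⟩ ⟨j, q⟩
  have happly : ∀ (Υ : Superchannel a₀ a₁ a₀' a₁'), Υ.apply Φ X (i, p) (j, q) =
    Υ.post (Matrix.of fun x y => Φ (Matrix.of fun z w =>
      Υ.pre (Matrix.of fun k l => X (k, z.2) (l, w.2)) (x.1, z.1) (y.1, w.1)) (x.2, p) (y.2, q))
      i j := fun _ => rfl
  simp only [LinearMap.add_apply, LinearMap.smul_apply, Matrix.add_apply, Matrix.smul_apply,
    smul_eq_mul]
  rw [happly, happly Θ, happly Λ]
  have h1 : ∀ Z, Ξ.post Z = Θ.post (Z.submatrix f₁ f₁) + Λ.post (Z.submatrix g₁ g₁) :=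
    fun _ => rfl
  have h2 : ∀ (c : ℂ) (Y : Matrix (a₀ × b₀) (a₀ × b₀) ℂ) x y, c * Φ Y x y = Φ (c • Y) x y := by
    intro c Y x y
    rw [map_smul]; rfl
  rw [h1, Matrix.add_apply]
  congr 1
  · rw [← smul_eq_mul, ← Matrix.smul_apply, ← map_smul]
    refine congrArg (fun Y => Θ.post Y i j) ?_
    ext ⟨u, x⟩ ⟨v, y⟩
    simp only [Matrix.smul_apply, smul_eq_mul, Matrix.of_apply, h2]
    refine congrArg (fun Y => Φ Y (x, p) (y, q)) ?_
    ext z w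
    exact hinl _ _ _ _ _
  · rw [← smul_eq_mul, ← Matrix.smul_apply, ← map_smul]
    refine congrArg (fun Y => Λ.post Y i j) ?_
    ext ⟨u, x⟩ ⟨v, y⟩
    simp only [Matrix.smul_apply, smul_eq_mul, Matrix.of_apply, h2]
    refine congrArg (fun Y => Φ Y (x, p) (y, q)) ?_
    ext z w
    exact hinr _ _ _ _ _

variable [Fintype b₀] [Fintype b₁]

theorem Superchannel.isChannel_apply (Θ : Superchannel a₀ a₁ a₀' a₁')
    {Φ : LMap (a₀ × b₀) (a₁ × b₁)} (hΦ : IsChannel Φ) : IsChannel (Θ.apply Φ) :=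
  (Θ.isChannel_post.tensorId _).comp ((isChannel_relabel _).comp ((hΦ.idTensor _).comp
    ((isChannel_relabel _).comp (Θ.isChannel_pre.tensorId _))))

theorem Superchannel.isCP_apply (Θ : Superchannel a₀ a₁ a₀' a₁')
    {Φ : LMap (a₀ × b₀) (a₁ × b₁)} (hΦ : IsCP Φ) : IsCP (Θ.apply Φ) :=
  (Θ.isChannel_post.1.tensorId _).comp ((isCP_relabel _).comp ((hΦ.idTensor _).comp
    ((isCP_relabel _).comp (Θ.isChannel_pre.1.tensorId _))))

omit [Fintype a₀] [Fintype a₁] [Fintype r₀] [Fintype r₁] in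
theorem linkChoi_apply [DecidableEq a₀] [DecidableEq b₀]
    (ρ : Matrix ((r₀ × b₀) × (r₁ × b₁)) ((r₀ × b₀) × (r₁ × b₁)) ℂ)
    (Φ : LMap (a₀ × b₀) (a₁ × b₁)) (p q : (r₀ × a₁) × (r₁ × a₀)) :
    linkChoi ρ Φ p q = ∑ i : b₀ × b₁, ∑ j : b₀ × b₁,
      ρ ((p.1.1, i.1), (p.2.1, i.2)) ((q.1.1, j.1), (q.2.1, j.2)) *
        choi Φ ((p.1.2, i.2), (p.2.2, i.1)) ((q.1.2, j.2), (q.2.2, j.1)) := rfl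

/-- The link product is X ⊗ Y contracted with the unnormalised maximally entangled vector on the two
copies of B; the transposition in its definition is what gives the form E(X ⊗ Y)E*. -/
theorem linkProd_posSemidef {a b c : Type*} [Fintype a] [Fintype b] [Fintype c]
    {X : Matrix (a × b) (a × b) ℂ} {Y : Matrix (b × c) (b × c) ℂ} (hX : X.PosSemidef)
    (hY : Y.PosSemidef) : (linkProd X Y).PosSemidef := by
  classical
  let E : Matrix (a × c) ((a × b) × (b × c)) ℂ := Matrix.of fun p q =>
    if p.1 = q.1.1 then if p.2 = q.2.2 then if q.1.2 = q.2.1 then 1 else 0 else 0 else 0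
  have h : linkProd X Y = E * (X ⊗ₖ Y) * E.conjTranspose := by
    ext p q
    simp only [E, linkProd, Matrix.mul_apply, Matrix.of_apply, Matrix.kroneckerMap_apply,
      Fintype.sum_prod_type, Matrix.conjTranspose_apply, apply_ite star, star_one, star_zero,
      mul_ite, mul_one, mul_zero, ite_mul, one_mul, zero_mul, Finset.sum_ite_eq,
      Finset.sum_ite_irrel, Finset.sum_const_zero, Finset.mem_univ, if_true]
    exact Finset.sum_comm
  rw [h]
  exact (hX.kronecker hY).mul_mul_conjTranspose_same _

theorem linkChoi_posSemidef [DecidableEq a₀] [DecidableEq b₀]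
    {ρ : Matrix ((r₀ × b₀) × (r₁ × b₁)) ((r₀ × b₀) × (r₁ × b₁)) ℂ} (hρ : ρ.PosSemidef)
    {Φ : LMap (a₀ × b₀) (a₁ × b₁)} (hΦ : IsCP Φ) : (linkChoi ρ Φ).PosSemidef := by
  unfold linkChoi
  exact (isCP_relabel _).posSemidef (linkProd_posSemidef ((isCP_relabel _).posSemidef hρ)
    ((isCP_relabel _).posSemidef hΦ.choi_posSemidef))

/-- Both sides are the same closed network of ρ, Φ and Θ contracted in different orders. Expanding Φ
in its Choi matrix produces the same terms `Q` on each side. -/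
theorem cpairing_linkChoi [DecidableEq a₀] [DecidableEq b₀]
    (ρ : Matrix ((r₀ × b₀) × (r₁ × b₁)) ((r₀ × b₀) × (r₁ × b₁)) ℂ)
    (Φ : LMap (a₀ × b₀) (a₁ × b₁)) (Θ : Superchannel a₀ a₁ r₀ r₁) :
    cpairing (linkChoi ρ Φ) Θ.toMap = cpairing ρ (Θ.apply Φ) := by
  let P : r₁ × b₁ → r₁ × b₁ → b₀ → b₀ → Matrix (Θ.U × a₀) (Θ.U × a₀) ℂ := fun z w m n =>
    Θ.pre (Matrix.of fun k l => ρ ((k, m), z) ((l, n), w))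
  let Q : r₁ × b₁ → r₁ × b₁ → a₀ × b₀ → a₀ × b₀ → ℂ := fun z w m n =>
    Θ.post (Matrix.of fun x y => choi Φ ((x.2, z.2), m) ((y.2, w.2), n) *
      P z w m.2 n.2 (x.1, m.1) (y.1, n.1)) z.1 w.1
  have hL : cpairing (linkChoi ρ Φ) Θ.toMap = ∑ z : r₁ × a₀, ∑ w : r₁ × a₀,
      ∑ i : b₀ × b₁, ∑ j : b₀ × b₁, Q (z.1, i.2) (w.1, j.2) (z.2, i.1) (w.2, j.1) := by
    refine Finset.sum_congr rfl fun z _ => Finset.sum_congr rfl fun w _ => ?_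
    have h1 : tensorId Θ.toMap (r₁ × a₀) (linkChoi ρ Φ) (z, z) (w, w) =
      Θ.post (Matrix.of fun x y => Θ.pre (Matrix.of fun k l =>
        linkChoi ρ Φ ((k, x.2), z) ((l, y.2), w)) (x.1, z.2) (y.1, w.2)) z.1 w.1 := rfl
    have h2 : (Matrix.of fun x y : Θ.U × a₁ => Θ.pre (Matrix.of fun k l =>
        linkChoi ρ Φ ((k, x.2), z) ((l, y.2), w)) (x.1, z.2) (y.1, w.2)) =
        ∑ i : b₀ × b₁, ∑ j : b₀ × b₁, Matrix.of fun x y =>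
          choi Φ ((x.2, i.2), (z.2, i.1)) ((y.2, j.2), (w.2, j.1)) *
            P (z.1, i.2) (w.1, j.2) i.1 j.1 (x.1, z.2) (y.1, w.2) := by
      ext x y
      have h3 : (Matrix.of fun k l => linkChoi ρ Φ ((k, x.2), z) ((l, y.2), w)) =
          ∑ i : b₀ × b₁, ∑ j : b₀ × b₁, choi Φ ((x.2, i.2), (z.2, i.1)) ((y.2, j.2), (w.2, j.1)) •
            Matrix.of fun k l => ρ ((k, i.1), (z.1, i.2)) ((l, j.1), (w.1, j.2)) := by
        ext k l
        simp only [Matrix.of_apply, linkChoi_apply, Matrix.sum_apply, Matrix.smul_apply,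
          smul_eq_mul]
        exact Finset.sum_congr rfl fun i _ => Finset.sum_congr rfl fun j _ => mul_comm _ _
      simp only [Matrix.of_apply, Matrix.sum_apply]
      rw [h3]
      simp only [map_sum, map_smul, Matrix.sum_apply, Matrix.smul_apply, smul_eq_mul]
      rfl
    rw [h1, h2]
    simp only [map_sum, Matrix.sum_apply]
    rfl
  have hR : cpairing ρ (Θ.apply Φ) = ∑ z : r₁ × b₁, ∑ w : r₁ × b₁,
      ∑ m : a₀ × b₀, ∑ n : a₀ × b₀, Q z w m n := by
    refine Finset.sum_congr rfl fun z _ => Finset.sum_congr rfl fun w _ => ?_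
    have h1 : tensorId (Θ.apply Φ) (r₁ × b₁) ρ (z, z) (w, w) =
      Θ.post (Matrix.of fun x y => Φ (Matrix.of fun m n => P z w m.2 n.2 (x.1, m.1) (y.1, n.1))
        (x.2, z.2) (y.2, w.2)) z.1 w.1 := rfl
    have h2 : (Matrix.of fun x y : Θ.U × a₁ => Φ (Matrix.of fun m n =>
        P z w m.2 n.2 (x.1, m.1) (y.1, n.1)) (x.2, z.2) (y.2, w.2)) =
        ∑ m : a₀ × b₀, ∑ n : a₀ × b₀, Matrix.of fun x y =>
          choi Φ ((x.2, z.2), m) ((y.2, w.2), n) * P z w m.2 n.2 (x.1, m.1) (y.1, n.1) := by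
      ext x y
      simp only [Matrix.of_apply, Matrix.sum_apply, LMap.apply_eq_sum Φ]
      exact Finset.sum_congr rfl fun i _ => Finset.sum_congr rfl fun j _ => mul_comm _ _
    rw [h1, h2]
    simp only [map_sum, Matrix.sum_apply]
    rfl
  rw [hL, hR]
  -- On the left A₀ is summed by the pairing and B₁ by the link product; on the right B₁ is summed
  -- by the pairing and A₀ by the expansion of Φ.
  let e : ((r₁ × a₀) × (r₁ × a₀)) × ((b₀ × b₁) × (b₀ × b₁)) ≃
      ((r₁ × b₁) × (r₁ × b₁)) × ((a₀ × b₀) × (a₀ × b₀)) :=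
    { toFun := fun x => (((x.1.1.1, x.2.1.2), (x.1.2.1, x.2.2.2)),
        ((x.1.1.2, x.2.1.1), (x.1.2.2, x.2.2.1)))
      invFun := fun x => (((x.1.1.1, x.2.1.1), (x.1.2.1, x.2.2.1)),
        ((x.2.1.2, x.1.1.2), (x.2.2.2, x.1.2.2)))
      left_inv := fun _ => rfl
      right_inv := fun _ => rfl }
  have he : ∑ x : ((r₁ × a₀) × (r₁ × a₀)) × ((b₀ × b₁) × (b₀ × b₁)),
      Q (x.1.1.1, x.2.1.2) (x.1.2.1, x.2.2.2) (x.1.1.2, x.2.1.1) (x.1.2.2, x.2.2.1) =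
      ∑ x : ((r₁ × b₁) × (r₁ × b₁)) × ((a₀ × b₀) × (a₀ × b₀)), Q x.1.1 x.1.2 x.2.1 x.2.2 :=
    Fintype.sum_equiv e _ _ fun _ => rfl
  simpa only [Fintype.sum_prod_type (α₁ := (r₁ × a₀) × (r₁ × a₀)),
    Fintype.sum_prod_type (α₁ := (r₁ × b₁) × (r₁ × b₁)),
    Fintype.sum_prod_type (α₁ := r₁ × a₀), Fintype.sum_prod_type (α₁ := r₁ × b₁),
    Fintype.sum_prod_type (α₁ := b₀ × b₁), Fintype.sum_prod_type (α₁ := a₀ × b₀)] using he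

end Superchannels

theorem le_of_forall_pos_le_add_mul {x y c : ℝ} (h : ∀ η : ℝ, 0 < η → x ≤ y + c * η) : x ≤ y := by
  have hlim : Filter.Tendsto (fun η : ℝ => y + c * η) (nhdsWithin 0 (Set.Ioi 0))
      (nhds (y + c * 0)) := (Continuous.tendsto (by fun_prop) 0).mono_left nhdsWithin_le_nhds
  simpa using ge_of_tendsto hlim (Filter.eventually_of_mem self_mem_nhdsWithin h)

/-! ### The conversion distance against positive functionals, in both directions. -/

section ConversionDistance

theorem traceNorm_neg {a : Type*} [Fintype a] [DecidableEq a] (X : Matrix a a ℂ) :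
    traceNorm (-X) = traceNorm X := by
  simp [traceNorm]

theorem diamondNorm_sub_comm {a b : Type*} [Fintype a] [Fintype b] [DecidableEq a] [DecidableEq b]
    (Φ Ψ : LMap a b) : diamondNorm (Φ - Ψ) = diamondNorm (Ψ - Φ) := by
  have h : ∀ ρ, tensorId (Φ - Ψ) a ρ = -tensorId (Ψ - Φ) a ρ := fun ρ => by
    rw [← neg_sub Ψ Φ]; rfl
  simp only [diamondNorm, h, traceNorm_neg]

variable {a₀ a₁ a₀' a₁' b₀ b₁ : Type u}
  [Fintype a₀] [Fintype a₁] [Fintype a₀'] [Fintype a₁'] [Fintype b₀] [Fintype b₁]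
  [DecidableEq a₀] [DecidableEq a₁] [DecidableEq a₀'] [DecidableEq a₁']
  [DecidableEq b₀] [DecidableEq b₁]
  [Nonempty a₀] [Nonempty a₁] [Nonempty a₀'] [Nonempty a₁'] [Nonempty b₀] [Nonempty b₁]
  {Φ₁ : LMap (a₀ × b₀) (a₁ × b₁)} {Φ₂ : LMap (a₀' × b₀) (a₁' × b₁)} {ε : ℝ}

omit [DecidableEq a₀] [DecidableEq a₁] [Nonempty a₁] in
-- The common core of both implications starting from the distance. Attainment of the infimum over Θ
-- is not established, whence η.
theorem exists_functional_le_of_conversionDist_le (hΦ₁ : IsChannel Φ₁) (hΦ₂ : IsChannel Φ₂)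
    (h : conversionDist Φ₁ Φ₂ ≤ ε) {F : LMap (a₀' × b₀) (a₁' × b₁) →ₗ[ℂ] ℂ}
    (hF : ∀ φ, IsCP φ → 0 ≤ F φ) {μ : ℝ} (hμ : ∀ α, IsChannel α → (F α).re ≤ μ) {η : ℝ}
    (hη : 0 < η) : ∃ Θ : Superchannel a₀ a₁ a₀' a₁',
      (F Φ₂).re ≤ (F (Θ.apply Φ₁)).re + μ / 2 * (ε + η) := by
  obtain ⟨Θ₀⟩ := Superchannel.nonempty (a₀ := a₀) (a₁ := a₁) (a₀' := a₀') (a₁' := a₁')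
  have hne : {t : ℝ | ∃ Θ : Superchannel a₀ a₁ a₀' a₁',
      t = diamondNorm (Θ.apply Φ₁ - Φ₂)}.Nonempty := ⟨_, Θ₀, rfl⟩
  obtain ⟨_, ⟨Θ, rfl⟩, hΘ⟩ := exists_lt_of_csInf_lt hne
    (show conversionDist Φ₁ Φ₂ < ε + η by linarith)
  refine ⟨Θ, ?_⟩
  have hμ0 : 0 ≤ μ := by
    have := hμ Φ₂ hΦ₂
    exact (Complex.nonneg_iff.mp (hF Φ₂ hΦ₂.1)).1.trans this
  have h1 := functional_sub_le hF hμ hΦ₂ (Θ.isChannel_apply hΦ₁)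
  rw [diamondNorm_sub_comm, map_sub, Complex.sub_re] at h1
  have h2 := mul_le_mul_of_nonneg_left hΘ.le (by linarith : 0 ≤ μ / 2)
  linarith

omit [DecidableEq a₀] [DecidableEq a₁] [Nonempty a₀] [Nonempty a₁] [Nonempty a₀'] [Nonempty b₀] in
-- Minimax replaces one Θ for all ρ by a Θ for each ρ.
theorem conversionDist_le_of_forall_pairing (hΦ₁ : IsChannel Φ₁) (hΦ₂ : IsChannel Φ₂) (hε : 0 ≤ ε)
    (h : ∀ ρ : Matrix ((a₀' × b₀) × (a₁' × b₁)) ((a₀' × b₀) × (a₁' × b₁)) ℂ, ρ.PosSemidef →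
      (∀ α : LMap (a₀' × b₀) (a₁' × b₁), IsChannel α → pairing ρ α ≤ 1) → ∀ η : ℝ, 0 < η →
      ∃ Θ : Superchannel a₀ a₁ a₀' a₁',
        pairing ρ Φ₂ ≤ pairing ρ (Θ.apply Φ₁) + ε / 2 + η) :
    conversionDist Φ₁ Φ₂ ≤ ε := by
  -- The constant 4: one η from `h` and one for strictness in the minimax, both doubled by
  -- `diamondNorm_sub_le`.
  refine le_of_forall_pos_le_add_mul (c := 4) fun η hη => ?_
  let K : Set (Matrix ((a₀' × b₀) × (a₁' × b₁)) ((a₀' × b₀) × (a₁' × b₁)) ℂ) :=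
    {ρ | ρ.PosSemidef ∧ ∀ α : LMap (a₀' × b₀) (a₁' × b₁), IsChannel α → pairing ρ α ≤ 1}
  let Y : Set (Matrix ((a₁' × b₁) × (a₀' × b₀)) ((a₁' × b₁) × (a₀' × b₀)) ℂ) :=
    {W | ∃ Θ : Superchannel a₀ a₁ a₀' a₁', W = choi (Θ.apply Φ₁)}
  let f : Matrix ((a₀' × b₀) × (a₁' × b₁)) ((a₀' × b₀) × (a₁' × b₁)) ℂ →ₗ[ℝ]
      Matrix ((a₁' × b₁) × (a₀' × b₀)) ((a₁' × b₁) × (a₀' × b₀)) ℂ →ₗ[ℝ] ℝ :=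
    LinearMap.mk₂ ℝ (fun ρ W => pairing ρ (ofChoi W))
      (fun ρ σ W => by
        simp only [pairing_eq_re, ← cpairingₗ_apply, map_add, LinearMap.add_apply, Complex.add_re])
      (fun c ρ W => pairing_smul_left ρ c _)
      (fun ρ V W => by rw [← ofChoiₗ_apply, map_add, pairing_add_right]; rfl)
      (fun c ρ W => by
        rw [smul_eq_mul, ← pairing_smul_right ρ c]
        congr 1
        exact map_smul ofChoiₗ (c : ℂ) W)
  let g : Matrix ((a₀' × b₀) × (a₁' × b₁)) ((a₀' × b₀) × (a₁' × b₁)) ℂ →ₗ[ℝ] ℝ :=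
    f.flip (choi Φ₂)
  have hfW : ∀ ρ Ψ, f ρ (choi Ψ) = pairing ρ Ψ := fun ρ Ψ => by
    change pairing ρ (ofChoi (choi Ψ)) = _
    rw [ofChoi_choi]
  have hKclosed : IsClosed K := by
    have : K = {ρ | ρ.PosSemidef} ∩ ⋂ α : {α : LMap (a₀' × b₀) (a₁' × b₁) // IsChannel α},
        {ρ | f.flip (choi α.1) ρ ≤ 1} := by
      ext ρ
      simp [K, hfW]
    rw [this]
    exact isClosed_posSemidef.inter (isClosed_iInter fun α =>
      isClosed_le (f.flip (choi α.1)).continuous_of_finiteDimensional continuous_const)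
  have hKcomp : IsCompact K := by
    refine (isCompact_posSemidef_trace_le (Fintype.card (a₁' × b₁))).of_isClosed_subset hKclosed
      fun ρ hρ => ⟨hρ.1, ?_⟩
    set d : ℝ := (Fintype.card (a₁' × b₁) : ℝ) with hd
    have hdpos : 0 < d := by rw [hd]; exact_mod_cast Fintype.card_pos
    -- The completely depolarising channel: its pairing with ρ is Tr ρ / d, which bounds the trace
    -- on `K`.
    let W : Matrix ((a₁' × b₁) × (a₀' × b₀)) ((a₁' × b₁) × (a₀' × b₀)) ℂ :=
      ((d⁻¹ : ℝ) : ℂ) • 1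
    have hW : IsChannel (ofChoi W) := by
      refine isChannel_ofChoi (Matrix.PosSemidef.one.smul
        (by exact_mod_cast (inv_pos.mpr hdpos).le)) fun p q => ?_
      have : (d : ℂ) * ((d⁻¹ : ℝ) : ℂ) = 1 := by
        rw [← Complex.ofReal_mul, mul_inv_cancel₀ hdpos.ne', Complex.ofReal_one]
      by_cases hpq : p = q
      · subst hpq
        simp only [W, Matrix.smul_apply, Matrix.one_apply_eq, smul_eq_mul, mul_one,
          Finset.sum_const, Finset.card_univ, nsmul_eq_mul, if_true]
        rw [← this, hd, Complex.ofReal_natCast]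
      · simp [W, hpq]
    have h1 := hρ.2 _ hW
    have h2 : pairing ρ (ofChoi W) = d⁻¹ * ρ.trace.re := by
      rw [pairing_eq_re, ← Complex.re_ofReal_mul, cpairing_ofChoi]
      congr 1
      simp only [W, Matrix.smul_apply, Matrix.one_apply, Prod.mk.injEq, smul_eq_mul, ite_and,
        mul_ite, mul_one, mul_zero, Finset.sum_ite_irrel, Finset.sum_const_zero,
        Finset.sum_ite_eq, Finset.mem_univ, if_true, Matrix.trace, Matrix.diag_apply,
        Finset.mul_sum]
      refine Eq.trans ?_ (Fintype.sum_prod_type_right fun x : (a₀' × b₀) × (a₁' × b₁) =>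
        ((d⁻¹ : ℝ) : ℂ) * ρ x x).symm
      exact Finset.sum_congr rfl fun i _ => Finset.sum_congr rfl fun p _ => mul_comm _ _
    rw [h2, inv_mul_le_iff₀ hdpos, mul_one] at h1
    exact h1
  have hKconv : Convex ℝ K := by
    intro ρ hρ σ hσ s t hs ht hst
    refine ⟨convex_posSemidef hρ.1 hσ.1 hs ht hst, fun α hα => ?_⟩
    rw [← hfW, map_add, map_smul, map_smul, LinearMap.add_apply, LinearMap.smul_apply,
      LinearMap.smul_apply, hfW, hfW, smul_eq_mul, smul_eq_mul, ← hst]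
    exact add_le_add (mul_le_of_le_one_right hs (hρ.2 α hα)) (mul_le_of_le_one_right ht (hσ.2 α hα))
  have hYconv : Convex ℝ Y := by
    rintro _ ⟨Θ, rfl⟩ _ ⟨Λ, rfl⟩ s t hs ht hst
    obtain ⟨Ξ, hΞ⟩ := exists_superchannel_convexCombination (b₀ := b₀) (b₁ := b₁) Θ Λ hs ht hst
    exact ⟨Ξ, by rw [hΞ]; rfl⟩
  obtain ⟨_, ⟨Θ, rfl⟩, hΘ⟩ := exists_forall_lt_of_forall_exists_lt hKcomp hKconv
    ⟨0, Matrix.PosSemidef.zero, fun α _ => by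
      rw [pairing_eq_re, ← cpairingₗ_apply, map_zero, LinearMap.zero_apply]; simp⟩ hYconv f g
    g.continuous_of_finiteDimensional (fun y => (f.flip y).continuous_of_finiteDimensional)
    (fun x => (f x).continuous_of_finiteDimensional) (t := -(ε / 2 + 2 * η)) fun ρ hρ => by
      obtain ⟨Θ, hΘ⟩ := h ρ hρ.1 hρ.2 η hη
      refine ⟨_, ⟨Θ, rfl⟩, ?_⟩
      rw [hfW, LinearMap.flip_apply, hfW]
      linarith
  have h1 := diamondNorm_sub_le hΦ₂ (Θ.isChannel_apply hΦ₁) (t := ε / 2 + 2 * η) (by linarith)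
    fun ρ hρ hρ' => by
      have := hΘ ρ ⟨hρ, hρ'⟩
      rw [hfW, LinearMap.flip_apply, hfW] at this
      rw [pairing_sub_right]
      linarith
  rw [diamondNorm_sub_comm] at h1
  have h2 : conversionDist Φ₁ Φ₂ ≤ diamondNorm (Θ.apply Φ₁ - Φ₂) :=
    csInf_le ⟨0, fun _ ⟨_, h⟩ => h ▸ diamondNorm_nonneg _⟩ ⟨Θ, rfl⟩
  linarith

end ConversionDistance

/-! ### Equivalence of the distance bound and the entropy comparison. -/

section Entropy

variable {a₀ a₁ a₀' a₁' b₀ b₁ r₀ r₁ : Type u}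
  [Fintype a₀] [Fintype a₁] [Fintype a₀'] [Fintype a₁'] [Fintype b₀] [Fintype b₁]
  [Fintype r₀] [Fintype r₁] [DecidableEq a₀] [DecidableEq b₀]

theorem pairing_apply_le_condTwoNorm
    {ρ : Matrix ((r₀ × b₀) × (r₁ × b₁)) ((r₀ × b₀) × (r₁ × b₁)) ℂ} (hρ : ρ.PosSemidef)
    {Φ : LMap (a₀ × b₀) (a₁ × b₁)} (hΦ : IsCP Φ) (Θ : Superchannel a₀ a₁ r₀ r₁) :
    pairing ρ (Θ.apply Φ) ≤ condTwoNorm (linkChoi ρ Φ) := by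
  rw [pairing_eq_re, ← cpairing_linkChoi, ← pairing_eq_re]
  obtain ⟨C, hC⟩ := exists_pairing_bound (linkChoi ρ Φ)
  refine pairing_le_dualNorm (linkChoi_posSemidef hρ hΦ) (C := C) ?_ ?_ ⟨Θ, rfl⟩
  · rintro _ ⟨Λ, rfl⟩
    exact Λ.isChannel_toMap.1
  · rintro _ ⟨Λ, rfl⟩
    exact hC _ Λ.isChannel_toMap

theorem condTwoNorm_linkChoi_le [Nonempty a₀] [Nonempty r₁]
    {ρ : Matrix ((r₀ × b₀) × (r₁ × b₁)) ((r₀ × b₀) × (r₁ × b₁)) ℂ} (hρ : ρ.PosSemidef)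
    {Φ : LMap (a₀ × b₀) (a₁ × b₁)} (hΦ : IsCP Φ) {C : ℝ}
    (hC : ∀ Θ : Superchannel a₀ a₁ r₀ r₁, pairing ρ (Θ.apply Φ) ≤ C) :
    condTwoNorm (linkChoi ρ Φ) ≤ C := by
  obtain ⟨Θ⟩ := Superchannel.nonempty (a₀ := a₀) (a₁ := a₁) (a₀' := r₀) (a₁' := r₁)
  refine dualNorm_le (linkChoi_posSemidef hρ hΦ) ?_
    (Set.range_nonempty_iff_nonempty.mpr ⟨Θ⟩) ?_
  · rintro _ ⟨Λ, rfl⟩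
    exact Λ.isChannel_toMap.1
  · rintro _ ⟨Λ, rfl⟩
    rw [pairing_eq_re, cpairing_linkChoi, ← pairing_eq_re]
    exact hC Λ

omit [DecidableEq a₀] [DecidableEq b₀] in
theorem nonempty_of_isState {a : Type*} [Fintype a] {ρ : Matrix a a ℂ} (hρ : IsState ρ) :
    Nonempty a := by
  by_contra h
  rw [not_nonempty_iff] at h
  have := hρ.2
  simp [Matrix.trace] at this

variable [DecidableEq a₁] [DecidableEq a₀'] [DecidableEq a₁'] [DecidableEq b₁]
  [Nonempty a₀] [Nonempty a₁'] [Nonempty b₁]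
  {Φ₁ : LMap (a₀ × b₀) (a₁ × b₁)} {Φ₂ : LMap (a₀' × b₀) (a₁' × b₁)} {ε : ℝ}

omit [DecidableEq a₁] in
theorem entropyCondition_of_conversionDist_le [Nonempty a₀'] [Nonempty b₀] (hΦ₁ : IsChannel Φ₁) (hΦ₂ : IsChannel Φ₂)
    (h : conversionDist Φ₁ Φ₂ ≤ ε) (r₀ r₁ : Type u) [Fintype r₀] [Fintype r₁] :
    EntropyCondition Φ₁ Φ₂ ε r₀ r₁ := by
  intro ρ hρ
  -- A state exists only for nonempty labels; a nonempty `r₁` ensures that the supremum over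
  -- superchannels is not taken over the empty set.
  obtain ⟨x⟩ := nonempty_of_isState hρ
  have : Nonempty r₁ := ⟨x.2.1⟩
  refine condTwoNorm_linkChoi_le hρ.1 hΦ₂.1 fun Λ =>
    le_of_forall_pos_le_add_mul (c := condNorm ρ / 2) fun η hη => ?_
  let F : LMap (a₀' × b₀) (a₁' × b₁) →ₗ[ℂ] ℂ :=
    { toFun := fun φ => cpairing ρ (Λ.apply φ)
      map_add' := fun φ ψ => by rw [Λ.apply_add, ← cpairingₗ_apply, map_add]; rfl
      map_smul' := fun c φ => by rw [Λ.apply_smul, ← cpairingₗ_apply, map_smul]; rfl }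
  obtain ⟨Θ, hΘ⟩ := exists_functional_le_of_conversionDist_le hΦ₁ hΦ₂ h (F := F)
    (fun φ hφ => cpairing_nonneg hρ.1 (Λ.isCP_apply hφ))
    (fun α hα => pairing_le_condNorm hρ.1 (Λ.isChannel_apply hα)) hη
  have h1 : pairing ρ (Λ.apply (Θ.apply Φ₁)) ≤ condTwoNorm (linkChoi ρ Φ₁) := by
    rw [← Superchannel.apply_comp]
    exact pairing_apply_le_condTwoNorm hρ.1 hΦ₁.1 _
  have h2 : pairing ρ (Λ.apply Φ₂) ≤ pairing ρ (Λ.apply (Θ.apply Φ₁)) +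
    condNorm ρ / 2 * (ε + η) := hΘ
  linarith

omit [DecidableEq a₀] [DecidableEq a₁] in
-- By homogeneity: the minimax tests operators normalised by their values on channels, and dividing
-- by t = Tr ρ gives a state of conditional norm at most 1/t. Only ρ = 0 has to be treated apart.
theorem conversionDist_le_of_forall_state (hΦ₁ : IsChannel Φ₁) (hΦ₂ : IsChannel Φ₂) (hε : 0 ≤ ε)
    (h : ∀ ρ : Matrix ((a₀' × b₀) × (a₁' × b₁)) ((a₀' × b₀) × (a₁' × b₁)) ℂ, IsState ρ →
      ∀ η : ℝ, 0 < η → ∃ Θ : Superchannel a₀ a₁ a₀' a₁',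
        pairing ρ Φ₂ ≤ pairing ρ (Θ.apply Φ₁) + ε / 2 * condNorm ρ + η) :
    conversionDist Φ₁ Φ₂ ≤ ε := by
  refine conversionDist_le_of_forall_pairing hΦ₁ hΦ₂ hε fun ρ hρ hρ' η hη => ?_
  obtain ⟨h1, h2⟩ := Complex.nonneg_iff.mp hρ.trace_nonneg
  rcases h1.eq_or_lt with h0 | h0
  · obtain ⟨Θ⟩ := Superchannel.nonempty (a₀ := a₀) (a₁ := a₁) (a₀' := a₀') (a₁' := a₁')
    have : ρ = 0 := hρ.trace_eq_zero_iff.mp (Complex.ext h0.symm h2.symm)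
    refine ⟨Θ, ?_⟩
    have hz : ∀ φ : LMap (a₀' × b₀) (a₁' × b₁), pairing ρ φ = 0 := fun φ => by
      rw [this, pairing_eq_re, ← cpairingₗ_apply, map_zero, LinearMap.zero_apply, Complex.zero_re]
    rw [hz, hz]
    linarith
  · set t := ρ.trace.re with ht
    have hstate : IsState (((t⁻¹ : ℝ) : ℂ) • ρ) := by
      refine ⟨hρ.smul (by exact_mod_cast (inv_pos.mpr h0).le), ?_⟩
      rw [Matrix.trace_smul, show ρ.trace = (t : ℂ) from Complex.ext rfl (by simpa using h2.symm),
        smul_eq_mul, ← Complex.ofReal_mul, inv_mul_cancel₀ h0.ne', Complex.ofReal_one]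
    obtain ⟨Θ, hΘ⟩ := h _ hstate (t⁻¹ * η) (by positivity)
    refine ⟨Θ, ?_⟩
    have h3 : condNorm (((t⁻¹ : ℝ) : ℂ) • ρ) ≤ t⁻¹ * 1 := condNorm_le hstate.1 fun α hα => by
      rw [pairing_smul_left]
      exact mul_le_mul_of_nonneg_left (hρ' α hα) (inv_pos.mpr h0).le
    have h4 := mul_le_mul_of_nonneg_left h3 (by linarith : 0 ≤ ε / 2)
    rw [pairing_smul_left, pairing_smul_left] at hΘ
    have h5 : t⁻¹ * pairing ρ Φ₂ ≤ t⁻¹ * (pairing ρ (Θ.apply Φ₁) + ε / 2 + η) := by linarith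
    exact le_of_mul_le_mul_left h5 (inv_pos.mpr h0)

omit [DecidableEq a₁] in
theorem conversionDist_le_of_entropyCondition (hΦ₁ : IsChannel Φ₁) (hΦ₂ : IsChannel Φ₂)
    (hε : 0 ≤ ε) (h : EntropyCondition Φ₁ Φ₂ ε a₀' a₁') : conversionDist Φ₁ Φ₂ ≤ ε := by
  refine conversionDist_le_of_forall_state hΦ₁ hΦ₂ hε fun ρ hρ η hη => ?_
  -- If every Θ failed, the norm on the Φ₁ side would be too small for the lower bound that the
  -- identity superchannel gives on the Φ₂ side.
  by_contra! hcon
  have h1 := condTwoNorm_linkChoi_le (r₀ := a₀') (r₁ := a₁') hρ.1 hΦ₁.1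
    (C := pairing ρ Φ₂ - ε / 2 * condNorm ρ - η) fun Θ => by linarith [hcon Θ]
  have h2 := pairing_apply_le_condTwoNorm hρ.1 hΦ₂.1 (Superchannel.refl a₀' a₁')
  rw [Superchannel.refl_apply] at h2
  have h3 := h ρ hρ
  linarith

end Entropy

/-! ### Measurements in the Heisenberg picture. -/

section Measurements

theorem IsMeasurement.kronecker {ι κ a b : Type*} [Fintype ι] [Fintype κ] [Finite a] [Finite b]
    [DecidableEq a] [DecidableEq b] {N : ι → Matrix a a ℂ} {M : κ → Matrix b b ℂ}
    (hN : IsMeasurement N) (hM : IsMeasurement M) :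
    IsMeasurement fun x : ι × κ => N x.1 ⊗ₖ M x.2 := by
  refine ⟨fun x => (hN.1 x.1).kronecker (hM.1 x.2), ?_⟩
  rw [← Matrix.one_kronecker_one, ← hN.2, ← hM.2, Fintype.sum_prod_type]
  ext p q
  simp only [Matrix.sum_apply, Matrix.kroneckerMap_apply, Finset.sum_mul, Finset.mul_sum]
  exact Finset.sum_comm

variable {a b : Type*} [Fintype a] [Fintype b] [DecidableEq a]

/-- The adjoint of a map with respect to the trace pairing. -/
def adjointMap (P : LMap a b) (N : Matrix b b ℂ) : Matrix a a ℂ :=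
  Matrix.of fun q p => (P (Matrix.single p q 1) * N).trace

theorem trace_mul_adjointMap (P : LMap a b) (N : Matrix b b ℂ) (X : Matrix a a ℂ) :
    (X * adjointMap P N).trace = (P X * N).trace := by
  have h : (X * adjointMap P N).trace = ∑ p, ∑ q, X p q * (P (Matrix.single p q 1) * N).trace :=
    rfl
  conv_rhs => rw [Matrix.matrix_eq_sum_single X]
  simp only [h, map_sum, Finset.sum_mul, Matrix.trace_sum]
  refine Finset.sum_congr rfl fun p _ => Finset.sum_congr rfl fun q _ => ?_
  rw [← smul_eq_mul, ← Matrix.trace_smul, ← Matrix.smul_mul, ← map_smul, Matrix.smul_single,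
    smul_eq_mul, mul_one]

theorem adjointMap_posSemidef {P : LMap a b} (hP : IsCP P) {N : Matrix b b ℂ}
    (hN : N.PosSemidef) : (adjointMap P N).PosSemidef := by
  refine posSemidef_of_forall_dotProduct fun v => ?_
  have h : star v ⬝ᵥ (adjointMap P N).mulVec v =
      (Matrix.vecMulVec v (star v) * adjointMap P N).trace := by
    rw [Matrix.vecMulVec_mul, Matrix.trace_vecMulVec, Matrix.dotProduct_mulVec, dotProduct_comm]
  rw [h, trace_mul_adjointMap]
  exact trace_mul_nonneg (hP.posSemidef (Matrix.posSemidef_vecMulVec_self_star v)) hN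

theorem IsMeasurement.adjointMap {ι : Type*} [Fintype ι] [DecidableEq b] {P : LMap a b}
    (hP : IsChannel P) {N : ι → Matrix b b ℂ} (hN : IsMeasurement N) :
    IsMeasurement fun i => adjointMap P (N i) := by
  refine ⟨fun i => adjointMap_posSemidef hP.1 (hN.1 i), ?_⟩
  ext q p
  simp only [Matrix.sum_apply, QChan.adjointMap, Matrix.of_apply]
  rw [← Matrix.trace_sum, ← Finset.mul_sum, hN.2, Matrix.mul_one, hP.2]
  by_cases h : p = q
  · subst h; simp
  · simp [h, Ne.symm h]

omit [Fintype b] [DecidableEq a] in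
theorem trace_mul_kronecker {s : Type*} [Fintype s] (X : Matrix (a × s) (a × s) ℂ)
    (N : Matrix a a ℂ) (M : Matrix s s ℂ) : (X * (N ⊗ₖ M)).trace =
      ∑ k, ∑ l, M l k * ((Matrix.of fun i j => X (i, k) (j, l)) * N).trace := by
  simp only [Matrix.trace, Matrix.diag_apply, Matrix.mul_apply, Matrix.kroneckerMap_apply,
    Matrix.of_apply, Finset.mul_sum, Fintype.sum_prod_type_right]
  refine Finset.sum_congr rfl fun k _ => ?_
  rw [Finset.sum_comm]
  exact Finset.sum_congr rfl fun l _ => Finset.sum_congr rfl fun i _ =>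
    Finset.sum_congr rfl fun j _ => by ring

theorem trace_tensorId_mul_kronecker {s : Type*} [Fintype s] (P : LMap a b)
    (X : Matrix (a × s) (a × s) ℂ) (N : Matrix b b ℂ) (M : Matrix s s ℂ) :
    (tensorId P s X * (N ⊗ₖ M)).trace = (X * (adjointMap P N ⊗ₖ M)).trace := by
  simp only [trace_mul_kronecker, trace_mul_adjointMap]
  rfl

theorem sum_prob_mul_trace_mem_Icc {ι : Type*} [Fintype ι] (E : Ensemble ι a)
    {M : ι → Matrix a a ℂ} (hM : IsMeasurement M) :
    0 ≤ ∑ i, E.prob i * ((E.state i * M i).trace).re ∧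
      ∑ i, E.prob i * ((E.state i * M i).trace).re ≤ 1 := by
  refine ⟨Finset.sum_nonneg fun i _ => mul_nonneg (E.prob_nonneg i)
    (Complex.nonneg_iff.mp (trace_mul_nonneg (E.isState i).1 (hM.1 i))).1, ?_⟩
  rw [← E.sum_prob]
  refine Finset.sum_le_sum fun i _ => mul_le_of_le_one_right (E.prob_nonneg i) ?_
  have h : (1 - M i).PosSemidef := by
    classical
    rw [← hM.2, ← Finset.sum_erase_eq_sub (Finset.mem_univ i)]
    exact Matrix.posSemidef_sum _ fun j _ => hM.1 j
  rw [Matrix.trace_mul_comm]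
  refine (trace_mul_le_of_le_one h (E.isState i).1).trans ?_
  rw [(E.isState i).2, Complex.one_re]

theorem le_succProb {ι : Type*} [Fintype ι] (E : Ensemble ι a)
    {M : ι → Matrix a a ℂ} (hM : IsMeasurement M) :
    ∑ i, E.prob i * ((E.state i * M i).trace).re ≤ succProb E :=
  le_csSup ⟨1, fun _ ⟨_, hM, h⟩ => h ▸ (sum_prob_mul_trace_mem_Icc E hM).2⟩ ⟨M, hM, rfl⟩

theorem succProb_nonneg {ι : Type*} [Fintype ι] (E : Ensemble ι a) : 0 ≤ succProb E :=
  Real.sSup_nonneg fun _ ⟨_, hM, h⟩ => h ▸ (sum_prob_mul_trace_mem_Icc E hM).1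

end Measurements

/-! ### Guessing games: from the distance bound to success probabilities. -/

section Games

set_option linter.unusedSectionVars false

variable {a₀ a₁ b₀ b₁ r₀ r₁ U : Type u}
  [Fintype a₀] [Fintype a₁] [Fintype b₀] [Fintype b₁] [Fintype r₀] [Fintype r₁] [Fintype U]

theorem isCP_gameMap {α : LMap r₀ (U × a₀)}
    (hα : IsCP α) {Φ : LMap (a₀ × b₀) (a₁ × b₁)} (hΦ : IsCP Φ) : IsCP (gameMap r₁ α Φ) :=
  (isCP_relabel _).comp (((hΦ.idTensor _).comp ((isCP_relabel _).comp (hα.tensorId _))).tensorId _)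

theorem isChannel_gameMap {α : LMap r₀ (U × a₀)} (hα : IsChannel α)
    {Φ : LMap (a₀ × b₀) (a₁ × b₁)} (hΦ : IsChannel Φ) : IsChannel (gameMap r₁ α Φ) :=
  (isChannel_relabel _).comp
    (((hΦ.idTensor _).comp ((isChannel_relabel _).comp (hα.tensorId _))).tensorId _)

variable [DecidableEq a₁] [DecidableEq b₀] [DecidableEq b₁] [DecidableEq r₀] [DecidableEq r₁]
  [DecidableEq U] {k l : ℕ} {M : Fin l → Matrix (b₁ × b₁) (b₁ × b₁) ℂ}
  {N : Fin k → Matrix ((U × a₁) × r₁) ((U × a₁) × r₁) ℂ}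
  (E : Ensemble (Fin k × Fin l) ((r₀ × b₀) × (r₁ × b₁)))

theorem game_value_eq (α : LMap r₀ (U × a₀)) (Φ : LMap (a₀ × b₀) (a₁ × b₁)) :
    ∑ x : Fin k × Fin l,
      E.prob x * ((gameMap r₁ α Φ (E.state x) * (N x.1 ⊗ₖ M x.2)).trace).re =
    ∑ x : Fin k × Fin l,
      E.prob x * ((E.state x * adjointMap (gameMap r₁ α Φ) (N x.1 ⊗ₖ M x.2)).trace).re := by
  simp only [trace_mul_adjointMap]

theorem game_value_le_succProb {α : LMap r₀ (U × a₀)} (hα : IsChannel α)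
    {Φ : LMap (a₀ × b₀) (a₁ × b₁)} (hΦ : IsChannel Φ) (hM : IsMeasurement M)
    (hN : IsMeasurement N) :
    ∑ x : Fin k × Fin l,
      E.prob x * ((gameMap r₁ α Φ (E.state x) * (N x.1 ⊗ₖ M x.2)).trace).re ≤ succProb E := by
  rw [game_value_eq]
  exact le_succProb E ((hN.kronecker hM).adjointMap (isChannel_gameMap hα hΦ))

theorem game_value_nonneg {α : LMap r₀ (U × a₀)} (hα : IsChannel α)
    {Φ : LMap (a₀ × b₀) (a₁ × b₁)} (hΦ : IsChannel Φ) (hM : IsMeasurement M)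
    (hN : IsMeasurement N) : 0 ≤ ∑ x : Fin k × Fin l,
      E.prob x * ((gameMap r₁ α Φ (E.state x) * (N x.1 ⊗ₖ M x.2)).trace).re := by
  rw [game_value_eq]
  exact (sum_prob_mul_trace_mem_Icc E
    ((hN.kronecker hM).adjointMap (isChannel_gameMap hα hΦ))).1

theorem game_value_le_gameSuccProb {α : LMap r₀ (U × a₀)} (hα : IsChannel α)
    {Φ : LMap (a₀ × b₀) (a₁ × b₁)} (hΦ : IsChannel Φ) (hM : IsMeasurement M)
    (hN : IsMeasurement N) : ∑ x : Fin k × Fin l,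
      E.prob x * ((gameMap r₁ α Φ (E.state x) * (N x.1 ⊗ₖ M x.2)).trace).re ≤
        gameSuccProb Φ M E := by
  refine le_csSup ⟨succProb E, ?_⟩ ⟨U, _, _, α, N, hα, hN, rfl⟩
  rintro _ ⟨V, _, _, β, L, hβ, hL, rfl⟩
  exact game_value_le_succProb E hβ hΦ hM hL

theorem gameSuccProb_nonneg {Φ : LMap (a₀ × b₀) (a₁ × b₁)} (hΦ : IsChannel Φ)
    (hM : IsMeasurement M) : 0 ≤ gameSuccProb Φ M E := by
  refine Real.sSup_nonneg ?_
  rintro _ ⟨V, _, _, β, L, hβ, hL, rfl⟩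
  exact game_value_nonneg E hβ hΦ hM hL

/-- The value of a strategy in the guessing game, as a functional of the available map. -/
def gameFunctional (α : LMap r₀ (U × a₀)) (N : Fin k → Matrix ((U × a₁) × r₁) ((U × a₁) × r₁) ℂ)
    (M : Fin l → Matrix (b₁ × b₁) (b₁ × b₁) ℂ) : LMap (a₀ × b₀) (a₁ × b₁) →ₗ[ℂ] ℂ where
  toFun Φ := ∑ x : Fin k × Fin l,
    (E.prob x : ℂ) * (gameMap r₁ α Φ (E.state x) * (N x.1 ⊗ₖ M x.2)).trace
  map_add' Φ Ψ := by
    have h : ∀ X, gameMap r₁ α (Φ + Ψ) X = gameMap r₁ α Φ X + gameMap r₁ α Ψ X := fun _ => rfl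
    simp only [h, Matrix.add_mul, Matrix.trace_add, mul_add, Finset.sum_add_distrib]
  map_smul' c Φ := by
    have h : ∀ X, gameMap r₁ α (c • Φ) X = c • gameMap r₁ α Φ X := fun _ => rfl
    simp only [h, Matrix.smul_mul, Matrix.trace_smul, Finset.mul_sum, RingHom.id_apply, smul_eq_mul]
    exact Finset.sum_congr rfl fun x _ => by ring

theorem re_gameFunctional (α : LMap r₀ (U × a₀)) (Φ : LMap (a₀ × b₀) (a₁ × b₁)) :
    (gameFunctional E α N M Φ).re = ∑ x : Fin k × Fin l,
      E.prob x * ((gameMap r₁ α Φ (E.state x) * (N x.1 ⊗ₖ M x.2)).trace).re := by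
  simp only [gameFunctional, LinearMap.coe_mk, AddHom.coe_mk, Complex.re_sum,
    Complex.re_ofReal_mul]

theorem gameFunctional_nonneg {α : LMap r₀ (U × a₀)} (hα : IsChannel α) (hM : IsMeasurement M)
    (hN : IsMeasurement N) {Φ : LMap (a₀ × b₀) (a₁ × b₁)} (hΦ : IsCP Φ) :
    0 ≤ gameFunctional E α N M Φ :=
  Finset.sum_nonneg fun x _ => mul_nonneg (by exact_mod_cast E.prob_nonneg x)
    (trace_mul_nonneg ((isCP_gameMap hα.1 hΦ).posSemidef (E.isState x).1)
      ((hN.1 x.1).kronecker (hM.1 x.2)))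

variable {a₀' a₁' : Type u} [Fintype a₀'] [Fintype a₁'] [DecidableEq a₀'] [DecidableEq a₁']

/-- The preprocessing of Θ is absorbed into α, enlarging the ancilla to U ⊗ Θ.U, and the adjoint of
its postprocessing into N. M is unaffected, since it acts on B₁B₁ only. -/
theorem gameFunctional_apply_le {α : LMap r₀ (U × a₀')} (hα : IsChannel α)
    (hM : IsMeasurement M) {N : Fin k → Matrix ((U × a₁') × r₁) ((U × a₁') × r₁) ℂ}
    (hN : IsMeasurement N) (Θ : Superchannel a₀ a₁ a₀' a₁')
    {Φ : LMap (a₀ × b₀) (a₁ × b₁)} (hΦ : IsChannel Φ) :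
    (gameFunctional E α N M (Θ.apply Φ)).re ≤ gameSuccProb Φ M E := by
  classical
  let β : LMap r₀ ((U × Θ.U) × a₀) :=
    relabel (Equiv.prodAssoc U Θ.U a₀).symm ∘ₗ idTensor U Θ.pre ∘ₗ α
  let P : LMap (((U × Θ.U) × a₁) × r₁) ((U × a₁') × r₁) :=
    tensorId (idTensor U Θ.post ∘ₗ relabel (Equiv.prodAssoc U Θ.U a₁)) r₁
  have hβ : IsChannel β := (isChannel_relabel _).comp ((Θ.isChannel_pre.idTensor _).comp hα)
  have hP : IsChannel P := ((Θ.isChannel_post.idTensor _).comp (isChannel_relabel _)).tensorId _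
  have h : ∀ X, gameMap r₁ α (Θ.apply Φ) X = tensorId P (b₁ × b₁) (gameMap r₁ β Φ X) :=
    fun _ => rfl
  rw [re_gameFunctional]
  simp only [h, trace_tensorId_mul_kronecker]
  exact game_value_le_gameSuccProb (N := fun i => adjointMap P (N i)) E hβ hΦ hM (hN.adjointMap hP)

variable [DecidableEq a₀] [Nonempty a₀] [Nonempty a₁'] [Nonempty b₁]
  {Φ₁ : LMap (a₀ × b₀) (a₁ × b₁)} {Φ₂ : LMap (a₀' × b₀) (a₁' × b₁)} {ε : ℝ}

theorem guessingCondition_of_conversionDist_le (hΦ₁ : IsChannel Φ₁) (hΦ₂ : IsChannel Φ₂)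
    (hε : 0 ≤ ε) (h : conversionDist Φ₁ Φ₂ ≤ ε) (r₀ r₁ : Type u) [Fintype r₀] [Fintype r₁]
    [DecidableEq r₀] [DecidableEq r₁] [Nonempty a₀'] [Nonempty b₀] :
    GuessingCondition Φ₁ Φ₂ ε r₀ r₁ := by
  intro k l E M hM
  have hS := succProb_nonneg E
  have hG := gameSuccProb_nonneg E hΦ₁ hM
  -- A nonnegative bound also covers the default value 0 of `sSup`, so no strategy has to be
  -- exhibited.
  refine Real.sSup_le ?_ (by positivity)
  rintro _ ⟨U, _, _, α, N, hα, hN, rfl⟩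
  rw [← re_gameFunctional]
  refine le_of_forall_pos_le_add_mul (c := succProb E / 2) fun η hη => ?_
  obtain ⟨Θ, hΘ⟩ := exists_functional_le_of_conversionDist_le hΦ₁ hΦ₂ h
    (fun φ hφ => gameFunctional_nonneg E hα hM hN hφ) (fun β hβ => by
      rw [re_gameFunctional]
      exact game_value_le_succProb E hα hβ hM hN) hη
  have h1 := gameFunctional_apply_le E hα hM hN Θ hΦ₁
  linarith

end Games

/-! ### Heisenberg-Weyl operators, Bell measurements and twirling. -/

section Weyl

/-- An orthogonal unitary basis of a full matrix algebra, the Heisenberg-Weyl operators. -/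
theorem exists_unitary_basis (r : Type*) [Fintype r] [DecidableEq r] [Nonempty r] :
    ∃ V : Fin (Fintype.card r * Fintype.card r) → Matrix r r ℂ,
      (∀ j, (V j).conjTranspose * V j = 1) ∧
      ∀ p m q n, ∑ j, V j p m * star (V j q n) =
        if p = q then if m = n then (Fintype.card r : ℂ) else 0 else 0 := by
  set d := Fintype.card r with hd
  have : NeZero d := ⟨Fintype.card_ne_zero⟩
  let e : r ≃ ZMod d := Fintype.equivOfCardEq (by rw [ZMod.card])
  -- In coordinates ℤ/d this is the operator |m⟩ ↦ ψ(m)|m + x⟩.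
  let V : ZMod d × AddChar (ZMod d) ℂ → Matrix r r ℂ := fun x =>
    Matrix.of fun p m => if e p = e m + x.1 then x.2 (e m) else 0
  have hcard : Fintype.card (ZMod d × AddChar (ZMod d) ℂ) = d * d := by
    rw [Fintype.card_prod, AddChar.card_eq, ZMod.card]
  let f : ZMod d × AddChar (ZMod d) ℂ ≃ Fin (d * d) := Fintype.equivFinOfCardEq hcard
  refine ⟨fun j => V (f.symm j), fun j => ?_, fun p m q n => ?_⟩
  · change (V (f.symm j)).conjTranspose * V (f.symm j) = 1
    generalize f.symm j = w
    obtain ⟨x, ψ⟩ := w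
    have hψ : ∀ a, star (ψ a) * ψ a = 1 := fun a => by
      have := Complex.conj_mul' (ψ a)
      rw [AddChar.norm_apply] at this
      simpa using this
    ext m n
    have h : ∀ p, star (V (x, ψ) p m) * V (x, ψ) p n =
        if p = e.symm (e m + x) then if m = n then 1 else 0 else 0 := by
      intro p
      by_cases hp : p = e.symm (e m + x)
      · subst hp
        by_cases hmn : m = n
        · subst hmn
          simp only [V, Matrix.of_apply, Equiv.apply_symm_apply, if_true, hψ]
        · simp [V, hmn]
      · have : e p ≠ e m + x := fun h => hp (by rw [← h, Equiv.symm_apply_apply])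
        simp [V, this, hp]
    simp only [Matrix.mul_apply, Matrix.conjTranspose_apply, h, Finset.sum_ite_eq',
      Finset.mem_univ, if_true, Matrix.one_apply]
  · rw [Equiv.sum_comp f.symm fun x => V x p m * star (V x q n), Fintype.sum_prod_type]
    -- Only the shift p - m contributes, and there orthogonality of characters forces m = n.
    have h : ∀ x : ZMod d, ∑ ψ : AddChar (ZMod d) ℂ, V (x, ψ) p m * star (V (x, ψ) q n) =
        if x = e p - e m then if p = q then if m = n then (d : ℂ) else 0 else 0 else 0 := by
      intro x
      by_cases hx : x = e p - e m
      · by_cases hq : e q = e n + x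
        · have h1 : ∀ ψ : AddChar (ZMod d) ℂ, V (x, ψ) p m * star (V (x, ψ) q n) =
              ψ (e m - e n) := fun ψ => by
            have hp : e p = e m + x := by rw [hx]; ring
            simp only [V, Matrix.of_apply, if_pos hp, if_pos hq]
            rw [sub_eq_add_neg, AddChar.map_add_eq_mul, AddChar.map_neg_eq_conj]
            rfl
          simp only [h1, AddChar.sum_apply_eq_ite, sub_eq_zero, e.injective.eq_iff, ZMod.card,
            if_pos hx]
          by_cases hmn : m = n
          · have hpq : p = q := e.injective (by rw [hq, hx, hmn]; ring)
            simp [hmn, hpq]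
          · simp [hmn]
        · have : ¬ (p = q ∧ m = n) := by
            rintro ⟨rfl, rfl⟩
            exact hq (by rw [hx]; ring)
          have h2 : (if p = q then if m = n then (d : ℂ) else 0 else 0) = 0 := by
            rw [← ite_and, if_neg this]
          simp [V, hq, h2]
      · have hp : e p ≠ e m + x := fun h => hx (by rw [h]; ring)
        simp [V, hp, hx]
    simp only [h, Finset.sum_ite_eq', Finset.mem_univ, if_true]

variable {x y z s : Type*} [Fintype x] [Fintype y] [Fintype z] [Fintype s]

/-- The unnormalized maximally entangled vector. -/
def maxVec [DecidableEq z] (f : x → z) : x × z → ℂ := fun p => if f p.1 = p.2 then 1 else 0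

/-- The maximally entangled vector rotated by a unitary on the second factor. -/
def bellVec (f : x → z) (V : Matrix z z ℂ) : x × z → ℂ := fun p => V p.2 (f p.1)

/-- Unitarity of V undoes the rotation, so the Bell effect with label V becomes the same fixed
operator for every V. -/
theorem conj_bellVec [DecidableEq x] [DecidableEq z] (f : x → z) {V : Matrix z z ℂ}
    (hV : V.conjTranspose * V = 1) :
    ((1 : Matrix x x ℂ) ⊗ₖ V).conjTranspose *
        Matrix.vecMulVec (bellVec f V) (star (bellVec f V)) * ((1 : Matrix x x ℂ) ⊗ₖ V) =
      Matrix.vecMulVec (maxVec f) (star (maxVec f)) := by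
  have h : ((1 : Matrix x x ℂ) ⊗ₖ V).conjTranspose.mulVec (bellVec f V) = maxVec f := by
    ext ⟨m, p⟩
    have h1 := congrFun (congrFun hV p) (f m)
    simp only [Matrix.mul_apply, Matrix.conjTranspose_apply, Matrix.one_apply] at h1
    simp only [Matrix.mulVec, dotProduct, Fintype.sum_prod_type, Matrix.conjTranspose_apply,
      Matrix.kroneckerMap_apply, Matrix.one_apply, bellVec, maxVec, ite_mul, one_mul, zero_mul,
      apply_ite star, star_zero, Finset.sum_ite_irrel, Finset.sum_const_zero, Finset.sum_ite_eq',
      Finset.mem_univ, if_true, h1]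
    simp only [eq_comm]
  rw [Matrix.mul_vecMulVec, Matrix.vecMulVec_mul, h]
  congr 1
  rw [← h, Matrix.star_mulVec, Matrix.conjTranspose_conjTranspose]

/-- The relation `hV` is the resolution of the identity. A general injection `f` is allowed so that
labels carrying a trivial ancilla are covered. -/
theorem isMeasurement_bellVec [DecidableEq x] [DecidableEq z] {ι : Type*} [Fintype ι]
    {f : x → z} (hf : Function.Injective f) {V : ι → Matrix z z ℂ} {c : ℝ} (hc : 0 < c)
    (hV : ∀ p m q n, ∑ j, V j p m * star (V j q n) =
      if p = q then if m = n then (c : ℂ) else 0 else 0) :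
    IsMeasurement fun j => ((c⁻¹ : ℝ) : ℂ) •
      Matrix.vecMulVec (bellVec f (V j)) (star (bellVec f (V j))) := by
  refine ⟨fun j => (Matrix.posSemidef_vecMulVec_self_star _).smul
    (by exact_mod_cast (inv_pos.mpr hc).le), ?_⟩
  ext ⟨m, p⟩ ⟨n, q⟩
  have hc' : (c : ℂ) ≠ 0 := by exact_mod_cast hc.ne'
  simp only [Matrix.sum_apply, Matrix.smul_apply, Matrix.vecMulVec_apply, bellVec, Pi.star_apply,
    smul_eq_mul, ← Finset.mul_sum, hV, hf.eq_iff, Matrix.one_apply, Prod.mk.injEq]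
  by_cases h1 : p = q <;> by_cases h2 : m = n <;> simp [h1, h2, hc']

omit [Fintype x] in
theorem trace_conj_mul [Fintype x] (A Z N : Matrix x x ℂ) :
    (A * Z * A.conjTranspose * N).trace = (Z * (A.conjTranspose * N * A)).trace := by
  rw [Matrix.mul_assoc, Matrix.mul_assoc, Matrix.trace_mul_comm]
  simp only [Matrix.mul_assoc]

/-- A twirled measurement on `Y ⊗ Z` acts on operators as the pairing with a channel `Y → Z`. -/
theorem exists_isChannel_of_twirl [DecidableEq y] [DecidableEq z] [Nonempty z] {ι : Type*}
    [Fintype ι] {X : ι → Matrix z z ℂ} (hX : ∀ i, (X i).conjTranspose * X i = 1)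
    {N : ι → Matrix (y × z) (y × z) ℂ} (hN : IsMeasurement N) :
    ∃ β : LMap y z, IsChannel β ∧ ∀ Y : Matrix (y × z) (y × z) ℂ,
      ∑ i, (Y * (((1 : Matrix y y ℂ) ⊗ₖ X i).conjTranspose * N i *
        ((1 : Matrix y y ℂ) ⊗ₖ X i))).trace = (Fintype.card z : ℂ) * cpairing Y β := by
  have hX' : ∀ i, X i * (X i).conjTranspose = 1 := fun i => mul_eq_one_comm.mp (hX i)
  set L : ι → Matrix (y × z) (y × z) ℂ := fun i =>
    ((1 : Matrix y y ℂ) ⊗ₖ X i).conjTranspose * N i * ((1 : Matrix y y ℂ) ⊗ₖ X i) with hL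
  set d : ℝ := (Fintype.card z : ℝ) with hd
  have hdpos : 0 < d := by rw [hd]; exact_mod_cast Fintype.card_pos
  have hd' : (Fintype.card z : ℂ) ≠ 0 := by exact_mod_cast Fintype.card_ne_zero
  have hdc : ((d⁻¹ : ℝ) : ℂ) = (Fintype.card z : ℂ)⁻¹ := by simp [hd]
  -- The summed twirled measurement, swapped and transposed to match the pairing; dividing by dim Z
  -- makes it a Choi matrix of a channel.
  let W : Matrix (z × y) (z × y) ℂ := ((d⁻¹ : ℝ) : ℂ) •
    ((∑ i, L i).submatrix (Prod.swap : z × y → y × z) Prod.swap).transpose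
  have hLp : (∑ i, L i).PosSemidef :=
    Matrix.posSemidef_sum _ fun i _ => (hN.1 i).conjTranspose_mul_mul_same _
  have hWp : W.PosSemidef :=
    (hLp.submatrix _).transpose.smul (by exact_mod_cast (inv_pos.mpr hdpos).le)
  -- Unitary conjugation on Z leaves the partial trace over Z unchanged, so ∑ L i has the partial
  -- trace of ∑ N i = 1, namely dim Z times the identity.
  have hLt : ∀ i p q, ∑ a, L i (q, a) (p, a) = ∑ a, N i (q, a) (p, a) := by
    intro i p q
    have h1 : ∀ a, L i (q, a) (p, a) = ∑ b, ∑ c, N i (q, c) (p, b) * (X i b a * star (X i c a)) := by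
      intro a
      simp only [hL, Matrix.mul_apply, Fintype.sum_prod_type, Matrix.conjTranspose_apply,
        Matrix.kroneckerMap_apply, Matrix.one_apply, ite_mul, one_mul, zero_mul, mul_ite, mul_zero,
        apply_ite star, star_zero, Finset.sum_ite_irrel, Finset.sum_const_zero,
        Finset.sum_ite_eq', Finset.mem_univ, if_true, Finset.sum_mul]
      exact Finset.sum_congr rfl fun b _ => Finset.sum_congr rfl fun c _ => by ring
    have h2 : ∀ b c, ∑ a, X i b a * star (X i c a) = if b = c then 1 else 0 := by
      intro b c
      have := congrFun (congrFun (hX' i) b) c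
      simpa only [Matrix.mul_apply, Matrix.conjTranspose_apply, Matrix.one_apply] using this
    simp only [h1]
    rw [Finset.sum_comm]
    refine Finset.sum_congr rfl fun b _ => ?_
    rw [Finset.sum_comm]
    simp only [← Finset.mul_sum, h2, mul_ite, mul_one, mul_zero, Finset.sum_ite_eq,
      Finset.mem_univ, if_true]
  refine ⟨ofChoi W, isChannel_ofChoi hWp fun p q => ?_, fun Y => ?_⟩
  · have h1 : ∑ a, W (a, p) (a, q) = (Fintype.card z : ℂ)⁻¹ * ∑ i, ∑ a, L i (q, a) (p, a) := by
      simp only [W, hdc, Matrix.smul_apply, Matrix.transpose_apply, Matrix.submatrix_apply,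
        Prod.swap, Matrix.sum_apply, smul_eq_mul, ← Finset.mul_sum]
      rw [Finset.sum_comm]
    have h2 : ∑ i, ∑ a, N i (q, a) (p, a) = ∑ a, (1 : Matrix (y × z) (y × z) ℂ) (q, a) (p, a) := by
      rw [← hN.2, Finset.sum_comm]
      simp only [Matrix.sum_apply]
    simp only [h1, hLt, h2, Matrix.one_apply, Prod.mk.injEq, and_true, Finset.sum_const,
      Finset.card_univ, nsmul_eq_mul, mul_ite, mul_one, mul_zero, inv_mul_cancel₀ hd', eq_comm]
  · have h1 : cpairing Y (ofChoi W) =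
        (Fintype.card z : ℂ)⁻¹ * (Y * ∑ i, L i).trace := by
      rw [cpairing_ofChoi]
      simp only [W, hdc]
      generalize ∑ i, L i = S
      simp only [Matrix.smul_apply, Matrix.transpose_apply, Matrix.submatrix_apply,
        Prod.swap, smul_eq_mul, Matrix.trace, Matrix.diag_apply, Matrix.mul_apply,
        Fintype.sum_prod_type_right, Finset.mul_sum]
      refine Finset.sum_congr rfl fun i _ => ?_
      rw [Finset.sum_comm]
      simp_rw [Finset.sum_comm (γ := z)]
      refine Finset.sum_congr rfl fun p _ => ?_
      exact Finset.sum_congr rfl fun j _ => Finset.sum_congr rfl fun q _ => by ring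
    rw [h1, mul_inv_cancel_left₀ hd', Finset.mul_sum, Matrix.trace_sum]

/-- Contraction of `S ⊗ S` with the maximally entangled vector. -/
def contractPair (Z : Matrix (x × (s × s)) (x × (s × s)) ℂ) : Matrix x x ℂ :=
  Matrix.of fun i j => ∑ b, ∑ c, Z (i, (b, b)) (j, (c, c))

theorem trace_mul_kronecker_maxVec [DecidableEq s] (Z : Matrix (x × (s × s)) (x × (s × s)) ℂ)
    (N : Matrix x x ℂ) :
    (Z * (N ⊗ₖ Matrix.vecMulVec (maxVec (id : s → s)) (star (maxVec (id : s → s))))).trace =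
      (contractPair Z * N).trace := by
  have h : contractPair Z = ∑ b, ∑ c, Matrix.of fun i j => Z (i, (b, b)) (j, (c, c)) := by
    ext i j
    simp [contractPair, Matrix.sum_apply]
  rw [trace_mul_kronecker, h]
  simp [Matrix.vecMulVec_apply, maxVec, Fintype.sum_prod_type, Finset.sum_mul, Matrix.trace_sum,
    apply_ite]

omit [Fintype x] in
theorem conjBy_one_kronecker_block {a : Type*} [Fintype a] [DecidableEq a] (X : Matrix s s ℂ)
    (σ : Matrix (a × s) (a × s) ℂ) (k l : s) :
    (Matrix.of fun i j => conjBy ((1 : Matrix a a ℂ) ⊗ₖ X) σ (i, k) (j, l)) =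
      ∑ n, ∑ m, (X k m * star (X l n)) • Matrix.of fun i j => σ (i, m) (j, n) := by
  ext i j
  simp only [conjBy, LinearMap.coe_mk, AddHom.coe_mk, Matrix.of_apply, Matrix.mul_apply,
    Fintype.sum_prod_type, Matrix.sum_apply, Matrix.smul_apply, Matrix.conjTranspose_apply,
    Matrix.kroneckerMap_apply, Matrix.one_apply, mul_ite, one_mul, mul_zero, ite_mul, zero_mul,
    Finset.sum_ite_irrel, Finset.sum_const_zero, Finset.sum_ite_eq, Finset.mem_univ, if_true,
    apply_ite star, star_zero, Finset.sum_mul, smul_eq_mul]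
  exact Finset.sum_congr rfl fun n _ => Finset.sum_congr rfl fun m _ => by ring

theorem tensorId_conj_one_kronecker {a b : Type*} [Fintype a] [Fintype b] [DecidableEq a]
    [DecidableEq b] (G : LMap a b) (X : Matrix s s ℂ) (ρ : Matrix (a × s) (a × s) ℂ) :
    tensorId G s (conjBy ((1 : Matrix a a ℂ) ⊗ₖ X) ρ) =
      conjBy ((1 : Matrix b b ℂ) ⊗ₖ X) (tensorId G s ρ) := by
  ext ⟨i, k⟩ ⟨j, l⟩
  have h := congrFun (congrFun (conjBy_one_kronecker_block X (tensorId G s ρ) k l) i) j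
  rw [Matrix.of_apply] at h
  rw [h, tensorId_apply, conjBy_one_kronecker_block]
  simp only [map_sum, map_smul, Matrix.sum_apply, Matrix.smul_apply]
  rfl

end Weyl

/-! ### Values of the twirled games. -/

section TwirledGames

set_option linter.unusedSectionVars false

theorem trace_conjBy_mul {a : Type*} [Fintype a] (A Z N : Matrix a a ℂ) :
    (conjBy A Z * N).trace = (Z * (A.conjTranspose * N * A)).trace :=
  trace_conj_mul A Z N

theorem relabel_conjBy {a b : Type*} [Fintype a] [Fintype b] (e : a ≃ b) (A Z : Matrix a a ℂ) :
    relabel e (conjBy A Z) = conjBy (relabel e A) (relabel e Z) := by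
  change (A * Z * A.conjTranspose).submatrix e.symm e.symm = A.submatrix e.symm e.symm *
    Z.submatrix e.symm e.symm * (A.submatrix e.symm e.symm).conjTranspose
  rw [Matrix.conjTranspose_submatrix, Matrix.submatrix_mul_equiv, Matrix.submatrix_mul_equiv]

variable {a₀ a₁ b₀ b₁ r₀ r₁ U : Type u}
  [Fintype a₀] [Fintype a₁] [Fintype b₀] [Fintype b₁] [Fintype r₀] [Fintype r₁] [Fintype U]

/-- Contracting the two copies of B₁ and then pairing over R₁ is pairing over R₁B₁. This is how a
strategy is read as a superchannel. -/
theorem cpairing_contractPair_gameMap (Θ : Superchannel a₀ a₁ r₀ r₁)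
    (Φ : LMap (a₀ × b₀) (a₁ × b₁))
    (ρ : Matrix ((r₀ × b₀) × (r₁ × b₁)) ((r₀ × b₀) × (r₁ × b₁)) ℂ) :
    cpairing (contractPair (gameMap r₁ Θ.pre Φ ρ)) Θ.post = cpairing ρ (Θ.apply Φ) := by
  have h : ∀ i j, (Matrix.of fun x y => contractPair (gameMap r₁ Θ.pre Φ ρ) (x, i) (y, j)) =
      ∑ b, ∑ c, Matrix.of fun x y =>
        gameMap r₁ Θ.pre Φ ρ ((x, i), (b, b)) ((y, j), (c, c)) := by
    intro i j
    ext x y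
    simp [contractPair, Matrix.sum_apply]
  have h1 : cpairing (contractPair (gameMap r₁ Θ.pre Φ ρ)) Θ.post =
      ∑ i, ∑ j, ∑ b, ∑ c, tensorId (Θ.apply Φ) (r₁ × b₁) ρ ((i, b), (i, b)) ((j, c), (j, c)) := by
    refine Finset.sum_congr rfl fun i _ => Finset.sum_congr rfl fun j _ => ?_
    rw [tensorId_apply, h]
    simp only [map_sum, Matrix.sum_apply]
    rfl
  rw [h1, cpairing, Fintype.sum_prod_type]
  refine Finset.sum_congr rfl fun i _ => ?_
  rw [Finset.sum_comm]
  exact Finset.sum_congr rfl fun b _ => (Fintype.sum_prod_type fun w : r₁ × b₁ =>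
    tensorId (Θ.apply Φ) (r₁ × b₁) ρ ((i, b), (i, b)) (w, w)).symm

variable [DecidableEq a₁] [DecidableEq b₁] [DecidableEq r₁] [DecidableEq U]

theorem gameMap_conjBy [DecidableEq r₀] [DecidableEq b₀] (α : LMap r₀ (U × a₀))
    (Φ : LMap (a₀ × b₀) (a₁ × b₁)) (V : Matrix r₁ r₁ ℂ) (W : Matrix b₁ b₁ ℂ)
    (ρ : Matrix ((r₀ × b₀) × (r₁ × b₁)) ((r₀ × b₀) × (r₁ × b₁)) ℂ) :
    gameMap r₁ α Φ (conjBy ((1 : Matrix (r₀ × b₀) (r₀ × b₀) ℂ) ⊗ₖ (V ⊗ₖ W)) ρ) =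
      conjBy (((1 : Matrix (U × a₁) (U × a₁) ℂ) ⊗ₖ V) ⊗ₖ ((1 : Matrix b₁ b₁ ℂ) ⊗ₖ W))
        (gameMap r₁ α Φ ρ) := by
  have h : relabel (gameEquiv U a₁ r₁ b₁ b₁)
      ((1 : Matrix (U × (a₁ × b₁)) (U × (a₁ × b₁)) ℂ) ⊗ₖ (V ⊗ₖ W)) =
      ((1 : Matrix (U × a₁) (U × a₁) ℂ) ⊗ₖ V) ⊗ₖ ((1 : Matrix b₁ b₁ ℂ) ⊗ₖ W) := by
    ext ⟨⟨⟨u, i⟩, p⟩, ⟨b, m⟩⟩ ⟨⟨⟨v, j⟩, q⟩, ⟨c, n⟩⟩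
    change (1 : Matrix (U × (a₁ × b₁)) (U × (a₁ × b₁)) ℂ) (u, (i, b)) (v, (j, c)) *
      (V p q * W m n) = ((1 : Matrix (U × a₁) (U × a₁) ℂ) (u, i) (v, j) * V p q) *
      ((1 : Matrix b₁ b₁ ℂ) b c * W m n)
    simp only [Matrix.one_apply, Prod.mk.injEq]
    by_cases h1 : u = v <;> by_cases h2 : i = j <;> by_cases h3 : b = c <;> simp [h1, h2, h3]
  rw [← h]
  unfold gameMap
  rw [LinearMap.comp_apply, LinearMap.comp_apply, tensorId_conj_one_kronecker, relabel_conjBy]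

/-- The uniform ensemble of the conjugates of a state by local unitaries on the second factor. -/
def twirlEnsemble {a b : Type*} [Fintype a] [Fintype b] [DecidableEq a] [DecidableEq b]
    {ρ : Matrix (a × b) (a × b) ℂ} (hρ : IsState ρ) {ι : Type*} [Fintype ι] [Nonempty ι]
    {X : ι → Matrix b b ℂ} (hX : ∀ i, (X i).conjTranspose * X i = 1) : Ensemble ι (a × b) where
  prob _ := (Fintype.card ι : ℝ)⁻¹
  state i := conjBy ((1 : Matrix a a ℂ) ⊗ₖ X i) ρ
  prob_nonneg _ := by positivity
  sum_prob := by simp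
  isState i := by
    refine ⟨hρ.1.mul_mul_conjTranspose_same _, ?_⟩
    change (((1 : Matrix a a ℂ) ⊗ₖ X i) * ρ * ((1 : Matrix a a ℂ) ⊗ₖ X i).conjTranspose).trace = 1
    rw [Matrix.trace_mul_comm, ← Matrix.mul_assoc, Matrix.conjTranspose_kronecker,
      ← Matrix.mul_kronecker_mul, hX]
    simpa using hρ.2

theorem kronecker_conjTranspose_mul_self {ι κ a b : Type*} [Fintype a] [Fintype b] [DecidableEq a]
    [DecidableEq b] {V : ι → Matrix a a ℂ} {W : κ → Matrix b b ℂ}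
    (hV : ∀ i, (V i).conjTranspose * V i = 1) (hW : ∀ i, (W i).conjTranspose * W i = 1)
    (x : ι × κ) : (V x.1 ⊗ₖ W x.2).conjTranspose * (V x.1 ⊗ₖ W x.2) = 1 := by
  rw [Matrix.conjTranspose_kronecker, ← Matrix.mul_kronecker_mul, hV, hW,
    Matrix.one_kronecker_one]

/-- Moving the rotations onto the measurement makes it dim b times the pairing of ρ with a channel;
the remaining factor is the uniform prior. -/
theorem succProb_twirlEnsemble_le {a b : Type*} [Fintype a] [Fintype b] [DecidableEq a]
    [DecidableEq b] [Nonempty b] {ρ : Matrix (a × b) (a × b) ℂ} (hρ : IsState ρ) {ι : Type*}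
    [Fintype ι] [Nonempty ι] {X : ι → Matrix b b ℂ} (hX : ∀ i, (X i).conjTranspose * X i = 1) :
    succProb (twirlEnsemble hρ hX) ≤
      (Fintype.card ι : ℝ)⁻¹ * (Fintype.card b * condNorm ρ) := by
  have hc : 0 ≤ condNorm ρ := by
    obtain ⟨α, hα⟩ := exists_isChannel (a := a) (b := b)
    exact (pairing_nonneg hρ.1 hα.1).trans (pairing_le_condNorm hρ.1 hα)
  refine Real.sSup_le ?_ (by positivity)
  rintro _ ⟨M, hM, rfl⟩
  obtain ⟨β, hβ, h⟩ := exists_isChannel_of_twirl hX hM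
  have h1 := h ρ
  have h2 : ∑ i, (twirlEnsemble hρ hX).prob i *
      (((twirlEnsemble hρ hX).state i * M i).trace).re =
      (Fintype.card ι : ℝ)⁻¹ * (Fintype.card b * pairing ρ β) := by
    have h3 : (Fintype.card b : ℝ) * pairing ρ β =
        (∑ i, (ρ * (((1 : Matrix a a ℂ) ⊗ₖ X i).conjTranspose * M i *
          ((1 : Matrix a a ℂ) ⊗ₖ X i))).trace).re := by
      rw [h1, pairing_eq_re, ← Complex.ofReal_natCast, Complex.re_ofReal_mul]
    rw [h3, Complex.re_sum, Finset.mul_sum]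
    refine Finset.sum_congr rfl fun i _ => ?_
    rw [← trace_conj_mul]
    rfl
  rw [h2]
  gcongr
  exact pairing_le_condNorm hρ.1 hβ

variable {k l : ℕ} [Nonempty (Fin k × Fin l)] {V : Fin k → Matrix r₁ r₁ ℂ}
  {W : Fin l → Matrix b₁ b₁ ℂ}
  {ρ : Matrix ((r₀ × b₀) × (r₁ × b₁)) ((r₀ × b₀) × (r₁ × b₁)) ℂ}

/-- Bell outcome j undoes the rotation `W j`, so all l outcomes contribute equally and cancel the
factor 1/l of the prior. What remains is a twirled measurement on the other systems. -/
theorem game_value_twirlEnsemble [DecidableEq r₀] [DecidableEq b₀] (hρ : IsState ρ)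
    (hV : ∀ i, (V i).conjTranspose * V i = 1) (hW : ∀ i, (W i).conjTranspose * W i = 1)
    (α : LMap r₀ (U × a₀)) (Φ : LMap (a₀ × b₀) (a₁ × b₁))
    (N : Fin k → Matrix ((U × a₁) × r₁) ((U × a₁) × r₁) ℂ) (c : ℝ) :
    let E := twirlEnsemble hρ (kronecker_conjTranspose_mul_self hV hW)
    ∑ x : Fin k × Fin l, E.prob x * ((gameMap r₁ α Φ (E.state x) *
      (N x.1 ⊗ₖ ((c : ℂ) • Matrix.vecMulVec (bellVec id (W x.2))
        (star (bellVec id (W x.2)))))).trace).re =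
    (k : ℝ)⁻¹ * c * (∑ i, (contractPair (gameMap r₁ α Φ ρ) *
      (((1 : Matrix (U × a₁) (U × a₁) ℂ) ⊗ₖ V i).conjTranspose * N i *
        ((1 : Matrix (U × a₁) (U × a₁) ℂ) ⊗ₖ V i))).trace).re := by
  intro E
  have hl : (l : ℝ) ≠ 0 := by
    obtain ⟨_, j⟩ := ‹Nonempty (Fin k × Fin l)›
    exact_mod_cast (Fin.pos j).ne'
  have h : ∀ x : Fin k × Fin l, ((gameMap r₁ α Φ (E.state x) *
      (N x.1 ⊗ₖ ((c : ℂ) • Matrix.vecMulVec (bellVec id (W x.2))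
        (star (bellVec id (W x.2)))))).trace).re = c * ((contractPair (gameMap r₁ α Φ ρ) *
      (((1 : Matrix (U × a₁) (U × a₁) ℂ) ⊗ₖ V x.1).conjTranspose * N x.1 *
        ((1 : Matrix (U × a₁) (U × a₁) ℂ) ⊗ₖ V x.1))).trace).re := by
    intro x
    have h1 : gameMap r₁ α Φ (E.state x) = _ := gameMap_conjBy α Φ (V x.1) (W x.2) ρ
    rw [h1]
    rw [trace_conjBy_mul, Matrix.conjTranspose_kronecker, ← Matrix.mul_kronecker_mul,
      ← Matrix.mul_kronecker_mul, Matrix.mul_smul, Matrix.smul_mul, conj_bellVec id (hW x.2),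
      Matrix.kronecker_smul, Matrix.mul_smul, Matrix.trace_smul, trace_mul_kronecker_maxVec,
      smul_eq_mul, Complex.re_ofReal_mul]
  simp only [h]
  change ∑ x : Fin k × Fin l, (Fintype.card (Fin k × Fin l) : ℝ)⁻¹ * _ = _
  rw [Fintype.sum_prod_type, Complex.re_sum, Finset.mul_sum]
  refine Finset.sum_congr rfl fun i _ => ?_
  simp only [Finset.sum_const, Finset.card_univ, Fintype.card_fin, Fintype.card_prod, nsmul_eq_mul,
    Nat.cast_mul, mul_inv]
  field_simp

end TwirledGames

/-! ### From the twirled guessing game back to the distance bound. -/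

section GuessingToDistance

variable {a₀ a₁ a₀' a₁' b₀ b₁ : Type u}
  [Fintype a₀] [Fintype a₁] [Fintype a₀'] [Fintype a₁'] [Fintype b₀] [Fintype b₁]
  [DecidableEq a₁] [DecidableEq a₀'] [DecidableEq a₁'] [DecidableEq b₀] [DecidableEq b₁]
  [Nonempty a₀] [Nonempty a₁'] [Nonempty b₁]
  {Φ₁ : LMap (a₀ × b₀) (a₁ × b₁)} {Φ₂ : LMap (a₀' × b₀) (a₁' × b₁)} {ε : ℝ}

theorem conversionDist_le_of_guessingCondition (hΦ₁ : IsChannel Φ₁) (hΦ₂ : IsChannel Φ₂)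
    (hε : 0 ≤ ε) (h : GuessingCondition Φ₁ Φ₂ ε a₀' a₁') : conversionDist Φ₁ Φ₂ ≤ ε := by
  refine conversionDist_le_of_forall_state hΦ₁ hΦ₂ hε fun ρ hρ η hη => ?_
  obtain ⟨V, hV, hV'⟩ := exists_unitary_basis a₁'
  obtain ⟨W, hW, hW'⟩ := exists_unitary_basis b₁
  set d : ℝ := (Fintype.card a₁' : ℝ) with hd
  set e : ℝ := (Fintype.card b₁ : ℝ) with he
  have hdpos : 0 < d := by rw [hd]; exact_mod_cast Fintype.card_pos
  have hepos : 0 < e := by rw [he]; exact_mod_cast Fintype.card_pos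
  have : Nonempty (Fin (Fintype.card a₁' * Fintype.card a₁') ×
      Fin (Fintype.card b₁ * Fintype.card b₁)) :=
    ⟨⟨0, Nat.mul_pos Fintype.card_pos Fintype.card_pos⟩,
      ⟨0, Nat.mul_pos Fintype.card_pos Fintype.card_pos⟩⟩
  let E := twirlEnsemble hρ (kronecker_conjTranspose_mul_self hV hW)
  let M : Fin (Fintype.card b₁ * Fintype.card b₁) → Matrix (b₁ × b₁) (b₁ × b₁) ℂ := fun j =>
    ((e⁻¹ : ℝ) : ℂ) • Matrix.vecMulVec (bellVec id (W j)) (star (bellVec id (W j)))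
  have hM : IsMeasurement M := isMeasurement_bellVec Function.injective_id hepos
    (by simpa [he] using hW')
  have hcard : ((Fintype.card a₁' * Fintype.card a₁' : ℕ) : ℝ)⁻¹ = d⁻¹ * d⁻¹ := by
    rw [Nat.cast_mul, mul_inv]
  -- Strategy imitating the identity superchannel: trivial ancilla and Bell measurement N. Each of
  -- the d² outcomes gives d⁻¹⟨ρ, Φ₂⟩, and the prior cancels their number.
  have h₂ : d⁻¹ * e⁻¹ * pairing ρ Φ₂ ≤ gameSuccProb Φ₂ M E := by
    let f : PUnit.{u+1} × a₁' → a₁' := Prod.snd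
    let N : Fin (Fintype.card a₁' * Fintype.card a₁') →
        Matrix ((PUnit.{u+1} × a₁') × a₁') ((PUnit.{u+1} × a₁') × a₁') ℂ := fun i =>
      ((d⁻¹ : ℝ) : ℂ) • Matrix.vecMulVec (bellVec f (V i)) (star (bellVec f (V i)))
    have hf : Function.Injective f := (Equiv.punitProd a₁').injective
    have hN : IsMeasurement N := isMeasurement_bellVec hf hdpos (by simpa [hd] using hV')
    let α : LMap a₀' (PUnit.{u+1} × a₀') := relabel (Equiv.punitProd a₀').symm
    have hα : IsChannel α := isChannel_relabel _
    have h1 := game_value_le_gameSuccProb E hα hΦ₂ hM hN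
    refine le_trans (le_of_eq ?_) ((game_value_twirlEnsemble hρ hV hW α Φ₂ N e⁻¹).ge.trans h1)
    have h2 : ∀ i, (contractPair (gameMap a₁' α Φ₂ ρ) *
        (((1 : Matrix (PUnit.{u+1} × a₁') (PUnit.{u+1} × a₁') ℂ) ⊗ₖ V i).conjTranspose * N i *
          ((1 : Matrix (PUnit.{u+1} × a₁') (PUnit.{u+1} × a₁') ℂ) ⊗ₖ V i))).trace =
        ((d⁻¹ : ℝ) : ℂ) * cpairing ρ Φ₂ := by
      intro i
      have h3 : cpairing ρ Φ₂ = cpairing (contractPair (gameMap a₁' α Φ₂ ρ))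
          (relabel (Equiv.punitProd a₁')) := by
        have h5 := cpairing_contractPair_gameMap (Superchannel.refl a₀' a₁') Φ₂ ρ
        rw [Superchannel.refl_apply] at h5
        exact h5.symm
      rw [h3]
      simp only [N]
      rw [Matrix.mul_smul, Matrix.smul_mul, conj_bellVec f (hV i), Matrix.mul_smul,
        Matrix.trace_smul, smul_eq_mul]
      congr 1
      generalize contractPair (gameMap a₁' α Φ₂ ρ) = Z
      rw [Matrix.mul_vecMulVec, Matrix.trace_vecMulVec]
      have h4 : cpairing Z (relabel (Equiv.punitProd a₁')) =
        ∑ i, ∑ j, Z ((PUnit.unit, i), i) ((PUnit.unit, j), j) := rfl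
      rw [h4]
      simp [dotProduct, Matrix.mulVec, maxVec, f, Fintype.sum_prod_type, apply_ite]
    simp only [h2]
    rw [Finset.sum_const, Finset.card_univ, Fintype.card_fin, nsmul_eq_mul, hcard,
      ← Complex.ofReal_natCast, Complex.re_ofReal_mul, Complex.re_ofReal_mul, Nat.cast_mul,
      ← pairing_eq_re, ← hd]
    field_simp
  obtain ⟨B, hB⟩ := exists_pairing_bound ρ
  obtain ⟨Θ₀⟩ := Superchannel.nonempty (a₀ := a₀) (a₁ := a₁) (a₀' := a₀') (a₁' := a₁')
  let S : Set ℝ := Set.range fun Θ : Superchannel a₀ a₁ a₀' a₁' => pairing ρ (Θ.apply Φ₁)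
  have hSne : S.Nonempty := ⟨_, Θ₀, rfl⟩
  have hSbdd : BddAbove S := ⟨B, by
    rintro _ ⟨Θ, rfl⟩
    exact hB _ (Θ.isChannel_apply hΦ₁)⟩
  have hS0 : 0 ≤ sSup S := Real.sSup_nonneg (by
    rintro _ ⟨Θ, rfl⟩
    exact pairing_nonneg hρ.1 (Θ.isChannel_apply hΦ₁).1)
  -- Any strategy (α, N) is the superchannel (α, β) with β obtained by twirling N; since k = d², the
  -- factor is k⁻¹e⁻¹d = d⁻¹e⁻¹.
  have h₁ : gameSuccProb Φ₁ M E ≤ d⁻¹ * e⁻¹ * sSup S := by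
    refine Real.sSup_le ?_ (by positivity)
    rintro _ ⟨U, _, _, α, N, hα, hN, rfl⟩
    obtain ⟨β, hβ, hN'⟩ := exists_isChannel_of_twirl hV hN
    refine (game_value_twirlEnsemble hρ hV hW α Φ₁ N e⁻¹).le.trans ?_
    rw [hN']
    have h2 := cpairing_contractPair_gameMap
      (⟨U, α, β, hα, hβ⟩ : Superchannel a₀ a₁ a₀' a₁') Φ₁ ρ
    simp only at h2
    rw [h2, hcard, ← Complex.ofReal_natCast, Complex.re_ofReal_mul, ← pairing_eq_re, ← hd]
    have h3 : pairing ρ ((⟨U, α, β, hα, hβ⟩ : Superchannel a₀ a₁ a₀' a₁').apply Φ₁) ≤ sSup S :=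
      le_csSup hSbdd ⟨_, rfl⟩
    calc _ = d⁻¹ * e⁻¹ *
          pairing ρ ((⟨U, α, β, hα, hβ⟩ : Superchannel a₀ a₁ a₀' a₁').apply Φ₁) := by field_simp
      _ ≤ _ := by gcongr
  -- There are d²e² ensemble elements and R₁B₁ has dimension de, which gives the same factor again.
  have h₀ : succProb E ≤ d⁻¹ * e⁻¹ * condNorm ρ := by
    refine (succProb_twirlEnsemble_le hρ _).trans (le_of_eq ?_)
    rw [Fintype.card_prod, Fintype.card_prod, Fintype.card_fin, Fintype.card_fin]
    push_cast
    rw [← hd, ← he]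
    field_simp
  have h₃ := h _ _ E M hM
  have h₄ := mul_le_mul_of_nonneg_left h₀ (by linarith : 0 ≤ ε / 2)
  have hκ : 0 < d⁻¹ * e⁻¹ := by positivity
  have h₅ : d⁻¹ * e⁻¹ * pairing ρ Φ₂ ≤ d⁻¹ * e⁻¹ * (sSup S + ε / 2 * condNorm ρ) := by linarith
  have h₆ := le_of_mul_le_mul_left h₅ hκ
  obtain ⟨_, ⟨Θ, rfl⟩, hΘ⟩ := exists_lt_of_lt_csSup hSne (sub_lt_self (sSup S) hη)
  exact ⟨Θ, by linarith⟩

end GuessingToDistance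

end QChan

end

/-! ### The equivalence, closed through the restricted conditions R₀ ≃ A₀', R₁ ≃ A₁'. -/

theorem theorem8 {a₀ a₁ a₀' a₁' b₀ b₁ : Type u}
    [Fintype a₀] [Fintype a₁] [Fintype a₀'] [Fintype a₁'] [Fintype b₀] [Fintype b₁]
    [DecidableEq a₀] [DecidableEq a₁] [DecidableEq a₀'] [DecidableEq a₁']
    [DecidableEq b₀] [DecidableEq b₁]
    [Nonempty a₀] [Nonempty a₁] [Nonempty a₀'] [Nonempty a₁'] [Nonempty b₀] [Nonempty b₁]
    (Φ₁ : QChan.LMap (a₀ × b₀) (a₁ × b₁)) (Φ₂ : QChan.LMap (a₀' × b₀) (a₁' × b₁))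
    (hΦ₁ : QChan.IsChannel Φ₁) (hΦ₂ : QChan.IsChannel Φ₂) (ε : ℝ) (hε : 0 ≤ ε) :
    List.TFAE [
      QChan.conversionDist Φ₁ Φ₂ ≤ ε,
      ∀ (r₀ r₁ : Type u) [Fintype r₀] [Fintype r₁],
        QChan.EntropyCondition Φ₁ Φ₂ ε r₀ r₁,
      ∀ (r₀ r₁ : Type u) [Fintype r₀] [Fintype r₁] [DecidableEq r₀] [DecidableEq r₁],
        QChan.GuessingCondition Φ₁ Φ₂ ε r₀ r₁,
      QChan.EntropyCondition Φ₁ Φ₂ ε a₀' a₁',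
      QChan.GuessingCondition Φ₁ Φ₂ ε a₀' a₁'] := by
  tfae_have 1 → 2 := fun h r₀ r₁ _ _ =>
    QChan.entropyCondition_of_conversionDist_le hΦ₁ hΦ₂ h r₀ r₁
  tfae_have 1 → 3 := fun h r₀ r₁ _ _ _ _ =>
    QChan.guessingCondition_of_conversionDist_le hΦ₁ hΦ₂ hε h r₀ r₁
  tfae_have 2 → 4 := fun h => h a₀' a₁'
  tfae_have 3 → 5 := fun h => h a₀' a₁'
  tfae_have 4 → 1 := QChan.conversionDist_le_of_entropyCondition hΦ₁ hΦ₂ hε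
  tfae_have 5 → 1 := QChan.conversionDist_le_of_guessingCondition hΦ₁ hΦ₂ hε
  tfae_finish
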